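/- **Conventions on fibrations.** A *cartesian fibration* is a (Grothendieck) fibration $\mathfrak p\colon\mathcal E\to\mathcal B$ such that $\mathcal B$ has finite products, each fibre $\mathcal E_I$ has finite products (written $\top$, $\wedge$), and the base change functors $(-)[f]\colon\mathcal E_J\to\mathcal E_I$ along arrows $f\colon I\to J$ of $\mathcal B$ preserve them. A left adjoint of $(-)[f]$ is written $\sum_f$; *Frobenius reciprocity* for $\sum_f$ says that the canonical arrow $\sum_f(X\wedge Y[f])\to\sum_f X\wedge Y$ is invertible for all $X$ and $Y$. For a commutative square $g\circ h=k\circ g'$ the *Beck–Chevalley condition* says that the canonical arrow $\sum_{g'}(X[h])\to(\sum_g X)[k]$ is invertible for all $X$. A cartesian fibration $\mathfrak p$ is * *elementary* if base change along the arrows $\langle 0,0,1\rangle\colon I\times K\to I\times I\times K$ has left adjoints for all $I,K$, which satisfy Frobenius reciprocity and the Beck–Chevalley condition for the squares $\langle 0,0,1\rangle\circ(1_I\times f)=(1_I\times 1_I\times f)\circ\langle 0,0,1\rangle$ with $f\colon K'\to K$; * *existential* if base change along the projections $\pi\colon I\times J\to J$ has left adjoints for all $I,J$, which satisfy Frobenius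 reciprocity and the Beck–Chevalley condition for the squares $\pi\circ(1_I\times f)=f\circ\pi$ with $f\colon J'\to J$; * *elementary existential* if it is both. **Conventions on virtual double categories (VDCs).** A VDC has objects, a category of tight arrows, loose arrows, and cells $\alpha_1,\dots,\alpha_n\Rightarrow\beta$ ($n\ge 0$) from a path of loose arrows to a loose arrow, with tight arrows as left and right sides, composed multicategorically. It is *fibrational* (an FVDC) if every loose arrow has restrictions along every pair of tight arrows into its ends, i.e. there is a cell $\rho\colon\alpha[f,g]\Rightarrow\alpha$ with sides $f,g$ through which every cell into $\alpha$ with sides factoring through $f$ and $g$ factors uniquely. It is *composable* if every path $P$ of loose arrows, also the empty one on each object, has a composite: a cell $P\Rightarrow\gamma$ with identity sides through which every cell with domain $A;P;C$ (for any paths $A$, $C$, and any target and sides) factors uniquely, by a cell with domain $A;\gamma;C$. A *cartesian composable FVDC*, also called a *cartesian equipment*, is a cartesian object in the 2-category of composable FVDCs, functors of VDCs preserving restrictions and composites, and (tight) transformations; that is, a composable FVDC $\mathbb D$ for which the diagonal $\mathbb D\to\mathbb D\times\mathbb D$ and the functor $\mathbb D\to 1$ have right adjoints in this 2-category. **The bilateral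 virtual double category.** For a cartesian fibration $\mathfrak p\colon\mathcal E\to\mathcal B$, the VDC $\mathbb{B}\mathrm{il}[\mathfrak p]$ has as category of objects and tight arrows $\mathcal B$; its loose arrows from $I$ to $J$ are the objects of $\mathcal E_{I\times J}$; for loose arrows $\alpha_i$ from $I_{i-1}$ to $I_i$ ($1\le i\le n$) and $\beta$ from $J$ to $J'$ and tight arrows $s\colon I_0\to J$, $t\colon I_n\to J'$, a cell $\alpha_1,\dots,\alpha_n\Rightarrow\beta$ with sides $s,t$ is an arrow $$\alpha_1[\langle 0,1\rangle]\wedge\dots\wedge\alpha_n[\langle n-1,n\rangle]\longrightarrow\beta$$ of $\mathcal E$ over $(s\times t)\circ\langle 0,n\rangle\colon I_0\times\dots\times I_n\to J\times J'$ (equivalently, an arrow of the fibre over $I_0\times\dots\times I_n$ into $\beta[(s\times t)\circ\langle 0,n\rangle]$), where $\langle i,j\rangle\colon I_0\times\dots\times I_n\to I_i\times I_j$ are the projections. For $n=0$ the domain is $\top\in\mathcal E_{I_0}$, over $I_0$, and $\langle 0,0\rangle$ is the diagonal. Identities and composition of cells are those induced by projections, conjunction and composition in $\mathcal E$. **Theorem.**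 A cartesian fibration $\mathfrak p\colon\mathcal E\to\mathcal B$ is elementary existential if and only if the virtual double category $\mathbb{B}\mathrm{il}[\mathfrak p]$ is a cartesian composable FVDC (that is, a cartesian equipment). -/

import Mathlib

open CategoryTheory CategoryTheory.Limits

attribute [-instance] CategoryTheory.catToReflQuiver

set_option linter.checkUnivs false
set_option linter.unusedSectionVars false

universe u v w x u' v' w' x' u₁ v₁ u₂ v₂

/-! ### Paths of loose arrows -/

/-- A (possibly empty) composable path of arrows of a graph `L` on `O`. -/
inductive LPath {O : Type u} (L : O → O → Type w) : O → O → Type (max u w)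
  | nil (I : O) : LPath L I I
  | cons {I J K : O} (α : L I J) (P : LPath L J K) : LPath L I K

namespace LPath

variable {O : Type u} {L : O → O → Type w}

/-- The path of length one. -/
def single {I J : O} (α : L I J) : LPath L I J := .cons α (.nil J)

/-- Concatenation of paths. -/
def append {I J K : O} : LPath L I J → LPath L J K → LPath L I K
  | .nil _, Q => Q
  | .cons α P, Q => .cons α (append P Q)

theorem append_nil {I J : O} (P : LPath L I J) : P.append (.nil J) = P := by
  induction P with
  | nil => rfl
  | cons α P ih => simp only [append, ih]

theorem append_assoc {I J K M : O} (P : LPath L I J) (Q : LPath L J K) (R : LPath L K M) :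
    (P.append Q).append R = P.append (Q.append R) := by
  induction P with
  | nil => rfl
  | cons α P ih => simp only [append, ih]

/-- The image of a path under a morphism of graphs. -/
def map {O' : Type u'} {L' : O' → O' → Type w'} (F : O → O')
    (G : ∀ {I J : O}, L I J → L' (F I) (F J)) {I J : O} : LPath L I J → LPath L' (F I) (F J)
  | .nil I => .nil (F I)
  | .cons α P => .cons (G α) (map F G P)

theorem map_append {O' : Type u'} {L' : O' → O' → Type w'} (F : O → O')
    (G : ∀ {I J : O}, L I J → L' (F I) (F J)) {I J K : O} (P : LPath L I J) (Q : LPath L J K) :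
    (P.append Q).map F G = (P.map F G).append (Q.map F G) := by
  induction P with
  | nil => rfl
  | cons α P ih => simp only [append, map, ih]

end LPath

/-! ### Virtual double categories -/

/-- The underlying data of a virtual double category: a category of objects and tight arrows,
loose arrows, and cells
```
  I --P--> I'      (P a path of loose arrows)
 s|        |t
  v        v
  J --β--> J'
``` -/
structure VDCData where
  Obj : Type u
  [cat : Category.{v} Obj]
  Loose : Obj → Obj → Type w
  Cell : ∀ {I I' J J' : Obj}, LPath Loose I I' → (I ⟶ J) → (I' ⟶ J') → Loose J J' → Type x

attribute [instance] VDCData.cat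

namespace VDCData

/-- Transport of a cell along equalities of its boundary. -/
def recast (D : VDCData.{u, v, w, x}) {I I' J J' : D.Obj} {P P' : LPath D.Loose I I'}
    {s s' : I ⟶ J} {t t' : I' ⟶ J'} {β : D.Loose J J'} (hP : P = P') (hs : s = s') (ht : t = t')
    (ξ : D.Cell P s t β) : D.Cell P' s' t' β := by
  subst hP hs ht; exact ξ

/-- A horizontally composable sequence `ξ₁, …, ξₙ` of cells: `CellPath D P Q s u` consists of
cells `ξⱼ` with domains paths `P₁, …, Pₙ` whose concatenation is `P`, with codomains the
consecutive members of the path `Q = β₁; …; βₙ`, with outermost tight arrows `s` and `u`. -/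
inductive CellPath (D : VDCData.{u, v, w, x}) : ∀ {I I' J J' : D.Obj},
    LPath D.Loose I I' → LPath D.Loose J J' → (I ⟶ J) → (I' ⟶ J') → Type (max u v w x)
  | nil {I J : D.Obj} (s : I ⟶ J) : CellPath D (.nil I) (.nil J) s s
  | cons {I K I' J M J' : D.Obj} {P₁ : LPath D.Loose I K} {P₂ : LPath D.Loose K I'}
      {P : LPath D.Loose I I'} {β : D.Loose J M} {Q : LPath D.Loose M J'}
      {s : I ⟶ J} {t : K ⟶ M} {u : I' ⟶ J'}
      (ξ : D.Cell P₁ s t β) (Ξ : CellPath D P₂ Q t u) (h : P = P₁.append P₂) :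
      CellPath D P (.cons β Q) s u

namespace CellPath

variable {D : VDCData.{u, v, w, x}}

/-- The sequence consisting of one cell. -/
def single {I I' J J' : D.Obj} {P : LPath D.Loose I I'} {s : I ⟶ J} {t : I' ⟶ J'}
    {β : D.Loose J J'} (ξ : D.Cell P s t β) : CellPath D P (.single β) s t :=
  .cons ξ (.nil t) P.append_nil.symm

/-- Juxtaposition of sequences of cells. -/
def append {I K I' J M J' : D.Obj} {P₁ : LPath D.Loose I K} {Q₁ : LPath D.Loose J M}
    {P₂ : LPath D.Loose K I'} {Q₂ : LPath D.Loose M J'} {P : LPath D.Loose I I'}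
    {Q : LPath D.Loose J J'} {s : I ⟶ J} {t : K ⟶ M} {u : I' ⟶ J'} :
    CellPath D P₁ Q₁ s t → CellPath D P₂ Q₂ t u → P = P₁.append P₂ → Q = Q₁.append Q₂ →
      CellPath D P Q s u
  | .nil _, Ξ', h, hQ => by subst h hQ; exact Ξ'
  | .cons ξ Ξ h₀, Ξ', h, hQ => by
      subst hQ
      exact .cons ξ (append Ξ Ξ' rfl rfl) (by rw [h, h₀, LPath.append_assoc])

theorem cons_append {I N K I' J O M J' : D.Obj} {P₀ : LPath D.Loose I N}
    {P₁ : LPath D.Loose N K} {Q₁ : LPath D.Loose O M} {β : D.Loose J O}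
    {R : LPath D.Loose I K} {P₂ : LPath D.Loose K I'} {Q₂ : LPath D.Loose M J'}
    {P : LPath D.Loose I I'} {Q : LPath D.Loose O J'} {P' : LPath D.Loose N I'}
    {r : I ⟶ J} {s : N ⟶ O} {t : K ⟶ M} {u : I' ⟶ J'}
    (ξ : D.Cell P₀ r s β) (Ξ : CellPath D P₁ Q₁ s t) (h₀ : R = P₀.append P₁)
    (Ξ' : CellPath D P₂ Q₂ t u) (h : P = R.append P₂)
    (hQ : LPath.cons β Q = (LPath.cons β Q₁).append Q₂)
    (hP' : P' = P₁.append P₂) (hQ' : Q = Q₁.append Q₂) (h' : P = P₀.append P') :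
    (CellPath.cons ξ Ξ h₀).append Ξ' h hQ = .cons ξ (Ξ.append Ξ' hP' hQ') h' := by
  subst hP' hQ'; rfl

end CellPath

/-- A two-level arrangement of cells: `CellTree D P Q R s u f h` consists of a sequence of cells
from `P` to `Q` stacked on a sequence of cells from `Q` to `R`, the former grouped according to
the domains of the latter. -/
inductive CellTree (D : VDCData.{u, v, w, x}) : ∀ {I I' J J' K K' : D.Obj},
    LPath D.Loose I I' → LPath D.Loose J J' → LPath D.Loose K K' →
    (I ⟶ J) → (I' ⟶ J') → (J ⟶ K) → (J' ⟶ K') → Type (max u v w x)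
  | nil {I J K : D.Obj} (s : I ⟶ J) (f : J ⟶ K) :
      CellTree D (.nil I) (.nil J) (.nil K) s s f f
  | cons {I I₁ I' J J₁ J' K K₁ K' : D.Obj}
      {P₁ : LPath D.Loose I I₁} {P₂ : LPath D.Loose I₁ I'} {P : LPath D.Loose I I'}
      {Q₁ : LPath D.Loose J J₁} {Q₂ : LPath D.Loose J₁ J'} {Q : LPath D.Loose J J'}
      {γ : D.Loose K K₁} {R : LPath D.Loose K₁ K'}
      {s : I ⟶ J} {t : I₁ ⟶ J₁} {u : I' ⟶ J'} {f : J ⟶ K} {g : J₁ ⟶ K₁} {h : J' ⟶ K'}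
      (Ξ : CellPath D P₁ Q₁ s t) (ζ : D.Cell Q₁ f g γ) (T : CellTree D P₂ Q₂ R t u g h)
      (hP : P = P₁.append P₂) (hQ : Q = Q₁.append Q₂) :
      CellTree D P Q (.cons γ R) s u f h

namespace CellTree

variable {D : VDCData.{u, v, w, x}}

/-- The upper level of a two-level arrangement. -/
def upper {I I' J J' K K' : D.Obj} {P : LPath D.Loose I I'} {Q : LPath D.Loose J J'}
    {R : LPath D.Loose K K'} {s : I ⟶ J} {u : I' ⟶ J'} {f : J ⟶ K} {h : J' ⟶ K'} :
    CellTree D P Q R s u f h → CellPath D P Q s u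
  | .nil s _ => .nil s
  | .cons Ξ _ T hP hQ => CellPath.append Ξ T.upper hP hQ

/-- The lower level of a two-level arrangement. -/
def lower {I I' J J' K K' : D.Obj} {P : LPath D.Loose I I'} {Q : LPath D.Loose J J'}
    {R : LPath D.Loose K K'} {s : I ⟶ J} {u : I' ⟶ J'} {f : J ⟶ K} {h : J' ⟶ K'} :
    CellTree D P Q R s u f h → CellPath D Q R f h
  | .nil _ f => .nil f
  | .cons _ ζ T _ hQ => .cons ζ T.lower hQ

/-- The sequence of cells obtained by composing each cell of the lower level with the cells of
the upper level above it, where `c` is the operation of composition. -/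
def composite (c : ∀ {I I' J J' K K' : D.Obj} {P : LPath D.Loose I I'} {Q : LPath D.Loose J J'}
      {s : I ⟶ J} {u : I' ⟶ J'} {f : J ⟶ K} {g : J' ⟶ K'} {γ : D.Loose K K'},
      CellPath D P Q s u → D.Cell Q f g γ → D.Cell P (s ≫ f) (u ≫ g) γ)
    {I I' J J' K K' : D.Obj} {P : LPath D.Loose I I'} {Q : LPath D.Loose J J'}
    {R : LPath D.Loose K K'} {s : I ⟶ J} {u : I' ⟶ J'} {f : J ⟶ K} {h : J' ⟶ K'} :
    CellTree D P Q R s u f h → CellPath D P R (s ≫ f) (u ≫ h)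
  | .nil s f => .nil (s ≫ f)
  | .cons Ξ ζ T hP _ => .cons (c Ξ ζ) (T.composite c) hP

end CellTree

/-- The sequence of the cells `i α`, for `α` in a path. -/
def idPath (D : VDCData.{u, v, w, x})
    (i : ∀ {I J : D.Obj} (α : D.Loose I J), D.Cell (.single α) (𝟙 I) (𝟙 J) α) {I J : D.Obj} :
    (P : LPath D.Loose I J) → CellPath D P P (𝟙 I) (𝟙 J)
  | .nil I => .nil (𝟙 I)
  | .cons α P => .cons (i α) (D.idPath i P) rfl

end VDCData

open VDCData

/-- A virtual double category. In the composite `comp Ξ ζ ha hb` of a sequence of cells `Ξ` with a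
cell `ζ`, the outer tight arrows `a` and `b` are the composites of those of `Ξ` and `ζ`; they are
recorded through the equations `ha` and `hb`, so that the axioms are plain equations. -/
structure VDC extends VDCData.{u, v, w, x} where
  idCell : ∀ {I J : Obj} (α : Loose I J), Cell (.single α) (𝟙 I) (𝟙 J) α
  comp : ∀ {I I' J J' K K' : Obj} {P : LPath Loose I I'} {Q : LPath Loose J J'}
    {s : I ⟶ J} {u : I' ⟶ J'} {f : J ⟶ K} {g : J' ⟶ K'} {γ : Loose K K'}
    (_ : CellPath toVDCData P Q s u) (_ : Cell Q f g γ) {a : I ⟶ K} {b : I' ⟶ K'}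
    (_ : s ≫ f = a) (_ : u ≫ g = b), Cell P a b γ
  id_comp : ∀ {I I' J J' : Obj} {P : LPath Loose I I'} {s : I ⟶ J} {t : I' ⟶ J'}
    {β : Loose J J'} (ξ : Cell P s t β),
    comp (toVDCData.idPath idCell P) ξ (Category.id_comp s) (Category.id_comp t) = ξ
  comp_id : ∀ {I I' J J' : Obj} {P : LPath Loose I I'} {s : I ⟶ J} {t : I' ⟶ J'}
    {β : Loose J J'} (ξ : Cell P s t β),
    comp (CellPath.single (D := toVDCData) ξ) (idCell β) (Category.comp_id s)
      (Category.comp_id t) = ξ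
  assoc : ∀ {I I' J J' K K' M M' : Obj} {P : LPath Loose I I'} {Q : LPath Loose J J'}
    {R : LPath Loose K K'} {s : I ⟶ J} {u : I' ⟶ J'} {f : J ⟶ K} {h : J' ⟶ K'}
    (T : CellTree toVDCData P Q R s u f h) {k : K ⟶ M} {l : K' ⟶ M'} {δ : Loose M M'}
    (ω : Cell R k l δ),
    comp (T.composite fun Ξ ζ => comp Ξ ζ rfl rfl) ω (Category.assoc s f k) (Category.assoc u h l) =
      comp T.upper (comp T.lower ω rfl rfl) rfl rfl

/-! ### Functors, products and adjunctions of virtual double categories -/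

/-- A morphism of the underlying data of virtual double categories. -/
structure VDCData.Hom (D : VDCData.{u, v, w, x}) (E : VDCData.{u', v', w', x'}) where
  tight : D.Obj ⥤ E.Obj
  loose : ∀ {I J : D.Obj}, D.Loose I J → E.Loose (tight.obj I) (tight.obj J)
  cell : ∀ {I I' J J' : D.Obj} {P : LPath D.Loose I I'} {s : I ⟶ J} {t : I' ⟶ J'}
    {β : D.Loose J J'}, D.Cell P s t β →
    E.Cell (P.map tight.obj loose) (tight.map s) (tight.map t) (loose β)

/-- The image of a sequence of cells. -/
def VDCData.CellPath.map {D : VDCData.{u, v, w, x}} {E : VDCData.{u', v', w', x'}} (F : D.Hom E)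
    {I I' J J' : D.Obj} {P : LPath D.Loose I I'} {Q : LPath D.Loose J J'}
    {s : I ⟶ J} {t : I' ⟶ J'} : CellPath D P Q s t →
    CellPath E (P.map F.tight.obj F.loose) (Q.map F.tight.obj F.loose) (F.tight.map s)
      (F.tight.map t)
  | .nil s => .nil (F.tight.map s)
  | .cons ξ Ξ h => .cons (F.cell ξ) (Ξ.map F) (by rw [h, LPath.map_append])

/-- A functor of virtual double categories. -/
structure VDC.Functor (D : VDC.{u, v, w, x}) (E : VDC.{u', v', w', x'}) extends
    D.toVDCData.Hom E.toVDCData where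
  map_id : ∀ {I J : D.Obj} (α : D.Loose I J),
    E.recast rfl (tight.map_id I) (tight.map_id J) (cell (D.idCell α)) = E.idCell (loose α)
  map_comp : ∀ {I I' J J' K K' : D.Obj} {P : LPath D.Loose I I'} {Q : LPath D.Loose J J'}
    {s : I ⟶ J} {u : I' ⟶ J'} {f : J ⟶ K} {g : J' ⟶ K'} {γ : D.Loose K K'}
    (Ξ : CellPath D.toVDCData P Q s u) (ζ : D.Cell Q f g γ),
    cell (D.comp Ξ ζ rfl rfl) =
      E.comp (Ξ.map toHom) (cell ζ) (tight.map_comp s f).symm (tight.map_comp u g).symm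

/-- The product of the data of two virtual double categories. -/
def VDCData.prod (D : VDCData.{u, v, w, x}) (E : VDCData.{u', v', w', x'}) :
    VDCData.{max u u', max v v', max w w', max x x'} where
  Obj := D.Obj × E.Obj
  Loose I J := D.Loose I.1 J.1 × E.Loose I.2 J.2
  Cell P s t β :=
    D.Cell (P.map (CategoryTheory.Prod.fst D.Obj E.Obj).obj fun α => α.1)
      ((CategoryTheory.Prod.fst D.Obj E.Obj).map s)
      ((CategoryTheory.Prod.fst D.Obj E.Obj).map t) β.1 ×
    E.Cell (P.map (CategoryTheory.Prod.snd D.Obj E.Obj).obj fun α => α.2)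
      ((CategoryTheory.Prod.snd D.Obj E.Obj).map s)
      ((CategoryTheory.Prod.snd D.Obj E.Obj).map t) β.2

/-- The first projection. -/
def VDCData.fst (D : VDCData.{u, v, w, x}) (E : VDCData.{u', v', w', x'}) :
    (D.prod E).Hom D where
  tight := CategoryTheory.Prod.fst D.Obj E.Obj
  loose α := α.1
  cell ξ := ξ.1

/-- The second projection. -/
def VDCData.snd (D : VDCData.{u, v, w, x}) (E : VDCData.{u', v', w', x'}) :
    (D.prod E).Hom E where
  tight := CategoryTheory.Prod.snd D.Obj E.Obj
  loose α := α.2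
  cell ξ := ξ.2

theorem VDCData.CellPath.map_append {D : VDCData.{u, v, w, x}} {E : VDCData.{u', v', w', x'}}
    (F : D.Hom E) {I K I' J M J' : D.Obj} {P₁ : LPath D.Loose I K} {Q₁ : LPath D.Loose J M}
    {P₂ : LPath D.Loose K I'} {Q₂ : LPath D.Loose M J'} {P : LPath D.Loose I I'}
    {Q : LPath D.Loose J J'} {s : I ⟶ J} {t : K ⟶ M} {u : I' ⟶ J'}
    (Ξ : CellPath D P₁ Q₁ s t) (Ξ' : CellPath D P₂ Q₂ t u) (h : P = P₁.append P₂)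
    (hQ : Q = Q₁.append Q₂) :
    CellPath.map F (Ξ.append Ξ' h hQ) = (Ξ.map F).append (Ξ'.map F)
      (by rw [h, LPath.map_append]) (by rw [hQ, LPath.map_append]) := by
  induction Ξ with
  | nil =>
    obtain rfl : P = P₂ := h
    obtain rfl : Q = Q₂ := hQ
    rfl
  | cons ξ Ξ h₀ ih =>
    subst h h₀ hQ
    refine Eq.trans ?_ (cons_append (F.cell ξ) (Ξ.map F) _ (Ξ'.map F) _ _
      (LPath.map_append ..) (LPath.map_append ..)
      (by rw [LPath.append_assoc, LPath.map_append, LPath.map_append])).symm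
    rw [← ih Ξ' rfl rfl]
    rfl

/-- The image of a two-level arrangement of cells. -/
def VDCData.CellTree.map {D : VDCData.{u, v, w, x}} {E : VDCData.{u', v', w', x'}} (F : D.Hom E)
    {I I' J J' K K' : D.Obj} {P : LPath D.Loose I I'} {Q : LPath D.Loose J J'}
    {R : LPath D.Loose K K'} {s : I ⟶ J} {u : I' ⟶ J'} {f : J ⟶ K} {h : J' ⟶ K'} :
    CellTree D P Q R s u f h →
    CellTree E (P.map F.tight.obj F.loose) (Q.map F.tight.obj F.loose)
      (R.map F.tight.obj F.loose) (F.tight.map s) (F.tight.map u) (F.tight.map f)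
      (F.tight.map h)
  | .nil s f => .nil (F.tight.map s) (F.tight.map f)
  | .cons Ξ ζ T hP hQ => .cons (Ξ.map F) (F.cell ζ) (T.map F)
      (by rw [hP, LPath.map_append]) (by rw [hQ, LPath.map_append])

theorem VDCData.CellTree.upper_map {D : VDCData.{u, v, w, x}} {E : VDCData.{u', v', w', x'}}
    (F : D.Hom E) {I I' J J' K K' : D.Obj} {P : LPath D.Loose I I'} {Q : LPath D.Loose J J'}
    {R : LPath D.Loose K K'} {s : I ⟶ J} {u : I' ⟶ J'} {f : J ⟶ K} {h : J' ⟶ K'}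
    (T : CellTree D P Q R s u f h) : (T.map F).upper = T.upper.map F := by
  induction T with
  | nil => rfl
  | cons Ξ ζ T hP hQ ih =>
    exact (congrArg (fun X => CellPath.append _ X _ _) ih).trans (CellPath.map_append ..).symm

theorem VDCData.CellTree.lower_map {D : VDCData.{u, v, w, x}} {E : VDCData.{u', v', w', x'}}
    (F : D.Hom E) {I I' J J' K K' : D.Obj} {P : LPath D.Loose I I'} {Q : LPath D.Loose J J'}
    {R : LPath D.Loose K K'} {s : I ⟶ J} {u : I' ⟶ J'} {f : J ⟶ K} {h : J' ⟶ K'}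
    (T : CellTree D P Q R s u f h) : (T.map F).lower = T.lower.map F := by
  induction T with
  | nil => rfl
  | cons Ξ ζ T hP hQ ih => exact congrArg (fun X => CellPath.cons _ X _) ih

namespace VDC

/-- The product of two virtual double categories, with componentwise structure. -/
def prod (D : VDC.{u, v, w, x}) (E : VDC.{u', v', w', x'}) :
    VDC.{max u u', max v v', max w w', max x x'} where
  toVDCData := D.toVDCData.prod E.toVDCData
  idCell α := (D.idCell α.1, E.idCell α.2)
  comp Ξ ζ _ _ ha hb :=
    (D.comp (Ξ.map (D.toVDCData.fst E.toVDCData)) ζ.1 (congrArg Prod.fst ha)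
        (congrArg Prod.fst hb),
      E.comp (Ξ.map (D.toVDCData.snd E.toVDCData)) ζ.2 (congrArg Prod.snd ha)
        (congrArg Prod.snd hb))
  id_comp {I I' J J' P s t β} ξ := by
    have h₁ : ∀ {I I' : (D.toVDCData.prod E.toVDCData).Obj}
        (P : LPath (D.toVDCData.prod E.toVDCData).Loose I I'),
        CellPath.map (D.toVDCData.fst E.toVDCData)
        (VDCData.idPath (D.toVDCData.prod E.toVDCData)
          (fun α => (D.idCell α.1, E.idCell α.2)) P) = D.idPath D.idCell _ := by
      intro I I' P
      induction P with
      | nil I => rfl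
      | cons α P ih =>
        change CellPath.cons _ (CellPath.map _ _) _ = CellPath.cons _ _ _
        rw [ih]; rfl
    have h₂ : ∀ {I I' : (D.toVDCData.prod E.toVDCData).Obj}
        (P : LPath (D.toVDCData.prod E.toVDCData).Loose I I'),
        CellPath.map (D.toVDCData.snd E.toVDCData)
        (VDCData.idPath (D.toVDCData.prod E.toVDCData)
          (fun α => (D.idCell α.1, E.idCell α.2)) P) = E.idPath E.idCell _ := by
      intro I I' P
      induction P with
      | nil I => rfl
      | cons α P ih =>
        change CellPath.cons _ (CellPath.map _ _) _ = CellPath.cons _ _ _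
        rw [ih]; rfl
    refine Prod.ext ?_ ?_
    · refine Eq.trans ?_ (D.id_comp ξ.1)
      dsimp only
      rw [h₁]; rfl
    · refine Eq.trans ?_ (E.id_comp ξ.2)
      dsimp only
      rw [h₂]; rfl
  comp_id ξ := Prod.ext (D.comp_id ξ.1) (E.comp_id ξ.2)
  assoc T k l _ ω := by
    refine Prod.ext ?_ ?_
    · refine Eq.trans ?_ ((D.assoc (T.map (D.toVDCData.fst E.toVDCData)) ω.1).trans ?_)
      · dsimp only
        congr 1
        clear ω k l
        induction T with
        | nil => rfl
        | cons Ξ ζ T hP hQ ih =>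
          change CellPath.cons _ (CellPath.map _ _) _ = CellPath.cons _ _ _
          rw [ih]; rfl
      · rw [CellTree.upper_map, CellTree.lower_map]; rfl
    · refine Eq.trans ?_ ((E.assoc (T.map (D.toVDCData.snd E.toVDCData)) ω.2).trans ?_)
      · dsimp only
        congr 1
        clear ω k l
        induction T with
        | nil => rfl
        | cons Ξ ζ T hP hQ ih =>
          change CellPath.cons _ (CellPath.map _ _) _ = CellPath.cons _ _ _
          rw [ih]; rfl
      · rw [CellTree.upper_map, CellTree.lower_map]; rfl

/-- The terminal virtual double category. -/
def terminal : VDC.{u, v, w, x} where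
  Obj := PUnit
  cat := { Hom := fun _ _ => PUnit, id := fun _ => ⟨⟩, comp := fun _ _ => ⟨⟩ }
  Loose _ _ := PUnit
  Cell _ _ _ _ := PUnit
  idCell _ := ⟨⟩
  comp _ _ _ _ _ _ := ⟨⟩
  id_comp _ := rfl
  comp_id _ := rfl
  assoc _ _ _ _ _ := rfl

/-- The functor to the terminal virtual double category. -/
def toTerminal (D : VDC.{u, v, w, x}) : VDC.Functor D terminal.{u', v', w', x'} where
  tight := { obj := fun _ => PUnit.unit, map := fun _ => PUnit.unit }
  loose _ := ⟨⟩
  cell _ := ⟨⟩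
  map_id _ := rfl
  map_comp _ _ := rfl

theorem map_diag_fst {D : VDC.{u, v, w, x}} {I J : D.Obj} (P : LPath D.Loose I J) :
    P = (P.map (L' := (D.prod D).Loose) (Functor.diag D.Obj).obj fun α => (α, α)).map
      (CategoryTheory.Prod.fst D.Obj D.Obj).obj fun α => α.1 := by
  induction P with
  | nil => rfl
  | cons α P ih => exact congrArg (LPath.cons α) ih

theorem map_diag_snd {D : VDC.{u, v, w, x}} {I J : D.Obj} (P : LPath D.Loose I J) :
    P = (P.map (L' := (D.prod D).Loose) (Functor.diag D.Obj).obj fun α => (α, α)).map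
      (CategoryTheory.Prod.snd D.Obj D.Obj).obj fun α => α.2 := by
  induction P with
  | nil => rfl
  | cons α P ih => exact congrArg (LPath.cons α) ih

/-- The data of the diagonal functor. -/
def diagHom (D : VDC.{u, v, w, x}) : D.toVDCData.Hom (D.prod D).toVDCData where
  tight := Functor.diag D.Obj
  loose α := (α, α)
  cell ξ := (D.recast (map_diag_fst _) rfl rfl ξ, D.recast (map_diag_snd _) rfl rfl ξ)

theorem recast_cons (D : VDCData.{u, v, w, x}) {I K I' J M J' : D.Obj}
    {P₁ P₁' : LPath D.Loose I K} {P₂ P₂' : LPath D.Loose K I'} {P P' : LPath D.Loose I I'}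
    {β : D.Loose J M} {Q Q' : LPath D.Loose M J'} {s : I ⟶ J} {t : K ⟶ M} {u : I' ⟶ J'}
    (ξ : D.Cell P₁ s t β) (Ξ : CellPath D P₂ Q t u) (h : P = P₁.append P₂)
    (h₁ : P₁ = P₁') (h₂ : P₂ = P₂') (hP : P = P') (hQ : Q = Q')
    (hQ' : LPath.cons β Q = LPath.cons β Q') (h' : P' = P₁'.append P₂') :
    Eq.rec (motive := fun X _ => CellPath D P' X s u)
      (Eq.rec (motive := fun X _ => CellPath D X (.cons β Q) s u) (CellPath.cons ξ Ξ h) hP) hQ' =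
    CellPath.cons (D.recast h₁ rfl rfl ξ)
      (Eq.rec (motive := fun X _ => CellPath D P₂' X t u)
        (Eq.rec (motive := fun X _ => CellPath D X Q t u) Ξ h₂) hQ) h' := by
  subst h₁ h₂ hP hQ; rfl

theorem recast_comp (D : VDC.{u, v, w, x}) {I I' J J' K K' : D.Obj} {P P' : LPath D.Loose I I'}
    {Q Q' : LPath D.Loose J J'} {s : I ⟶ J} {u : I' ⟶ J'} {f : J ⟶ K} {g : J' ⟶ K'}
    {γ : D.Loose K K'} (Ξ : CellPath D.toVDCData P Q s u) (ζ : D.Cell Q f g γ)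
    (hP : P = P') (hQ : Q = Q') :
    D.recast hP rfl rfl (D.comp Ξ ζ rfl rfl) =
      D.comp (Eq.rec (motive := fun X _ => CellPath D.toVDCData P' X s u)
        (Eq.rec (motive := fun X _ => CellPath D.toVDCData X Q s u) Ξ hP) hQ)
        (D.recast hQ rfl rfl ζ) rfl rfl := by
  subst hP hQ; rfl

/-- The diagonal functor. -/
def diag (D : VDC.{u, v, w, x}) : VDC.Functor D (D.prod D) where
  toHom := diagHom D
  map_id _ := rfl
  map_comp {I I' J J' K K' P Q s u f g γ} Ξ ζ := by
    refine Prod.ext ?_ ?_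
    · refine (recast_comp D Ξ ζ (map_diag_fst _) (map_diag_fst _)).trans ?_
      change D.comp _ _ _ _ = D.comp _ _ _ _
      congr 1
      clear ζ f g
      induction Ξ with
      | nil => rfl
      | cons ξ Ξ h ih =>
        exact (recast_cons _ ξ Ξ h (map_diag_fst _) (map_diag_fst _) _ (map_diag_fst _) _
          (by rw [← map_diag_fst, ← map_diag_fst, ← map_diag_fst]; exact h)).trans
          (congrArg (fun X => CellPath.cons _ X _) ih)
    · refine (recast_comp D Ξ ζ (map_diag_snd _) (map_diag_snd _)).trans ?_
      change D.comp _ _ _ _ = D.comp _ _ _ _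
      congr 1
      clear ζ f g
      induction Ξ with
      | nil => rfl
      | cons ξ Ξ h ih =>
        exact (recast_cons _ ξ Ξ h (map_diag_snd _) (map_diag_snd _) _ (map_diag_snd _) _
          (by rw [← map_diag_snd, ← map_diag_snd, ← map_diag_snd]; exact h)).trans
          (congrArg (fun X => CellPath.cons _ X _) ih)

end VDC

/-- The sequence of the cells `c α`, for `α` in a path, from the path to its image under `F`
followed by `G`. -/
def VDCData.Hom.unitPath {D : VDCData.{u, v, w, x}} {E : VDCData.{u', v', w', x'}}
    (F : D.Hom E) (G : E.Hom D) (η : ∀ I : D.Obj, I ⟶ G.tight.obj (F.tight.obj I))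
    (c : ∀ {I J : D.Obj} (α : D.Loose I J),
      D.Cell (.single α) (η I) (η J) (G.loose (F.loose α))) {I J : D.Obj} :
    (P : LPath D.Loose I J) → CellPath D P
      ((P.map F.tight.obj F.loose).map G.tight.obj G.loose) (η I) (η J)
  | .nil I => .nil (η I)
  | .cons α P => .cons (c α) (F.unitPath G η c P) rfl

/-- The sequence of the cells `c α`, for `α` in a path, from the image of the path under `G`
followed by `F` to the path. -/
def VDCData.Hom.counitPath {D : VDCData.{u, v, w, x}} {E : VDCData.{u', v', w', x'}}
    (F : D.Hom E) (G : E.Hom D) (ε : ∀ I : E.Obj, F.tight.obj (G.tight.obj I) ⟶ I)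
    (c : ∀ {I J : E.Obj} (α : E.Loose I J),
      E.Cell (.single (F.loose (G.loose α))) (ε I) (ε J) α) {I J : E.Obj} :
    (P : LPath E.Loose I J) → CellPath E
      ((P.map G.tight.obj G.loose).map F.tight.obj F.loose) P (ε I) (ε J)
  | .nil I => .nil (ε I)
  | .cons α P => .cons (c α) (F.counitPath G ε c P) rfl

namespace VDC

/-- An adjunction `F ⊣ G` in the 2-category of virtual double categories, functors and (tight)
transformations: an adjunction between the tight categories, together with cells
```
  I ----α----> J            FGI --FGα--> FGJ
 η|            |η            ε|           |ε
  v            v              v           v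
 GFI --GFα--> GFJ             I ----α---> J
```
which are natural with respect to all cells and satisfy the triangle identities. -/
structure Adjunction {D : VDC.{u, v, w, x}} {E : VDC.{u', v', w', x'}}
    (F : VDC.Functor D E) (G : VDC.Functor E D) where
  tight : F.tight ⊣ G.tight
  unit : ∀ {I J : D.Obj} (α : D.Loose I J),
    D.Cell (.single α) (tight.unit.app I) (tight.unit.app J) (G.loose (F.loose α))
  counit : ∀ {I J : E.Obj} (α : E.Loose I J),
    E.Cell (.single (F.loose (G.loose α))) (tight.counit.app I) (tight.counit.app J) α
  unit_naturality : ∀ {I I' J J' : D.Obj} {P : LPath D.Loose I I'} {s : I ⟶ J} {t : I' ⟶ J'}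
    {β : D.Loose J J'} (ξ : D.Cell P s t β),
    D.comp (CellPath.single (D := D.toVDCData) ξ) (unit β) rfl rfl =
      D.comp (F.toHom.unitPath G.toHom tight.unit.app unit P) (G.cell (F.cell ξ))
        (tight.unit.naturality s).symm (tight.unit.naturality t).symm
  counit_naturality : ∀ {I I' J J' : E.Obj} {P : LPath E.Loose I I'} {s : I ⟶ J} {t : I' ⟶ J'}
    {β : E.Loose J J'} (ξ : E.Cell P s t β),
    E.comp (CellPath.single (D := E.toVDCData) (F.cell (G.cell ξ))) (counit β)
        (tight.counit.naturality s) (tight.counit.naturality t) =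
      E.comp (F.toHom.counitPath G.toHom tight.counit.app counit P) ξ rfl rfl
  left_triangle : ∀ {I J : D.Obj} (α : D.Loose I J),
    E.comp (CellPath.single (D := E.toVDCData) (F.cell (unit α))) (counit (F.loose α))
      (tight.left_triangle_components I) (tight.left_triangle_components J) =
      E.idCell (F.loose α)
  right_triangle : ∀ {I J : E.Obj} (α : E.Loose I J),
    D.comp (CellPath.single (D := D.toVDCData) (unit (G.loose α))) (G.cell (counit α))
      (tight.right_triangle_components I) (tight.right_triangle_components J) =
      D.idCell (G.loose α)

/-! ### Fibrational, composable and cartesian virtual double categories -/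

variable (D : VDC.{u, v, w, x})

/-- A cell `ρ` from a single loose arrow `α'` to `α` exhibits `α'` as the restriction of `α` along
`f` and `g` if each cell with target `α` whose tight sides factor through `f` and `g` factors
uniquely through `ρ`. -/
def IsRestriction {I' J' I J : D.Obj} {α' : D.Loose I' J'} {f : I' ⟶ I} {g : J' ⟶ J}
    {α : D.Loose I J} (ρ : D.Cell (.single α') f g α) : Prop :=
  ∀ {K K' : D.Obj} (P : LPath D.Loose K K') (h : K ⟶ I') (k : K' ⟶ J')
    (ξ : D.Cell P (h ≫ f) (k ≫ g) α),
    ∃! ξ' : D.Cell P h k α', D.comp (CellPath.single (D := D.toVDCData) ξ') ρ rfl rfl = ξ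

/-- A virtual double category is fibrational if it has all restrictions. -/
def IsFibrational : Prop :=
  ∀ {I' J' I J : D.Obj} (f : I' ⟶ I) (g : J' ⟶ J) (α : D.Loose I J),
    ∃ (α' : D.Loose I' J') (ρ : D.Cell (.single α') f g α), D.IsRestriction ρ

/-- The sequence of cells `1, …, 1, κ, 1, …, 1` from `A; P; C` to `A; γ; C`. -/
def whisker {H I J K : D.Obj} (A : LPath D.Loose H I) {P : LPath D.Loose I J} {γ : D.Loose I J}
    (κ : D.Cell P (𝟙 I) (𝟙 J) γ) (C : LPath D.Loose J K) :
    CellPath D.toVDCData (A.append (P.append C)) (A.append (.cons γ C)) (𝟙 H) (𝟙 K) :=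
  (D.idPath D.idCell A).append (.cons κ (D.idPath D.idCell C) rfl) rfl rfl

/-- A cell `κ : P ⇒ γ` with identity tight sides is composing (it exhibits `γ` as the composite of
the path `P`; as the unit if `P` is empty) if each cell from a path `A; P; C` factors
uniquely through `κ`. -/
def IsComposing {I J : D.Obj} {P : LPath D.Loose I J} {γ : D.Loose I J}
    (κ : D.Cell P (𝟙 I) (𝟙 J) γ) : Prop :=
  ∀ {H K H' K' : D.Obj} (A : LPath D.Loose H I) (C : LPath D.Loose J K) (f : H ⟶ H')
    (g : K ⟶ K') (δ : D.Loose H' K') (ν : D.Cell (A.append (P.append C)) f g δ),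
    ∃! ν' : D.Cell (A.append (.cons γ C)) f g δ,
      D.comp (D.whisker A κ C) ν' (Category.id_comp f) (Category.id_comp g) = ν

/-- A virtual double category is composable if all paths of loose arrows, including the empty
ones, have composites. -/
def IsComposable : Prop :=
  ∀ {I J : D.Obj} (P : LPath D.Loose I J),
    ∃ (γ : D.Loose I J) (κ : D.Cell P (𝟙 I) (𝟙 J) γ), D.IsComposing κ

variable {D}

/-- Preservation of restrictions. -/
def Functor.PreservesRestrictions {E : VDC.{u', v', w', x'}} (F : VDC.Functor D E) : Prop :=
  ∀ {I' J' I J : D.Obj} {α' : D.Loose I' J'} {f : I' ⟶ I} {g : J' ⟶ J} {α : D.Loose I J}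
    (ρ : D.Cell (.single α') f g α), D.IsRestriction ρ →
      E.IsRestriction (α' := F.loose α') (F.cell ρ)

/-- Preservation of composites. -/
def Functor.PreservesComposites {E : VDC.{u', v', w', x'}} (F : VDC.Functor D E) : Prop :=
  ∀ {I J : D.Obj} {P : LPath D.Loose I J} {γ : D.Loose I J} (κ : D.Cell P (𝟙 I) (𝟙 J) γ),
    D.IsComposing κ →
      E.IsComposing (E.recast rfl (F.tight.map_id I) (F.tight.map_id J) (F.cell κ))

/-- The functor `F` has a right adjoint in the 2-category whose 1-cells are the functors that
preserve restrictions and composites, and whose 2-cells are all transformations. -/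
def Functor.HasRightAdjoint {E : VDC.{u', v', w', x'}} (F : VDC.Functor D E) : Prop :=
  ∃ G : VDC.Functor E D, G.PreservesRestrictions ∧ G.PreservesComposites ∧
    Nonempty (VDC.Adjunction F G)

/-- A cartesian composable fibrational virtual double category, also called a cartesian equipment: a
cartesian object in the 2-category of composable fibrational virtual double categories, functors
preserving restrictions and composites, and all transformations. -/
structure IsCartesianComposableFVDC (D : VDC.{u, v, w, x}) : Prop where
  fibrational : D.IsFibrational
  composable : D.IsComposable
  diag : (VDC.diag D).HasRightAdjoint
  toTerminal : (VDC.toTerminal.{u, v, w, x, u, v, w, x} D).HasRightAdjoint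

end VDC

/-! ### Fibrations -/

namespace Fibration

section

variable {B : Type u₁} [Category.{v₁} B] {E : Type u₂} [Category.{v₂} E] (p : E ⥤ B)

/-- The arrows of the total category from `X` to `Y` over an arrow `f` of the base. -/
structure OverHom {S T : B} (f : S ⟶ T) (X : p.Fiber S) (Y : p.Fiber T) : Type v₂ where
  hom : (Functor.Fiber.fiberInclusion.obj X : E) ⟶ Functor.Fiber.fiberInclusion.obj Y
  isHomLift : p.IsHomLift f hom

attribute [instance] OverHom.isHomLift

namespace OverHom

variable {p}

theorem ext {S T : B} {f : S ⟶ T} {X : p.Fiber S} {Y : p.Fiber T} {φ ψ : OverHom p f X Y}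
    (h : φ.hom = ψ.hom) : φ = ψ := by
  cases φ; cases ψ; cases h; rfl

/-- Composition of arrows over arrows of the base. -/
def comp {R S T : B} {f : R ⟶ S} {g : S ⟶ T} {k : R ⟶ T} {X : p.Fiber R} {Y : p.Fiber S}
    {Z : p.Fiber T} (φ : OverHom p f X Y) (ψ : OverHom p g Y Z) (h : f ≫ g = k) :
    OverHom p k X Z :=
  ⟨φ.hom ≫ ψ.hom, h ▸ inferInstance⟩

/-- An arrow of a fibre, seen as an arrow over the identity. -/
def ofFiber {S : B} {X Y : p.Fiber S} (φ : X ⟶ Y) : OverHom p (𝟙 S) X Y :=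
  ⟨Functor.Fiber.fiberInclusion.map φ, inferInstance⟩

/-- An arrow over the identity, seen as an arrow of a fibre. -/
def toFiber {S : B} {X Y : p.Fiber S} (φ : OverHom p (𝟙 S) X Y) : X ⟶ Y :=
  ⟨φ.hom, φ.isHomLift⟩

theorem fiberInclusion_map_toFiber {S : B} {X Y : p.Fiber S} (φ : OverHom p (𝟙 S) X Y) :
    Functor.Fiber.fiberInclusion.map φ.toFiber = φ.hom := rfl

end OverHom

variable [p.IsFibered]

/-- The base change `Y[f]` of `Y` along `f`. -/
noncomputable def pull {S T : B} (f : S ⟶ T) (Y : p.Fiber T) : p.Fiber S :=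
  ⟨Functor.IsPreFibered.pullbackObj Y.2 f, Functor.IsPreFibered.pullbackObj_proj Y.2 f⟩

/-- The cartesian arrow `Y[f] ⟶ Y` over `f`. -/
noncomputable def pullMap {S T : B} (f : S ⟶ T) (Y : p.Fiber T) : OverHom p f (pull p f Y) Y :=
  ⟨Functor.IsPreFibered.pullbackMap Y.2 f,
    (Functor.IsPreFibered.pullbackMap.IsCartesian Y.2 f).toIsHomLift⟩

instance {S T : B} (f : S ⟶ T) (Y : p.Fiber T) : p.IsCartesian f (pullMap p f Y).hom :=
  Functor.IsPreFibered.pullbackMap.IsCartesian Y.2 f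

/-- The arrow `X ⟶ Y[f]` over `g` induced by an arrow `X ⟶ Y` over `g ≫ f`. -/
noncomputable def pullLift {R S T : B} {g : R ⟶ S} {f : S ⟶ T} {k : R ⟶ T} (h : g ≫ f = k)
    {X : p.Fiber R} {Y : p.Fiber T} (φ : OverHom p k X Y) : OverHom p g X (pull p f Y) :=
  ⟨Functor.IsStronglyCartesian.map p f (pullMap p f Y).hom h.symm φ.hom, inferInstance⟩

theorem pullLift_fac {R S T : B} {g : R ⟶ S} {f : S ⟶ T} {k : R ⟶ T} (h : g ≫ f = k)
    {X : p.Fiber R} {Y : p.Fiber T} (φ : OverHom p k X Y) :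
    (pullLift p h φ).hom ≫ (pullMap p f Y).hom = φ.hom :=
  Functor.IsStronglyCartesian.fac p f (pullMap p f Y).hom h.symm φ.hom

theorem pull_ext {R S T : B} {g : R ⟶ S} {f : S ⟶ T} {X : p.Fiber R} {Y : p.Fiber T}
    {φ ψ : OverHom p g X (pull p f Y)}
    (h : φ.hom ≫ (pullMap p f Y).hom = ψ.hom ≫ (pullMap p f Y).hom) : φ = ψ :=
  OverHom.ext (Functor.IsStronglyCartesian.ext p f (pullMap p f Y).hom g h)

/-- The base change functor along `f`. -/
noncomputable def baseChange {S T : B} (f : S ⟶ T) : p.Fiber T ⥤ p.Fiber S where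
  obj Y := pull p f Y
  map φ := (pullLift p (Category.id_comp f)
    ((pullMap p f _).comp (OverHom.ofFiber φ) (Category.comp_id f))).toFiber
  map_id Y := by
    apply Functor.Fiber.hom_ext
    refine congrArg OverHom.hom (pull_ext p (ψ := OverHom.ofFiber (𝟙 (pull p f Y))) ?_)
    rw [pullLift_fac]
    simp [OverHom.comp, OverHom.ofFiber]
  map_comp {X Y Z} φ ψ := by
    apply Functor.Fiber.hom_ext
    rw [Functor.map_comp]
    simp only [OverHom.fiberInclusion_map_toFiber]
    refine congrArg OverHom.hom (pull_ext p (ψ := OverHom.comp _ _ (Category.id_comp _)) ?_)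
    rw [pullLift_fac]
    simp only [OverHom.comp, OverHom.ofFiber, Category.assoc, pullLift_fac, Functor.map_comp]
    rw [← Category.assoc, ← Category.assoc, pullLift_fac]

theorem baseChange_map_fac {S T : B} (f : S ⟶ T) {X Y : p.Fiber T} (φ : X ⟶ Y) :
    Functor.Fiber.fiberInclusion.map ((baseChange p f).map φ) ≫ (pullMap p f Y).hom =
      (pullMap p f X).hom ≫ Functor.Fiber.fiberInclusion.map φ :=
  pullLift_fac p (Category.id_comp f) _

/-- The arrow `X ⟶ Y[f]` of the fibre induced by an arrow `X ⟶ Y` over `f`. -/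
noncomputable def toPull {S T : B} {f : S ⟶ T} {X : p.Fiber S} {Y : p.Fiber T}
    (φ : OverHom p f X Y) : X ⟶ (baseChange p f).obj Y :=
  (pullLift p (Category.id_comp f) φ).toFiber

theorem toPull_fac {S T : B} {f : S ⟶ T} {X : p.Fiber S} {Y : p.Fiber T} (φ : OverHom p f X Y) :
    Functor.Fiber.fiberInclusion.map (toPull p φ) ≫ (pullMap p f Y).hom = φ.hom :=
  pullLift_fac p (Category.id_comp f) φ

/-- The arrow `X ⟶ Y` over `f` that corresponds to an arrow `X ⟶ Y[f]` of the fibre. -/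
noncomputable def ofPull {S T : B} {f : S ⟶ T} {X : p.Fiber S} {Y : p.Fiber T}
    (φ : X ⟶ (baseChange p f).obj Y) : OverHom p f X Y :=
  (OverHom.ofFiber φ).comp (pullMap p f Y) (Category.id_comp f)

theorem ofPull_toPull {S T : B} {f : S ⟶ T} {X : p.Fiber S} {Y : p.Fiber T}
    (φ : OverHom p f X Y) : ofPull p (toPull p φ) = φ :=
  OverHom.ext (toPull_fac p φ)

theorem fiber_ext {S T : B} {f : S ⟶ T} {X : p.Fiber S} {Y : p.Fiber T}
    {φ ψ : X ⟶ (baseChange p f).obj Y}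
    (h : Functor.Fiber.fiberInclusion.map φ ≫ (pullMap p f Y).hom =
      Functor.Fiber.fiberInclusion.map ψ ≫ (pullMap p f Y).hom) : φ = ψ :=
  Functor.Fiber.hom_ext (congrArg OverHom.hom
    (pull_ext p (Y := Y) (φ := OverHom.ofFiber φ) (ψ := OverHom.ofFiber ψ) h))

theorem toPull_comp {S T : B} {f : S ⟶ T} {X : p.Fiber S} {Y Z : p.Fiber T}
    (φ : OverHom p f X Y) (ψ : Y ⟶ Z) :
    toPull p φ ≫ (baseChange p f).map ψ =
      toPull p (φ.comp (OverHom.ofFiber ψ) (Category.comp_id f)) := by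
  apply fiber_ext
  rw [toPull_fac, Functor.map_comp]
  refine (Category.assoc _ _ _).trans ?_
  rw [baseChange_map_fac]
  refine (Category.assoc _ _ _).symm.trans ?_
  rw [toPull_fac]
  rfl

/-- The canonical isomorphism `Y[g][h] ⟶ Y[k][g']` for a commutative square `h ≫ g = g' ≫ k`. -/
noncomputable def pullSwap {S S' T T' : B} {h : S' ⟶ S} {g : S ⟶ T} {g' : S' ⟶ T'} {k : T' ⟶ T}
    (w : h ≫ g = g' ≫ k) (Y : p.Fiber T) :
    (baseChange p h).obj ((baseChange p g).obj Y) ⟶ (baseChange p g').obj ((baseChange p k).obj Y) :=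
  (pullLift p (Category.id_comp g')
    (pullLift p w.symm ((pullMap p h (pull p g Y)).comp (pullMap p g Y) rfl))).toFiber

end

/-- A cartesian fibration: a fibration whose base has finite products and whose fibres have finite
products, preserved by base change. -/
class IsCartesianFibration {B : Type u₁} [Category.{v₁} B] [HasFiniteProducts B]
    {E : Type u₂} [Category.{v₂} E] (p : E ⥤ B) : Prop extends p.IsFibered where
  hasFiniteProducts : ∀ S : B, HasFiniteProducts (p.Fiber S)
  preservesFiniteProducts : ∀ {S T : B} (f : S ⟶ T), PreservesFiniteProducts (baseChange p f)

attribute [instance] IsCartesianFibration.hasFiniteProducts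
  IsCartesianFibration.preservesFiniteProducts

variable {B : Type u₁} [Category.{v₁} B] [HasFiniteProducts B] {E : Type u₂} [Category.{v₂} E]
  (p : E ⥤ B) [IsCartesianFibration p]

/-- The arrow over `u` to the terminal object of a fibre. -/
noncomputable def terminalLift {S T : B} (X : p.Fiber S) (u : S ⟶ T) :
    OverHom p u X (⊤_ (p.Fiber T)) :=
  ofPull p (terminal.from X ≫ (PreservesTerminal.iso (baseChange p u)).inv)

theorem terminal_overHom_ext {S T : B} {X : p.Fiber S} {u : S ⟶ T}
    (φ ψ : OverHom p u X (⊤_ (p.Fiber T))) : φ = ψ := by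
  rw [← ofPull_toPull p φ, ← ofPull_toPull p ψ]
  exact congrArg _ (((terminalIsTerminal (C := p.Fiber T)).isTerminalObj
    (baseChange p u) _).hom_ext _ _)

/-- The arrow over `u` to the product of two objects of a fibre. -/
noncomputable def prodLift {S T : B} {u : S ⟶ T} {X : p.Fiber S} {Y Z : p.Fiber T}
    (φ : OverHom p u X Y) (ψ : OverHom p u X Z) : OverHom p u X (Y ⨯ Z) :=
  ofPull p (prod.lift (toPull p φ) (toPull p ψ) ≫ (PreservesLimitPair.iso (baseChange p u) Y Z).inv)

theorem toPull_prodLift {S T : B} {u : S ⟶ T} {X : p.Fiber S} {Y Z : p.Fiber T}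
    (φ : OverHom p u X Y) (ψ : OverHom p u X Z) : toPull p (prodLift p φ ψ) =
      prod.lift (toPull p φ) (toPull p ψ) ≫ (PreservesLimitPair.iso (baseChange p u) Y Z).inv := by
  apply fiber_ext
  rw [toPull_fac]
  rfl

theorem ofPull_comp {S T : B} {f : S ⟶ T} {X : p.Fiber S} {Y Z : p.Fiber T}
    (φ : OverHom p f X Y) (ψ : Y ⟶ Z) :
    φ.hom ≫ Functor.Fiber.fiberInclusion.map ψ =
      (ofPull p (toPull p φ ≫ (baseChange p f).map ψ)).hom := by
  rw [toPull_comp, ofPull_toPull]; rfl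

theorem prodLift_fst {S T : B} {u : S ⟶ T} {X : p.Fiber S} {Y Z : p.Fiber T}
    (φ : OverHom p u X Y) (ψ : OverHom p u X Z) :
    (prodLift p φ ψ).hom ≫ Functor.Fiber.fiberInclusion.map prod.fst = φ.hom := by
  rw [ofPull_comp, toPull_prodLift, Category.assoc, PreservesLimitPair.iso_inv_fst,
    prod.lift_fst, ofPull_toPull]

theorem prodLift_snd {S T : B} {u : S ⟶ T} {X : p.Fiber S} {Y Z : p.Fiber T}
    (φ : OverHom p u X Y) (ψ : OverHom p u X Z) :
    (prodLift p φ ψ).hom ≫ Functor.Fiber.fiberInclusion.map prod.snd = ψ.hom := by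
  rw [ofPull_comp, toPull_prodLift, Category.assoc, PreservesLimitPair.iso_inv_snd,
    prod.lift_snd, ofPull_toPull]

theorem prod_overHom_ext {S T : B} {u : S ⟶ T} {X : p.Fiber S} {Y Z : p.Fiber T}
    {φ ψ : OverHom p u X (Y ⨯ Z)}
    (h₁ : φ.hom ≫ Functor.Fiber.fiberInclusion.map prod.fst =
      ψ.hom ≫ Functor.Fiber.fiberInclusion.map prod.fst)
    (h₂ : φ.hom ≫ Functor.Fiber.fiberInclusion.map prod.snd =
      ψ.hom ≫ Functor.Fiber.fiberInclusion.map prod.snd) : φ = ψ := by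
  rw [← ofPull_toPull p φ, ← ofPull_toPull p ψ]
  congr 1
  rw [← cancel_mono (PreservesLimitPair.iso (baseChange p u) Y Z).hom]
  ext
  · simp only [Category.assoc, PreservesLimitPair.iso_hom, prodComparison_fst, toPull_comp]
    exact congrArg (fun χ => Functor.Fiber.fiberInclusion.map (toPull p χ)) (OverHom.ext h₁ : φ.comp (OverHom.ofFiber prod.fst) _ =
      ψ.comp (OverHom.ofFiber prod.fst) _)
  · simp only [Category.assoc, PreservesLimitPair.iso_hom, prodComparison_snd, toPull_comp]
    exact congrArg (fun χ => Functor.Fiber.fiberInclusion.map (toPull p χ)) (OverHom.ext h₂ : φ.comp (OverHom.ofFiber prod.snd) _ =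
      ψ.comp (OverHom.ofFiber prod.snd) _)

/-! ### Elementary existential fibrations -/

/-- The canonical arrow `∑_{g'} X[h] ⟶ (∑_g X)[k]` for a commutative square `h ≫ g = g' ≫ k` and
left adjoints `∑_g`, `∑_{g'}` of the base change functors along `g`, `g'`: the transpose of
`X[h] ⟶ (∑_g X)[g][h] ≅ (∑_g X)[k][g']`. -/
noncomputable def bcComparison {S S' T T' : B} {h : S' ⟶ S} {g : S ⟶ T} {g' : S' ⟶ T'}
    {k : T' ⟶ T} (w : h ≫ g = g' ≫ k) {L : p.Fiber S ⥤ p.Fiber T} (adj : L ⊣ baseChange p g)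
    {L' : p.Fiber S' ⥤ p.Fiber T'} (adj' : L' ⊣ baseChange p g') (X : p.Fiber S) :
    L'.obj ((baseChange p h).obj X) ⟶ (baseChange p k).obj (L.obj X) :=
  (adj'.homEquiv _ _).symm ((baseChange p h).map (adj.unit.app X) ≫ pullSwap p w (L.obj X))

/-- The Beck–Chevalley condition for left adjoints along the vertical sides of a commutative
square. -/
def BeckChevalley {S S' T T' : B} {h : S' ⟶ S} {g : S ⟶ T} {g' : S' ⟶ T'} {k : T' ⟶ T}
    (w : h ≫ g = g' ≫ k) : Prop :=
  ∀ (L : p.Fiber S ⥤ p.Fiber T) (adj : L ⊣ baseChange p g)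
    (L' : p.Fiber S' ⥤ p.Fiber T') (adj' : L' ⊣ baseChange p g') (X : p.Fiber S),
    IsIso (bcComparison p w adj adj' X)

/-- The canonical arrow `∑_g (X ∧ Y[g]) ⟶ ∑_g X ∧ Y`. -/
noncomputable def frobeniusComparison {S T : B} {g : S ⟶ T} {L : p.Fiber S ⥤ p.Fiber T}
    (adj : L ⊣ baseChange p g) (X : p.Fiber S) (Y : p.Fiber T) :
    L.obj (X ⨯ (baseChange p g).obj Y) ⟶ L.obj X ⨯ Y :=
  prod.lift (L.map prod.fst) (L.map prod.snd ≫ adj.counit.app Y)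

/-- Frobenius reciprocity for the left adjoint of base change along `g`. -/
def Frobenius {S T : B} (g : S ⟶ T) : Prop :=
  ∀ (L : p.Fiber S ⥤ p.Fiber T) (adj : L ⊣ baseChange p g) (X : p.Fiber S) (Y : p.Fiber T),
    IsIso (frobeniusComparison p adj X Y)

/-- The arrow `⟨0, 0, 1⟩ : I × K ⟶ I × I × K`. -/
noncomputable def dup (I K : B) : I ⨯ K ⟶ I ⨯ (I ⨯ K) := prod.lift prod.fst (𝟙 (I ⨯ K))

theorem dup_natural (I : B) {K' K : B} (f : K' ⟶ K) :
    prod.map (𝟙 I) f ≫ dup I K = dup I K' ≫ prod.map (𝟙 I) (prod.map (𝟙 I) f) := by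
  ext <;> simp [dup]

/-- An elementary fibration: base change along the arrows `⟨0, 0, 1⟩ : I × K ⟶ I × I × K` has left
adjoints, which satisfy the Beck–Chevalley condition (for the pullback squares obtained by changing
`K`) and Frobenius reciprocity. -/
structure IsElementary : Prop where
  isRightAdjoint : ∀ I K : B, (baseChange p (dup I K)).IsRightAdjoint
  beckChevalley : ∀ (I : B) {K' K : B} (f : K' ⟶ K), BeckChevalley p (dup_natural I f)
  frobenius : ∀ I K : B, Frobenius p (dup I K)

theorem snd_natural (I : B) {J' J : B} (f : J' ⟶ J) :
    prod.map (𝟙 I) f ≫ (prod.snd : I ⨯ J ⟶ J) = (prod.snd : I ⨯ J' ⟶ J') ≫ f := by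
  simp

/-- An existential fibration: base change along the product projections `I × J ⟶ J` has left
adjoints, which satisfy the Beck–Chevalley condition (for the pullback squares obtained by changing
`J`) and Frobenius reciprocity. -/
structure IsExistential : Prop where
  isRightAdjoint : ∀ I J : B, (baseChange p (prod.snd : I ⨯ J ⟶ J)).IsRightAdjoint
  beckChevalley : ∀ (I : B) {J' J : B} (f : J' ⟶ J), BeckChevalley p (snd_natural I f)
  frobenius : ∀ I J : B, Frobenius p (prod.snd : I ⨯ J ⟶ J)

/-- An elementary existential fibration. -/
structure IsElementaryExistential : Prop where
  elementary : IsElementary p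
  existential : IsExistential p

/-! ### The bilateral virtual double category -/

/-- The loose arrows from `I` to `J` are the objects over `I × J`. -/
abbrev Rel (I J : B) := p.Fiber (I ⨯ J)

variable {p}

/-- The product `I₀ × ⋯ × Iₙ` of the objects along a path. -/
noncomputable def ctx {I J : B} : LPath (Rel p) I J → B
  | .nil I => I
  | .cons (I := I) _ P => I ⨯ ctx P

/-- The projection `I₀ × ⋯ × Iₙ ⟶ I₀`. -/
noncomputable def src {I J : B} : (P : LPath (Rel p) I J) → (ctx P ⟶ I)
  | .nil I => 𝟙 I
  | .cons _ _ => prod.fst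

/-- The projection `I₀ × ⋯ × Iₙ ⟶ Iₙ`. -/
noncomputable def tgt {I J : B} : (P : LPath (Rel p) I J) → (ctx P ⟶ J)
  | .nil I => 𝟙 I
  | .cons _ P => prod.snd ≫ tgt P

/-- The projection `⟨0, 1⟩ : I₀ × ⋯ × Iₙ ⟶ I₀ × I₁`. -/
noncomputable def headBase {I J K : B} (α : Rel p I J) (P : LPath (Rel p) J K) :
    ctx (.cons α P) ⟶ I ⨯ J :=
  prod.lift prod.fst (prod.snd ≫ src P)

/-- The projection `I₀ × ⋯ × Iₙ ⟶ I₁ × ⋯ × Iₙ`. -/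
noncomputable def tailBase {I J K : B} (α : Rel p I J) (P : LPath (Rel p) J K) :
    ctx (.cons α P) ⟶ ctx P :=
  prod.snd

/-- The conjunction `α₁[⟨0,1⟩] ∧ ⋯ ∧ αₙ[⟨n-1,n⟩]` in the fibre over `I₀ × ⋯ × Iₙ`. -/
noncomputable def conj {I J : B} : (P : LPath (Rel p) I J) → p.Fiber (ctx P)
  | .nil I => ⊤_ (p.Fiber I)
  | .cons α P => pull p (headBase α P) α ⨯ pull p (tailBase α P) (conj P)

/-- The first projection `α₁[⟨0,1⟩] ∧ ⋯ ∧ αₙ[⟨n-1,n⟩] ⟶ α₁` over `⟨0,1⟩`. -/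
noncomputable def conjHead {I J K : B} (α : Rel p I J) (P : LPath (Rel p) J K) :
    OverHom p (headBase α P) (conj (.cons α P)) α :=
  (OverHom.ofFiber (prod.fst : conj (.cons α P) ⟶ pull p (headBase α P) α)).comp
    (pullMap p _ α) (Category.id_comp _)

/-- The projection from the conjunction of a path to that of its tail. -/
noncomputable def conjTail {I J K : B} (α : Rel p I J) (P : LPath (Rel p) J K) :
    OverHom p (tailBase α P) (conj (.cons α P)) (conj P) :=
  (OverHom.ofFiber (prod.snd : conj (.cons α P) ⟶ pull p (tailBase α P) (conj P))).comp
    (pullMap p _ (conj P)) (Category.id_comp _)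

theorem conjNil_ext {S I : B} {X : p.Fiber S} {u : S ⟶ I}
    (φ ψ : OverHom p u X (conj (.nil I : LPath (Rel p) I I))) : φ = ψ :=
  terminal_overHom_ext p φ ψ

/-- The pairing into a conjunction. -/
noncomputable def conjLift {S I J K : B} {X : p.Fiber S} {α : Rel p I J} {P : LPath (Rel p) J K}
    (u : S ⟶ ctx (.cons α P)) {a : S ⟶ I ⨯ J} {b : S ⟶ ctx P} (φ : OverHom p a X α)
    (ψ : OverHom p b X (conj P)) (ha : u ≫ headBase α P = a) (hb : u ≫ tailBase α P = b) :
    OverHom p u X (conj (.cons α P)) :=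
  prodLift p (pullLift p ha φ) (pullLift p hb ψ)

section

variable {S I J K : B} {X : p.Fiber S} {α : Rel p I J} {P : LPath (Rel p) J K}
  {u : S ⟶ ctx (.cons α P)} {a : S ⟶ I ⨯ J} {b : S ⟶ ctx P}

theorem conjLift_head (φ : OverHom p a X α)
    (ψ : OverHom p b X (conj P)) (ha : u ≫ headBase α P = a) (hb : u ≫ tailBase α P = b) :
    (conjLift u φ ψ ha hb).hom ≫ (conjHead α P).hom = φ.hom := by
  refine Eq.trans ?_ (pullLift_fac p ha φ)
  refine (Category.assoc _ _ _).symm.trans (congrArg (· ≫ _) ?_)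
  exact prodLift_fst p _ _

theorem conjLift_tail (φ : OverHom p a X α)
    (ψ : OverHom p b X (conj P)) (ha : u ≫ headBase α P = a) (hb : u ≫ tailBase α P = b) :
    (conjLift u φ ψ ha hb).hom ≫ (conjTail α P).hom = ψ.hom := by
  refine Eq.trans ?_ (pullLift_fac p hb ψ)
  refine (Category.assoc _ _ _).symm.trans (congrArg (· ≫ _) ?_)
  exact prodLift_snd p _ _

theorem base_unique {S T : B} {u u' : S ⟶ T} {X : p.Fiber S} {Y : p.Fiber T}
    {φ : OverHom p u X Y} {ψ : OverHom p u' X Y} (h : φ.hom = ψ.hom) : u = u' := by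
  obtain ⟨a, ha⟩ := φ
  obtain ⟨b, hb⟩ := ψ
  obtain rfl : a = b := h
  exact (IsHomLift.fac p u a).trans (IsHomLift.fac p u' a).symm

theorem conjCons_ext {u' : S ⟶ ctx (.cons α P)} {φ : OverHom p u X (conj (.cons α P))}
    {ψ : OverHom p u' X (conj (.cons α P))}
    (h₁ : φ.hom ≫ (conjHead α P).hom = ψ.hom ≫ (conjHead α P).hom)
    (h₂ : φ.hom ≫ (conjTail α P).hom = ψ.hom ≫ (conjTail α P).hom) : φ.hom = ψ.hom := by
  have e₁ := base_unique (φ := φ.comp (conjHead α P) rfl) (ψ := ψ.comp (conjHead α P) rfl) h₁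
  have e₂ := base_unique (φ := φ.comp (conjTail α P) rfl) (ψ := ψ.comp (conjTail α P) rfl) h₂
  obtain rfl : u = u' := by
    refine Limits.prod.hom_ext ?_ e₂
    have e : (u ≫ headBase α P) ≫ prod.fst = (u' ≫ headBase α P) ≫ prod.fst :=
      congrArg (· ≫ prod.fst) e₁
    exact (congrArg (u ≫ ·) (prod.lift_fst _ _)).symm.trans ((Category.assoc _ _ _).symm.trans
      (e.trans ((Category.assoc _ _ _).trans (congrArg (u' ≫ ·) (prod.lift_fst _ _)))))
  refine congrArg OverHom.hom (prod_overHom_ext p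
    (congrArg OverHom.hom (pull_ext p (φ := φ.comp (OverHom.ofFiber _) (Category.comp_id _))
      (ψ := ψ.comp (OverHom.ofFiber _) (Category.comp_id _)) ?_))
    (congrArg OverHom.hom (pull_ext p (φ := φ.comp (OverHom.ofFiber _) (Category.comp_id _))
      (ψ := ψ.comp (OverHom.ofFiber _) (Category.comp_id _)) ?_)))
  · exact (Category.assoc _ _ _).trans (h₁.trans (Category.assoc _ _ _).symm)
  · exact (Category.assoc _ _ _).trans (h₂.trans (Category.assoc _ _ _).symm)

end

/-- The projection from the product of the objects along a path to that along an initial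
segment. -/
noncomputable def initBase {I J K : B} : (P₁ : LPath (Rel p) I J) → (P₂ : LPath (Rel p) J K) →
    (ctx (P₁.append P₂) ⟶ ctx P₁)
  | .nil _, P₂ => src P₂
  | .cons (I := I) _ P₁, P₂ => prod.map (𝟙 I) (initBase P₁ P₂)

/-- The projection from the product of the objects along a path to that along a final segment. -/
noncomputable def finBase {I J K : B} : (P₁ : LPath (Rel p) I J) → (P₂ : LPath (Rel p) J K) →
    (ctx (P₁.append P₂) ⟶ ctx P₂)
  | .nil _, P₂ => 𝟙 (ctx P₂)
  | .cons _ P₁, P₂ => prod.snd ≫ finBase P₁ P₂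

theorem initBase_src {I J K : B} (P₁ : LPath (Rel p) I J) (P₂ : LPath (Rel p) J K) :
    initBase P₁ P₂ ≫ src P₁ = src (P₁.append P₂) := by
  cases P₁ with
  | nil => exact Category.comp_id _
  | cons α P₁ => simp [initBase, src, LPath.append, ctx]

theorem finBase_tgt {I J K : B} (P₁ : LPath (Rel p) I J) (P₂ : LPath (Rel p) J K) :
    finBase P₁ P₂ ≫ tgt P₂ = tgt (P₁.append P₂) := by
  induction P₁ with
  | nil => exact Category.id_comp _
  | cons α P₁ ih => exact (Category.assoc _ _ _).trans (congrArg (prod.snd ≫ ·) (ih P₂))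

theorem initBase_tgt {I J K : B} (P₁ : LPath (Rel p) I J) (P₂ : LPath (Rel p) J K) :
    initBase P₁ P₂ ≫ tgt P₁ = finBase P₁ P₂ ≫ src P₂ := by
  induction P₁ with
  | nil => exact (Category.comp_id _).trans (Category.id_comp _).symm
  | cons α P₁ ih => simp [initBase, finBase, tgt, LPath.append, ctx, ← ih]

theorem lift_headBase {S I J K : B} (α : Rel p I J) (P : LPath (Rel p) J K) (x : S ⟶ I)
    (y : S ⟶ ctx P) :
    (prod.lift x y : S ⟶ ctx (.cons α P)) ≫ headBase α P = prod.lift x (y ≫ src P) := by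
  refine (prod.comp_lift _ _ _).trans ?_
  rw [prod.lift_fst]
  exact congrArg (prod.lift x) (prod.lift_snd_assoc _ _ _)

theorem lift_sides {R S I J : B} (u : R ⟶ S) {a : S ⟶ I} {b : S ⟶ J} {c : R ⟶ I} {d : R ⟶ J}
    (h : c = u ≫ a) (k : u ≫ b = d) : u ≫ prod.lift a b = prod.lift c d := by
  rw [prod.comp_lift, h, k]

theorem initBase_head {I J K M : B} (α : Rel p I J) (P₁ : LPath (Rel p) J K)
    (P₂ : LPath (Rel p) K M) :
    initBase (.cons α P₁) P₂ ≫ headBase α P₁ = headBase α (P₁.append P₂) := by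
  simp only [headBase, ← initBase_src P₁ P₂]
  ext <;> simp [initBase, LPath.append, ctx]

theorem initBase_tail {I J K M : B} (α : Rel p I J) (P₁ : LPath (Rel p) J K)
    (P₂ : LPath (Rel p) K M) :
    initBase (.cons α P₁) P₂ ≫ tailBase α P₁ = tailBase α (P₁.append P₂) ≫ initBase P₁ P₂ :=
  prod.map_snd _ _

/-- The projection from the conjunction of a path to that of an initial segment. -/
noncomputable def conjInit {I J K : B} : (P₁ : LPath (Rel p) I J) → (P₂ : LPath (Rel p) J K) →
    OverHom p (initBase P₁ P₂) (conj (P₁.append P₂)) (conj P₁)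
  | .nil _, P₂ => terminalLift p (conj P₂) (src P₂)
  | .cons α P₁, P₂ => conjLift _ (conjHead α (P₁.append P₂))
      ((conjTail α (P₁.append P₂)).comp (conjInit P₁ P₂) rfl)
      (initBase_head α P₁ P₂) (initBase_tail α P₁ P₂)

/-- The projection from the conjunction of a path to that of a final segment. -/
noncomputable def conjFin {I J K : B} : (P₁ : LPath (Rel p) I J) → (P₂ : LPath (Rel p) J K) →
    OverHom p (finBase P₁ P₂) (conj (P₁.append P₂)) (conj P₂)
  | .nil _, P₂ => OverHom.ofFiber (𝟙 (conj P₂))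
  | .cons α P₁, P₂ => (conjTail α (P₁.append P₂)).comp (conjFin P₁ P₂) rfl

/-- The projection to an initial segment, for a path with a given decomposition. -/
noncomputable def segInitBase {I J K : B} {P : LPath (Rel p) I K} {P₁ : LPath (Rel p) I J}
    {P₂ : LPath (Rel p) J K} (h : P = P₁.append P₂) : ctx P ⟶ ctx P₁ := by
  subst h; exact initBase P₁ P₂

/-- The projection to a final segment, for a path with a given decomposition. -/
noncomputable def segFinBase {I J K : B} {P : LPath (Rel p) I K} {P₁ : LPath (Rel p) I J}
    {P₂ : LPath (Rel p) J K} (h : P = P₁.append P₂) : ctx P ⟶ ctx P₂ := by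
  subst h; exact finBase P₁ P₂

/-- The projection to the conjunction of an initial segment. -/
noncomputable def segInit {I J K : B} {P : LPath (Rel p) I K} {P₁ : LPath (Rel p) I J}
    {P₂ : LPath (Rel p) J K} (h : P = P₁.append P₂) :
    OverHom p (segInitBase h) (conj P) (conj P₁) := by
  subst h; exact conjInit P₁ P₂

/-- The projection to the conjunction of a final segment. -/
noncomputable def segFin {I J K : B} {P : LPath (Rel p) I K} {P₁ : LPath (Rel p) I J}
    {P₂ : LPath (Rel p) J K} (h : P = P₁.append P₂) :
    OverHom p (segFinBase h) (conj P) (conj P₂) := by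
  subst h; exact conjFin P₁ P₂

section

variable {I J K M : B} {P : LPath (Rel p) I K} {P₁ : LPath (Rel p) I J} {P₂ : LPath (Rel p) J K}

theorem segInitBase_src (h : P = P₁.append P₂) : segInitBase h ≫ src P₁ = src P := by
  subst h; exact initBase_src P₁ P₂

theorem segInitBase_tgt (h : P = P₁.append P₂) :
    segInitBase h ≫ tgt P₁ = segFinBase h ≫ src P₂ := by
  subst h; exact initBase_tgt P₁ P₂

theorem segFinBase_tgt (h : P = P₁.append P₂) : segFinBase h ≫ tgt P₂ = tgt P := by
  subst h; exact finBase_tgt P₁ P₂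

theorem segInit_head {α : Rel p M I} (h : LPath.cons α P = (LPath.cons α P₁).append P₂) :
    (segInit h).hom ≫ (conjHead α P₁).hom = (conjHead α P).hom := by
  obtain rfl : P = P₁.append P₂ := by injection h
  exact conjLift_head _ _ (initBase_head α P₁ P₂) (initBase_tail α P₁ P₂)

theorem segInit_tail {α : Rel p M I} (h : LPath.cons α P = (LPath.cons α P₁).append P₂)
    (h' : P = P₁.append P₂) :
    (segInit h).hom ≫ (conjTail α P₁).hom = (conjTail α P).hom ≫ (segInit h').hom := by
  subst h'
  exact conjLift_tail _ _ (initBase_head α P₁ P₂) (initBase_tail α P₁ P₂)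

theorem segFin_cons {α : Rel p M I} (h : LPath.cons α P = (LPath.cons α P₁).append P₂)
    (h' : P = P₁.append P₂) :
    (segFin h).hom = (conjTail α P).hom ≫ (segFin h').hom := by
  subst h'; rfl

theorem segFin_nil (h : P = (LPath.nil I).append P) : (segFin h).hom = 𝟙 _ := by
  rfl

theorem segInit_nil {I J : B} {P : LPath (Rel p) I J} (h : P = P.append (.nil J)) :
    (segInit h).hom = 𝟙 _ := by
  induction P with
  | nil I => exact congrArg OverHom.hom (conjNil_ext (segInit h) (OverHom.ofFiber (𝟙 _)))
  | cons α P ih =>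
    have h' : P = P.append (.nil _) := P.append_nil.symm
    refine conjCons_ext (ψ := OverHom.ofFiber (𝟙 _)) ?_ ?_
    · exact (segInit_head h).trans (Category.id_comp _).symm
    · refine (segInit_tail h h').trans ?_
      rw [ih h']
      exact (Category.comp_id _).trans (Category.id_comp _).symm

end

section

variable {I J K M : B} {R₁ : LPath (Rel p) I J} {R₂ : LPath (Rel p) J K}
  {P₂ : LPath (Rel p) K M} {P : LPath (Rel p) I M} {T : LPath (Rel p) J M}
  {P₁ : LPath (Rel p) I K}

theorem segInit_segInit (h : P = P₁.append P₂) (h₁ : P₁ = R₁.append R₂) (k : P = R₁.append T)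
    (k' : T = R₂.append P₂) :
    (segInit h).hom ≫ (segInit h₁).hom = (segInit k).hom := by
  subst h₁ h
  induction R₁ with
  | nil I =>
    subst k'
    refine congrArg OverHom.hom (conjNil_ext ((segInit rfl).comp (segInit rfl) ?_) (segInit k))
    exact initBase_src _ _
  | cons α R₁ ih =>
    have k₀ : (R₁.append R₂).append P₂ = R₁.append T := by injection k
    refine conjCons_ext (φ := (segInit rfl).comp (segInit rfl) rfl) ?_ ?_
    · refine (Category.assoc _ _ _).trans ?_
      refine (congrArg (_ ≫ ·) (segInit_head (P := R₁.append R₂) rfl)).trans ?_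
      exact (segInit_head rfl).trans (segInit_head k).symm
    · refine (Category.assoc _ _ _).trans ?_
      refine (congrArg (_ ≫ ·) (segInit_tail (P := R₁.append R₂) rfl rfl)).trans ?_
      refine (Category.assoc _ _ _).symm.trans ?_
      refine (congrArg (· ≫ _) (segInit_tail (P := (R₁.append R₂).append P₂) rfl rfl)).trans ?_
      refine (Category.assoc _ _ _).trans ?_
      refine (congrArg (_ ≫ ·) (ih k' k₀)).trans ?_
      exact (segInit_tail k k₀).symm

theorem segInit_segFin (h : P = P₁.append P₂) (h₁ : P₁ = R₁.append R₂) (k : P = R₁.append T)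
    (k' : T = R₂.append P₂) :
    (segInit h).hom ≫ (segFin h₁).hom = (segFin k).hom ≫ (segInit k').hom := by
  subst h₁ h
  induction R₁ with
  | nil I =>
    subst k'
    exact (Category.comp_id _).trans (Category.id_comp _).symm
  | cons α R₁ ih =>
    have k₀ : (R₁.append R₂).append P₂ = R₁.append T := by injection k
    refine (congrArg (_ ≫ ·) (segFin_cons (P := R₁.append R₂) rfl rfl)).trans ?_
    refine (Category.assoc _ _ _).symm.trans ?_
    refine (congrArg (· ≫ _) (segInit_tail (P := (R₁.append R₂).append P₂) rfl rfl)).trans ?_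
    refine (Category.assoc _ _ _).trans ?_
    refine (congrArg (_ ≫ ·) (ih k' k₀)).trans ?_
    refine (Category.assoc _ _ _).symm.trans ?_
    exact congrArg (· ≫ _) (segFin_cons k k₀).symm

theorem segFin_segFin (h : P = P₁.append P₂) (h₁ : P₁ = R₁.append R₂) (k : P = R₁.append T)
    (k' : T = R₂.append P₂) :
    (segFin h).hom = (segFin k).hom ≫ (segFin k').hom := by
  subst h₁ h
  induction R₁ with
  | nil I =>
    subst k'
    exact (Category.id_comp _).symm
  | cons α R₁ ih =>
    have k₀ : (R₁.append R₂).append P₂ = R₁.append T := by injection k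
    refine (segFin_cons (P := (R₁.append R₂).append P₂) rfl rfl).trans ?_
    refine (congrArg (_ ≫ ·) (ih k' k₀)).trans ?_
    refine (Category.assoc _ _ _).symm.trans ?_
    exact congrArg (· ≫ _) (segFin_cons k k₀).symm

end

variable (p)

/-- The underlying data of `Bil[p]`. A cell from `α₁, …, αₙ` to `β` with tight sides `s` and `t` is
an arrow `α₁[⟨0,1⟩] ∧ ⋯ ∧ αₙ[⟨n-1,n⟩] ⟶ β` over `(s × t) ∘ ⟨0,n⟩ = ⟨s ∘ ⟨0⟩, t ∘ ⟨n⟩⟩`. -/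
noncomputable abbrev bilData : VDCData.{u₁, v₁, u₂, v₂} where
  Obj := B
  Loose := Rel p
  Cell P s t β := OverHom p (prod.lift (src P ≫ s) (tgt P ≫ t)) (conj P) β

variable {p}

/-- The arrow `I₀ × ⋯ × Iₘ ⟶ J₀ × ⋯ × Jₙ` of the base given by the tight arrows in a sequence of
cells. -/
noncomputable def pathBase {I I' J J' : (bilData p).Obj}
    {P : LPath (bilData p).Loose I I'} {Q : LPath (bilData p).Loose J J'}
    {s : I ⟶ J} {t : I' ⟶ J'} : CellPath (bilData p) P Q s t → (ctx P ⟶ ctx Q)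
  | .nil s => s
  | .cons (P := P) (s := s) _ Ξ h => prod.lift (src P ≫ s) (segFinBase h ≫ pathBase Ξ)

theorem pathBase_src {I I' J J' : (bilData p).Obj}
    {P : LPath (bilData p).Loose I I'} {Q : LPath (bilData p).Loose J J'}
    {s : I ⟶ J} {t : I' ⟶ J'} (Ξ : CellPath (bilData p) P Q s t) :
    pathBase Ξ ≫ src Q = src P ≫ s := by
  cases Ξ with
  | nil s => exact (Category.comp_id s).trans (Category.id_comp s).symm
  | cons ξ Ξ h => exact prod.lift_fst _ _

theorem pathBase_tgt {I I' J J' : (bilData p).Obj}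
    {P : LPath (bilData p).Loose I I'} {Q : LPath (bilData p).Loose J J'}
    {s : I ⟶ J} {t : I' ⟶ J'} (Ξ : CellPath (bilData p) P Q s t) :
    pathBase Ξ ≫ tgt Q = tgt P ≫ t := by
  induction Ξ with
  | nil s => exact (Category.comp_id s).trans (Category.id_comp s).symm
  | @cons I K I' J M J' P₁ P₂ P β Q s t u ξ Ξ h ih =>
    refine (Category.assoc _ _ _).symm.trans ((congrArg (· ≫ tgt Q) (prod.lift_snd _ _)).trans ?_)
    refine (Category.assoc _ _ _).trans ((congrArg (segFinBase h ≫ ·) ih).trans ?_)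
    rw [← Category.assoc, segFinBase_tgt]

theorem pathBase_head {I K I' J M J' : (bilData p).Obj} {P₁ : LPath (bilData p).Loose I K}
    {P₂ : LPath (bilData p).Loose K I'} {P : LPath (bilData p).Loose I I'}
    {β : (bilData p).Loose J M} {Q : LPath (bilData p).Loose M J'} {s : I ⟶ J} {t : K ⟶ M}
    {u : I' ⟶ J'} (Ξ : CellPath (bilData p) P₂ Q t u) (h : P = P₁.append P₂) :
    (prod.lift (src P ≫ s) (segFinBase h ≫ pathBase Ξ) : ctx P ⟶ ctx (.cons β Q)) ≫
      headBase β Q = segInitBase h ≫ prod.lift (src P₁ ≫ s) (tgt P₁ ≫ t) := by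
  refine (lift_headBase β Q _ _).trans ?_
  rw [Category.assoc, pathBase_src, ← segInitBase_src h]
  exact (lift_sides _ (Category.assoc _ _ _)
    ((Category.assoc (segInitBase h) (tgt P₁) t).symm.trans
      ((congrArg (· ≫ t) (segInitBase_tgt h)).trans (Category.assoc _ _ _)))).symm

/-- The arrow from the conjunction of `α₁, …, αₘ` to that of `β₁, …, βₙ` given by a sequence of
cells. -/
noncomputable def pathArrow {I I' J J' : (bilData p).Obj}
    {P : LPath (bilData p).Loose I I'} {Q : LPath (bilData p).Loose J J'}
    {s : I ⟶ J} {t : I' ⟶ J'} : (Ξ : CellPath (bilData p) P Q s t) →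
      OverHom p (pathBase Ξ) (conj P) (conj Q)
  | .nil s => terminalLift p _ s
  | .cons ξ Ξ h => conjLift _ ((segInit h).comp ξ rfl) ((segFin h).comp (pathArrow Ξ) rfl)
      (pathBase_head Ξ h) (prod.lift_snd _ _)

section

variable {I K I' J M J' : (bilData p).Obj} {P₁ : LPath (bilData p).Loose I K}
  {P₂ : LPath (bilData p).Loose K I'} {P : LPath (bilData p).Loose I I'}
  {β : (bilData p).Loose J M} {Q : LPath (bilData p).Loose M J'} {s : I ⟶ J} {t : K ⟶ M}
  {u : I' ⟶ J'}

theorem pathArrow_head (ξ : (bilData p).Cell P₁ s t β) (Ξ : CellPath (bilData p) P₂ Q t u)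
    (h : P = P₁.append P₂) :
    (pathArrow (.cons ξ Ξ h)).hom ≫ (conjHead β Q).hom = (segInit h).hom ≫ ξ.hom :=
  conjLift_head _ _ _ _

theorem pathArrow_tail (ξ : (bilData p).Cell P₁ s t β) (Ξ : CellPath (bilData p) P₂ Q t u)
    (h : P = P₁.append P₂) :
    (pathArrow (.cons ξ Ξ h)).hom ≫ (conjTail β Q).hom =
      (segFin h).hom ≫ (pathArrow Ξ).hom :=
  conjLift_tail _ _ _ _

end

theorem pathArrow_append {I K I' J M J' : (bilData p).Obj} {P₁ : LPath (bilData p).Loose I K}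
    {Q₁ : LPath (bilData p).Loose J M} {P₂ : LPath (bilData p).Loose K I'}
    {Q₂ : LPath (bilData p).Loose M J'} {P : LPath (bilData p).Loose I I'}
    {Q : LPath (bilData p).Loose J J'} {s : I ⟶ J} {t : K ⟶ M} {u : I' ⟶ J'}
    (Ξ : CellPath (bilData p) P₁ Q₁ s t) (Ξ' : CellPath (bilData p) P₂ Q₂ t u)
    (h : P = P₁.append P₂) (hQ : Q = Q₁.append Q₂) :
    (pathArrow (Ξ.append Ξ' h hQ)).hom ≫ (segInit hQ).hom =
        (segInit h).hom ≫ (pathArrow Ξ).hom ∧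
      (pathArrow (Ξ.append Ξ' h hQ)).hom ≫ (segFin hQ).hom =
        (segFin h).hom ≫ (pathArrow Ξ').hom := by
  induction Ξ with
  | nil s =>
    have e : P = P₂ := h
    have e' : Q = Q₂ := hQ
    subst e e'
    refine ⟨congrArg OverHom.hom (conjNil_ext ((pathArrow Ξ').comp (segInit hQ) rfl)
      ((segInit h).comp (pathArrow (.nil s)) ?_)), ?_⟩
    · exact (pathBase_src Ξ').symm
    · exact (Category.comp_id _).trans (Category.id_comp _).symm
  | @cons I N K J O M R₁ R₂ P₁ β Q₁ s t u ξ Ξ h₀ ih =>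
    subst hQ
    have h' : P = R₁.append (R₂.append P₂) := by rw [h, h₀, LPath.append_assoc]
    obtain ⟨ih₁, ih₂⟩ := ih Ξ' rfl rfl
    change (pathArrow (CellPath.cons ξ (Ξ.append Ξ' rfl rfl) h')).hom ≫
        (segInit (P := .cons β (Q₁.append Q₂)) (P₁ := .cons β Q₁) (P₂ := Q₂) rfl).hom = _ ∧
      (pathArrow (CellPath.cons ξ (Ξ.append Ξ' rfl rfl) h')).hom ≫
        (segFin (P := .cons β (Q₁.append Q₂)) (P₁ := .cons β Q₁) (P₂ := Q₂) rfl).hom = _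
    constructor
    · refine conjCons_ext
        (φ := (pathArrow (CellPath.cons ξ (Ξ.append Ξ' rfl rfl) h')).comp
          (segInit (P := .cons β (Q₁.append Q₂)) (P₁ := .cons β Q₁) (P₂ := Q₂) rfl) rfl)
        (ψ := (segInit h).comp (pathArrow (CellPath.cons ξ Ξ h₀)) rfl) ?_ ?_
      · refine (Category.assoc _ _ _).trans ?_
        refine (congrArg (_ ≫ ·) (segInit_head (P := Q₁.append Q₂) rfl)).trans ?_
        refine (pathArrow_head _ _ _).trans ?_
        refine Eq.trans ?_ (Category.assoc _ _ _).symm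
        refine Eq.trans ?_ (congrArg (_ ≫ ·) (pathArrow_head ξ Ξ h₀).symm)
        refine Eq.trans ?_ (Category.assoc _ _ _)
        exact congrArg (· ≫ _) (segInit_segInit h h₀ h' rfl).symm
      · refine (Category.assoc _ _ _).trans ?_
        refine (congrArg (_ ≫ ·) (segInit_tail (P := Q₁.append Q₂) rfl rfl)).trans ?_
        refine (Category.assoc _ _ _).symm.trans ?_
        refine (congrArg (· ≫ _) (pathArrow_tail _ _ _)).trans ?_
        refine (Category.assoc _ _ _).trans ?_
        refine (congrArg (_ ≫ ·) ih₁).trans ?_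
        refine Eq.trans ?_ (Category.assoc _ _ _).symm
        refine Eq.trans ?_ (congrArg (_ ≫ ·) (pathArrow_tail ξ Ξ h₀).symm)
        refine (Category.assoc _ _ _).symm.trans (Eq.trans ?_ (Category.assoc _ _ _))
        exact congrArg (· ≫ _) (segInit_segFin h h₀ h' rfl).symm
    · refine (congrArg (_ ≫ ·) (segFin_cons (P := Q₁.append Q₂) rfl rfl)).trans ?_
      refine (Category.assoc _ _ _).symm.trans ?_
      refine (congrArg (· ≫ _) (pathArrow_tail _ _ _)).trans ?_
      refine (Category.assoc _ _ _).trans ?_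
      refine (congrArg (_ ≫ ·) ih₂).trans ?_
      refine (Category.assoc _ _ _).symm.trans ?_
      exact congrArg (· ≫ _) (segFin_segFin h h₀ h' rfl).symm

variable (p)

/-- The identity cell of a loose arrow `α`: the projection from the one-term conjunction. -/
noncomputable def bilId {I J : B} (α : Rel p I J) :
    (bilData p).Cell (.single α) (𝟙 I) (𝟙 J) α :=
  (conjHead α (.nil J)).comp (OverHom.ofFiber (𝟙 α)) (by
    rw [Category.comp_id, Category.comp_id, Category.comp_id]; rfl)

theorem bilId_hom {I J : B} (α : Rel p I J) : (bilId p α).hom = (conjHead α (.nil J)).hom :=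
  Category.comp_id _

/-- Composition of cells: the induced arrow between the conjunctions, followed by the lower cell. -/
noncomputable def bilComp {I I' J J' K K' : (bilData p).Obj} {P : LPath (bilData p).Loose I I'}
    {Q : LPath (bilData p).Loose J J'} {s : I ⟶ J} {u : I' ⟶ J'} {f : J ⟶ K} {g : J' ⟶ K'}
    {γ : (bilData p).Loose K K'} (Ξ : CellPath (bilData p) P Q s u) (ζ : (bilData p).Cell Q f g γ)
    {a : I ⟶ K} {b : I' ⟶ K'} (ha : s ≫ f = a) (hb : u ≫ g = b) : (bilData p).Cell P a b γ :=
  (pathArrow Ξ).comp ζ (by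
    subst ha hb
    refine lift_sides _ ?_ ?_
    · rw [← Category.assoc, ← pathBase_src Ξ, Category.assoc]
    · rw [← Category.assoc, pathBase_tgt Ξ, Category.assoc])

theorem pathArrow_idPath {I J : (bilData p).Obj} (P : LPath (bilData p).Loose I J) :
    (pathArrow ((bilData p).idPath (bilId p) P)).hom = 𝟙 _ := by
  induction P with
  | nil I =>
    have e (φ ψ : OverHom p (𝟙 (ctx (.nil I : LPath (Rel p) I I)))
      (conj (.nil I : LPath (Rel p) I I)) (conj (.nil I : LPath (Rel p) I I))) : φ = ψ :=
      conjNil_ext (I := I) φ ψ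
    exact congrArg OverHom.hom
      (e (pathArrow (p := p) (.nil (𝟙 I))) (OverHom.ofFiber (𝟙 _)))
  | cons α P ih =>
    refine conjCons_ext (ψ := OverHom.ofFiber (𝟙 _)) ?_ ?_
    · refine (pathArrow_head _ _ _).trans ?_
      rw [bilId_hom]
      exact (segInit_head rfl).trans (Category.id_comp _).symm
    · refine (pathArrow_tail _ _ _).trans ?_
      refine (congrArg (_ ≫ ·) ih).trans ((Category.comp_id _).trans ?_)
      refine (segFin_cons (P := P) (P₁ := .nil _) rfl rfl).trans ?_
      exact (Category.comp_id _).trans (Category.id_comp _).symm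

theorem pathArrow_composite {I I' J J' K K' : (bilData p).Obj}
    {P : LPath (bilData p).Loose I I'} {Q : LPath (bilData p).Loose J J'}
    {R : LPath (bilData p).Loose K K'} {s : I ⟶ J} {u : I' ⟶ J'} {f : J ⟶ K} {h : J' ⟶ K'}
    (T : CellTree (bilData p) P Q R s u f h) :
    (pathArrow (T.composite fun Ξ ζ => bilComp p Ξ ζ rfl rfl)).hom =
      (pathArrow T.upper).hom ≫ (pathArrow T.lower).hom := by
  induction T with
  | @nil I J K s f =>
    have e (φ ψ : OverHom p (S := ctx (.nil I : LPath (Rel p) I I))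
      (T := ctx (.nil K : LPath (Rel p) K K)) (s ≫ f)
      (conj (.nil I : LPath (Rel p) I I)) (conj (.nil K : LPath (Rel p) K K))) : φ = ψ :=
      conjNil_ext (I := K) φ ψ
    exact congrArg OverHom.hom (e (pathArrow (p := p) (.nil (s ≫ f)))
      ((pathArrow (p := p) (.nil s)).comp (pathArrow (p := p) (.nil f)) rfl))
  | cons Ξ ζ T hP hQ ih =>
    obtain ⟨h₁, h₂⟩ := pathArrow_append Ξ T.upper hP hQ
    refine conjCons_ext (ψ := (pathArrow _).comp (pathArrow _) rfl) ?_ ?_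
    · refine (pathArrow_head _ _ _).trans ?_
      refine Eq.trans ?_ (Category.assoc _ _ _).symm
      refine Eq.trans ?_ (congrArg (_ ≫ ·) (pathArrow_head _ _ _).symm)
      refine (Category.assoc _ _ _).symm.trans (Eq.trans ?_ (Category.assoc _ _ _))
      exact congrArg (· ≫ _) h₁.symm
    · refine (pathArrow_tail _ _ _).trans ?_
      refine Eq.trans ?_ (Category.assoc _ _ _).symm
      refine Eq.trans ?_ (congrArg (_ ≫ ·) (pathArrow_tail _ _ _).symm)
      refine (congrArg (_ ≫ ·) ih).trans ?_
      refine (Category.assoc _ _ _).symm.trans (Eq.trans ?_ (Category.assoc _ _ _))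
      exact congrArg (· ≫ _) h₂.symm

/-- The bilateral virtual double category `Bil[p]`. -/
noncomputable def Bil : VDC.{u₁, v₁, u₂, v₂} where
  toVDCData := bilData p
  idCell α := bilId p α
  comp Ξ ζ _ _ ha hb := bilComp p Ξ ζ ha hb
  id_comp ξ := OverHom.ext ((congrArg (· ≫ ξ.hom) (pathArrow_idPath p _)).trans
    (Category.id_comp _))
  comp_id ξ := OverHom.ext (by
    refine (congrArg (_ ≫ ·) (bilId_hom p _)).trans ((pathArrow_head _ _ _).trans ?_)
    exact (congrArg (· ≫ ξ.hom) (segInit_nil _)).trans (Category.id_comp _))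
  assoc T _ _ _ ω := OverHom.ext ((congrArg (· ≫ ω.hom) (pathArrow_composite p T)).trans
    (Category.assoc _ _ _))

end Fibration

/-! The two sides are linked by stably opcartesian arrows (`IsStablyOpcart`). An arrow X ⟶ Z over g
is stably opcartesian if it stays opcartesian when a context K is added to both ends of g and any
object over the enlarged codomain is conjoined. Opcartesian arrows over g represent the left adjoint
of base change along g. Stability under a context is the Beck–Chevalley condition for product
squares, and stability under conjunction is Frobenius reciprocity. Isomorphisms are stably
opcartesian, and the class is closed under composition, whiskering and conjunction in separate
variables.

From fibration to equipment: the hypotheses give stably opcartesian lifts along diagonals and along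
the projections that forget a middle variable. Paths are then composed by the relational formulas:
the unit is the sum of ⊤ along the diagonal, i.e. equality, and the composite of α and γ is "there
is j with α(i,j) ∧ γ(j,k)". Whiskering a cell by paths A and C only adds the objects of A and C as
context and their loose arrows as conjuncts, so a stably opcartesian cell is composing
(`isComposing_of_isStablyOpcart`). Restrictions are cartesian lifts along f × g. The right adjoints
are given by ⊤ over 1 × 1 and by the external conjunction α(x,x') ∧ β(y,y'). The latter preserves
composites because the components of a composing pair are stably opcartesian, and so is the
conjunction of two such arrows in separate variables.

From equipment to fibration: the difficulty is that a composing cell only factors cells whose target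
lies over the two outer objects of the path, while an opcartesian arrow must factor arrows into
objects over the whole base. The unit U on I bridges the gap by acting as an equality predicate.
Factoring the identity of X through a whiskered unit cell gives a transport X(k,i) ∧ U(i,j) ⟶
X(k,j), and whiskering on the other side gives a backward transport. Both are trivial at
reflexivity. To show that an arrow out of Y₀(h,i) ∧ U(i,j) ∧ Y₁(j,l) is determined at reflexivity
(`conj_unit_hom_ext`), further copies U(i,i') and U(j,j') are attached to the outer loose arrows.
Transport along them moves the target to the variables h, i', j', l, which belong to the outer
objects; there the unit property applies, and setting i' = i, j' = j recovers the original arrow. It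
follows that transport undoes backward transport, that transport is natural, and that units are
stably opcartesian.

The sum of X along ⟨0,0,1⟩ is then U(i,i') ∧ X(i',k). The sum of X along I × J ⟶ J is the composite
of ⊤ : 1 → I with X. Its stability along f : J' ⟶ J in the presence of Y is obtained by composing
further with the loose arrow U(j, f j') ∧ Y(j'): the arrow in question is a retract of the resulting
one (`isStableAlong_composite`). -/

namespace Fibration

/-! ### Products in the base -/

section

variable {B : Type u₁} [Category.{v₁} B]

/-- The arrows `k` and `q` exhibit their domain as a product. -/
def IsProd {R K T : B} (k : R ⟶ K) (q : R ⟶ T) : Prop :=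
  ∀ ⦃A : B⦄ (a : A ⟶ K) (b : A ⟶ T), ∃! u : A ⟶ R, u ≫ k = a ∧ u ≫ q = b

namespace IsProd

variable {R K T A : B} {k : R ⟶ K} {q : R ⟶ T} (H : IsProd k q)

include H

theorem hom_ext {u u' : A ⟶ R} (h₁ : u ≫ k = u' ≫ k) (h₂ : u ≫ q = u' ≫ q) : u = u' :=
  (H (u' ≫ k) (u' ≫ q)).unique ⟨h₁, h₂⟩ ⟨rfl, rfl⟩

theorem exists_lift (a : A ⟶ K) (b : A ⟶ T) : ∃ u : A ⟶ R, u ≫ k = a ∧ u ≫ q = b :=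
  (H a b).exists

end IsProd

end

section

variable {B : Type u₁} [Category.{v₁} B] [HasFiniteProducts B]

theorem isProd_fst_snd (K T : B) : IsProd (prod.fst : K ⨯ T ⟶ K) prod.snd := fun _ a b =>
  ⟨prod.lift a b, ⟨prod.lift_fst _ _, prod.lift_snd _ _⟩, fun u hu =>
    Limits.prod.hom_ext (by rw [hu.1, prod.lift_fst]) (by rw [hu.2, prod.lift_snd])⟩

/-- Contexts accumulate: a context K' added on top of a context K amounts to the single context K' ×
K. -/
theorem IsProd.comp {R K T R' K' : B} {k : R ⟶ K} {q : R ⟶ T} {k' : R' ⟶ K'} {q' : R' ⟶ R}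
    (H : IsProd k q) (H' : IsProd k' q') : IsProd (prod.lift k' (q' ≫ k)) (q' ≫ q) := by
  intro A x y
  obtain ⟨v, v₁, v₂⟩ := H.exists_lift (x ≫ prod.snd) y
  obtain ⟨u, u₁, u₂⟩ := H'.exists_lift (x ≫ prod.fst) v
  refine ⟨u, ⟨Limits.prod.hom_ext ?_ ?_, ?_⟩, ?_⟩
  · rw [Category.assoc, prod.lift_fst, u₁]
  · rw [Category.assoc, prod.lift_snd, ← Category.assoc, u₂, v₁]
  · rw [← Category.assoc, u₂, v₂]
  · rintro u' ⟨hx, hy⟩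
    refine H'.hom_ext ?_ (H.hom_ext ?_ ?_)
    · rw [u₁, ← hx, Category.assoc, prod.lift_fst]
    · rw [u₂, v₁, ← hx, Category.assoc, Category.assoc, prod.lift_snd]
    · rw [u₂, v₂, ← hy, Category.assoc]

theorem isProd_terminal (T : B) : IsProd (terminal.from T) (𝟙 T) := fun _ a b =>
  ⟨b, ⟨Subsingleton.elim _ _, Category.comp_id b⟩, fun u hu => by
    rw [← hu.2, Category.comp_id]⟩

end

/-! ### Arrows over arrows of the base -/

section

variable {B : Type u₁} [Category.{v₁} B] {E : Type u₂} [Category.{v₂} E] {p : E ⥤ B}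

namespace OverHom

@[simp]
theorem comp_hom {R S T : B} {f : R ⟶ S} {g : S ⟶ T} {k : R ⟶ T} {X : p.Fiber R}
    {Y : p.Fiber S} {Z : p.Fiber T} (φ : OverHom p f X Y) (ψ : OverHom p g Y Z)
    (h : f ≫ g = k) : (φ.comp ψ h).hom = φ.hom ≫ ψ.hom := rfl

@[simp]
theorem ofFiber_hom {S : B} {X Y : p.Fiber S} (φ : X ⟶ Y) :
    (ofFiber φ).hom = Functor.Fiber.fiberInclusion.map φ := rfl

@[simp]
theorem toFiber_map {S : B} {X Y : p.Fiber S} (φ : OverHom p (𝟙 S) X Y) :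
    Functor.Fiber.fiberInclusion.map φ.toFiber = φ.hom := rfl

/-- The identity, over the identity. -/
def id {S : B} (X : p.Fiber S) : OverHom p (𝟙 S) X X :=
  ofFiber (𝟙 X)

@[simp]
theorem id_hom {S : B} (X : p.Fiber S) : (id X).hom = 𝟙 _ := rfl

instance {S : B} (X : p.Fiber S) : IsIso (id X).hom :=
  inferInstanceAs (IsIso (𝟙 _))

/-- The same arrow, over an equal arrow of the base. -/
def rebase {S T : B} {u u' : S ⟶ T} {X : p.Fiber S} {Y : p.Fiber T} (φ : OverHom p u X Y)
    (h : u = u') : OverHom p u' X Y :=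
  ⟨φ.hom, h ▸ φ.isHomLift⟩

@[simp]
theorem rebase_hom {S T : B} {u u' : S ⟶ T} {X : p.Fiber S} {Y : p.Fiber T}
    (φ : OverHom p u X Y) (h : u = u') : (φ.rebase h).hom = φ.hom := rfl

/-- An arrow of the total category lies over only one arrow of the base. Equations upstairs thus
yield the base equations that the typing of `OverHom` demands. -/
theorem base_eq {S T : B} {u u' : S ⟶ T} {X : p.Fiber S} {Y : p.Fiber T}
    {φ : OverHom p u X Y} {ψ : OverHom p u' X Y} (h : φ.hom = ψ.hom) : u = u' := by
  obtain ⟨a, ha⟩ := φ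
  obtain ⟨b, hb⟩ := ψ
  obtain rfl : a = b := h
  exact (IsHomLift.fac p u a).trans (IsHomLift.fac p u' a).symm

/-- The inverse of an invertible arrow. -/
noncomputable def inv {S T : B} {u : S ⟶ T} {X : p.Fiber S} {Y : p.Fiber T}
    (φ : OverHom p u X Y) [IsIso φ.hom] (v : T ⟶ S) (h : u ≫ v = 𝟙 S) : OverHom p v Y X :=
  ⟨CategoryTheory.inv φ.hom, by
    have := IsHomLift.isIso_of_lift_isIso p u φ.hom
    obtain rfl : v = CategoryTheory.inv u := (IsIso.inv_eq_of_hom_inv_id h).symm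
    infer_instance⟩

@[simp]
theorem inv_hom {S T : B} {u : S ⟶ T} {X : p.Fiber S} {Y : p.Fiber T}
    (φ : OverHom p u X Y) [IsIso φ.hom] (v : T ⟶ S) (h : u ≫ v = 𝟙 S) :
    (φ.inv v h).hom = CategoryTheory.inv φ.hom := rfl

instance {S T : B} {u : S ⟶ T} {X : p.Fiber S} {Y : p.Fiber T}
    (φ : OverHom p u X Y) [IsIso φ.hom] (v : T ⟶ S) (h : u ≫ v = 𝟙 S) : IsIso (φ.inv v h).hom :=
  inferInstanceAs (IsIso (CategoryTheory.inv φ.hom))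

theorem isIso_toFiber {S : B} {X Y : p.Fiber S} (φ : OverHom p (𝟙 S) X Y) [IsIso φ.hom] :
    IsIso φ.toFiber :=
  ⟨(φ.inv (𝟙 S) (Category.comp_id _)).toFiber,
    Functor.Fiber.hom_ext (IsIso.hom_inv_id φ.hom),
    Functor.Fiber.hom_ext (IsIso.inv_hom_id φ.hom)⟩

end OverHom

/-! ### Conjunctions -/

/-- The arrows `a` and `b`, over `q` and `r`, exhibit `M` as the conjunction `X[q] ∧ Y[r]`. -/
def IsMeet {S T₁ T₂ : B} {q : S ⟶ T₁} {r : S ⟶ T₂} {M : p.Fiber S} {X : p.Fiber T₁}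
    {Y : p.Fiber T₂} (a : OverHom p q M X) (b : OverHom p r M Y) : Prop :=
  ∀ ⦃R : B⦄ (u : R ⟶ S) ⦃N : p.Fiber R⦄ ⦃q' : R ⟶ T₁⦄ ⦃r' : R ⟶ T₂⦄ (x : OverHom p q' N X)
    (y : OverHom p r' N Y), u ≫ q = q' → u ≫ r = r' →
    ∃! z : OverHom p u N M, z.hom ≫ a.hom = x.hom ∧ z.hom ≫ b.hom = y.hom

namespace IsMeet

variable {R S T₁ T₂ : B} {q : S ⟶ T₁} {r : S ⟶ T₂} {M : p.Fiber S} {X : p.Fiber T₁}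
  {Y : p.Fiber T₂} {a : OverHom p q M X} {b : OverHom p r M Y} (H : IsMeet a b)

/-- The pairing into a conjunction. -/
noncomputable def lift (u : R ⟶ S) {N : p.Fiber R} {q' : R ⟶ T₁} {r' : R ⟶ T₂}
    (x : OverHom p q' N X) (y : OverHom p r' N Y) (hq : u ≫ q = q') (hr : u ≫ r = r') :
    OverHom p u N M :=
  (H u x y hq hr).exists.choose

section

variable (u : R ⟶ S) {N : p.Fiber R} {q' : R ⟶ T₁} {r' : R ⟶ T₂}
    (x : OverHom p q' N X) (y : OverHom p r' N Y) (hq : u ≫ q = q') (hr : u ≫ r = r')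

@[simp]
theorem lift_left : (H.lift u x y hq hr).hom ≫ a.hom = x.hom :=
  (H u x y hq hr).exists.choose_spec.1

@[simp]
theorem lift_right : (H.lift u x y hq hr).hom ≫ b.hom = y.hom :=
  (H u x y hq hr).exists.choose_spec.2

@[simp]
theorem lift_left_assoc {Z : E} (f : Functor.Fiber.fiberInclusion.obj X ⟶ Z) :
    (H.lift u x y hq hr).hom ≫ a.hom ≫ f = x.hom ≫ f := by
  rw [← Category.assoc, lift_left]

@[simp]
theorem lift_right_assoc {Z : E} (f : Functor.Fiber.fiberInclusion.obj Y ⟶ Z) :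
    (H.lift u x y hq hr).hom ≫ b.hom ≫ f = y.hom ≫ f := by
  rw [← Category.assoc, lift_right]

end

include H in
theorem hom_ext {u : R ⟶ S} {N : p.Fiber R} {z z' : OverHom p u N M}
    (h₁ : z.hom ≫ a.hom = z'.hom ≫ a.hom) (h₂ : z.hom ≫ b.hom = z'.hom ≫ b.hom) :
    z.hom = z'.hom :=
  congrArg OverHom.hom ((H u (z'.comp a rfl) (z'.comp b rfl) rfl rfl).unique ⟨h₁, h₂⟩ ⟨rfl, rfl⟩)

include H in
theorem symm : IsMeet b a := fun _ u _ _ _ x y hq hr => by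
  obtain ⟨z, hz, hz'⟩ := H u y x hr hq
  exact ⟨z, hz.symm, fun z' h => hz' z' h.symm⟩

include H in
/-- A conjunction may be pulled back along a cartesian arrow, and one of its members along
another. -/
theorem of_cartesian {S' T' : B} {s : S' ⟶ S} {M' : p.Fiber S'} (m : OverHom p s M' M)
    [p.IsStronglyCartesian s m.hom] {t : T' ⟶ T₂} {Y' : p.Fiber T'} (y : OverHom p t Y' Y)
    [p.IsStronglyCartesian t y.hom] {q' : S' ⟶ T₁} {r' : S' ⟶ T'} {a' : OverHom p q' M' X}
    {b' : OverHom p r' M' Y'} (ha : a'.hom = m.hom ≫ a.hom) (hb : b'.hom ≫ y.hom = m.hom ≫ b.hom) :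
    IsMeet a' b' := by
  intro R u N q'' r'' x v hq hr
  have e₁ : q' = s ≫ q := OverHom.base_eq (φ := a') (ψ := m.comp a rfl) ha
  have e₂ : r' ≫ t = s ≫ r :=
    OverHom.base_eq (φ := b'.comp y rfl) (ψ := m.comp b rfl) hb
  obtain ⟨z₁, ⟨h₁, h₂⟩, -⟩ := H (u ≫ s) x (v.comp y rfl)
    (by rw [Category.assoc, ← e₁, hq]) (by rw [Category.assoc, ← e₂, ← hr, Category.assoc])
  have hz := Functor.IsStronglyCartesian.fac p s m.hom (g := u) rfl z₁.hom
  set z := Functor.IsStronglyCartesian.map p s m.hom (g := u) rfl z₁.hom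
  refine ⟨⟨z, inferInstance⟩, ⟨?_, ?_⟩, ?_⟩
  · change z ≫ a'.hom = _
    rw [ha, ← Category.assoc, hz, h₁]
  · change z ≫ b'.hom = _
    have : p.IsHomLift r'' (z ≫ b'.hom) := hr ▸ inferInstance
    refine Functor.IsStronglyCartesian.ext p t y.hom r'' ?_
    rw [Category.assoc, hb, ← Category.assoc, hz, h₂]; rfl
  · rintro z' ⟨h₁', h₂'⟩
    refine OverHom.ext (Functor.IsStronglyCartesian.ext p s m.hom u ?_)
    change z'.hom ≫ m.hom = z ≫ m.hom
    rw [hz]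
    refine H.hom_ext (z := z'.comp m rfl) ?_ ?_
    · rw [h₁, OverHom.comp_hom, Category.assoc, ← ha, h₁']
    · rw [h₂, OverHom.comp_hom, Category.assoc, ← hb, ← Category.assoc, h₂']; rfl

include H in
/-- Conjunctions are associative. -/
theorem assoc {S₂ U V : B} {m : S₂ ⟶ S} {n : S₂ ⟶ U} {M₂ : p.Fiber S₂} {Z : p.Fiber U}
    {f : OverHom p m M₂ M} {g : OverHom p n M₂ Z} (H₂ : IsMeet f g) {v : V ⟶ T₂} {w : V ⟶ U}
    {Q : p.Fiber V} {c : OverHom p v Q Y} {d : OverHom p w Q Z} (K : IsMeet c d)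
    {m' : S₂ ⟶ V} {x : S₂ ⟶ T₁} (e : OverHom p m' M₂ Q) (hc : e.hom ≫ c.hom = f.hom ≫ b.hom)
    (hd : e.hom ≫ d.hom = g.hom) (a' : OverHom p x M₂ X) (ha' : a'.hom = f.hom ≫ a.hom) :
    IsMeet a' e := by
  intro R u N q' r' x' y' hq hr
  have e₁ : x = m ≫ q := OverHom.base_eq (φ := a') (ψ := f.comp a rfl) ha'
  have e₂ : m' ≫ v = m ≫ r :=
    OverHom.base_eq (φ := e.comp c rfl) (ψ := f.comp b rfl) hc
  have e₃ : m' ≫ w = n := OverHom.base_eq (φ := e.comp d rfl) (ψ := g) hd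
  have h₁ : u ≫ m ≫ q = q' := by rw [← e₁, hq]
  have h₂ : u ≫ m ≫ r = r' ≫ v := by rw [← e₂, ← hr, Category.assoc]
  have h₃ : u ≫ n = r' ≫ w := by rw [← e₃, ← hr, Category.assoc]
  refine ⟨H₂.lift u (H.lift (u ≫ m) x' (y'.comp c rfl) (by rw [Category.assoc, h₁])
    (by rw [Category.assoc, h₂])) (y'.comp d rfl) rfl h₃, ⟨?_, ?_⟩, ?_⟩
  · simp [ha']
  · refine K.hom_ext (z := OverHom.comp _ e hr) (z' := y') ?_ ?_
    · simp [hc]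
    · simp [hd]
  · rintro z ⟨k₁, k₂⟩
    refine OverHom.ext (H₂.hom_ext ?_ ?_)
    · rw [lift_left]
      refine H.hom_ext (z := z.comp f rfl) ?_ ?_
      · rw [lift_left, ← k₁, ha', OverHom.comp_hom, Category.assoc]
      · rw [lift_right, OverHom.comp_hom, OverHom.comp_hom, ← k₂, Category.assoc, Category.assoc,
          hc]
    · rw [lift_right, OverHom.comp_hom, ← k₂, Category.assoc, hd]

end IsMeet

/-! ### Opcartesian arrows -/

/-- The arrow `φ` is opcartesian. -/
def IsOpcart {S T : B} {g : S ⟶ T} {X : p.Fiber S} {Z : p.Fiber T} (φ : OverHom p g X Z) : Prop :=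
  ∀ ⦃T' : B⦄ (w : T ⟶ T') ⦃w' : S ⟶ T'⦄ ⦃W : p.Fiber T'⦄ (ψ : OverHom p w' X W), g ≫ w = w' →
    ∃! χ : OverHom p w Z W, φ.hom ≫ χ.hom = ψ.hom

namespace IsOpcart

variable {R S T : B} {f : R ⟶ S} {g : S ⟶ T} {k : R ⟶ T} {X : p.Fiber R} {Y : p.Fiber S}
  {Z : p.Fiber T}

theorem hom_ext {φ : OverHom p f X Y} (H : IsOpcart φ) {W : p.Fiber T}
    {χ χ' : OverHom p g Y W} (h : φ.hom ≫ χ.hom = φ.hom ≫ χ'.hom) : χ.hom = χ'.hom :=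
  congrArg OverHom.hom ((H g (φ.comp χ' rfl) rfl).unique h rfl)

theorem comp {φ : OverHom p f X Y} {ψ : OverHom p g Y Z} (H : IsOpcart φ) (H' : IsOpcart ψ)
    (h : f ≫ g = k) : IsOpcart (φ.comp ψ h) := by
  intro T' w w' W χ hw
  obtain ⟨χ₁, h₁, -⟩ := H (g ≫ w) χ (by rw [← Category.assoc, h, hw])
  obtain ⟨χ₂, h₂, -⟩ := H' w χ₁ rfl
  refine ⟨χ₂, ?_, fun χ' h' => ?_⟩
  · change (φ.hom ≫ ψ.hom) ≫ χ₂.hom = _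
    rw [Category.assoc, h₂, h₁]
  · refine OverHom.ext (H'.hom_ext (H.hom_ext (χ := ψ.comp χ' rfl) (χ' := ψ.comp χ₂ rfl) ?_))
    rw [OverHom.comp_hom, OverHom.comp_hom, h₂, h₁, ← h', OverHom.comp_hom, Category.assoc]

theorem of_isIso (φ : OverHom p f X Y) [IsIso φ.hom] : IsOpcart φ := by
  intro T' w w' W χ hw
  have := IsHomLift.isIso_of_lift_isIso p f φ.hom
  refine ⟨(φ.inv (inv f) (by simp)).comp χ (by rw [← hw, IsIso.inv_hom_id_assoc]), by simp,
    fun χ' h' => OverHom.ext ?_⟩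
  rw [OverHom.comp_hom, ← h', OverHom.inv_hom, IsIso.inv_hom_id_assoc]

/-- An arrow over the identity that compares two opcartesian arrows is invertible. -/
theorem isIso {φ : OverHom p f X Y} {Y' : p.Fiber S} {φ' : OverHom p f X Y'} (H : IsOpcart φ)
    (H' : IsOpcart φ') {j : OverHom p (𝟙 S) Y Y'} (h : φ.hom ≫ j.hom = φ'.hom) :
    IsIso j.hom := by
  obtain ⟨i, hi, -⟩ := H' (𝟙 S) φ (Category.comp_id f)
  refine ⟨i.hom, ?_, ?_⟩
  · refine H.hom_ext (χ := j.comp i (Category.comp_id _)) (χ' := OverHom.id Y) ?_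
    rw [OverHom.comp_hom, ← Category.assoc, h, hi, OverHom.id_hom, Category.comp_id]
  · refine H'.hom_ext (χ := i.comp j (Category.comp_id _)) (χ' := OverHom.id Y') ?_
    rw [OverHom.comp_hom, ← Category.assoc, hi, h, OverHom.id_hom, Category.comp_id]

end IsOpcart

end

section

variable {B : Type u₁} [Category.{v₁} B] {E : Type u₂} [Category.{v₂} E] {p : E ⥤ B}
  [p.IsFibered]

instance {S T : B} (f : S ⟶ T) (Y : p.Fiber T) :
    p.IsStronglyCartesian f (pullMap p f Y).hom := inferInstance

instance {S T : B} (f : S ⟶ T) [IsIso f] (Y : p.Fiber T) : IsIso (pullMap p f Y).hom :=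
  Functor.IsStronglyCartesian.isIso_of_base_isIso p f _

/-- It is enough to factor arrows over the same arrow of the base. -/
theorem IsOpcart.of_fiber {S T : B} {g : S ⟶ T} {X : p.Fiber S} {Z : p.Fiber T}
    {φ : OverHom p g X Z}
    (H : ∀ {W : p.Fiber T} (ψ : OverHom p g X W), ∃! χ : OverHom p (𝟙 T) Z W,
      φ.hom ≫ χ.hom = ψ.hom) : IsOpcart φ := by
  intro T' w w' W ψ hw
  obtain ⟨χ, hχ, hχ'⟩ := H (pullLift p hw ψ)
  refine ⟨χ.comp (pullMap p w W) (Category.id_comp w), ?_, fun χ₁ h₁ => ?_⟩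
  · change φ.hom ≫ χ.hom ≫ _ = _
    rw [← Category.assoc, hχ, pullLift_fac]
  · have := hχ' (pullLift p (Category.id_comp w) χ₁) (congrArg OverHom.hom
      (pull_ext p (φ := φ.comp (pullLift p (Category.id_comp w) χ₁) (Category.comp_id g))
        (ψ := pullLift p hw ψ) ?_))
    · rw [← this]
      exact OverHom.ext (pullLift_fac p _ _).symm
    · rw [pullLift_fac, OverHom.comp_hom, Category.assoc, pullLift_fac, h₁]

end

section

variable {B : Type u₁} [Category.{v₁} B] [HasFiniteProducts B] {E : Type u₂} [Category.{v₂} E]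
  {p : E ⥤ B} [IsCartesianFibration p]

theorem terminal_hom_ext {S T : B} {X : p.Fiber S} {u u' : S ⟶ T}
    (φ : OverHom p u X (⊤_ (p.Fiber T))) (ψ : OverHom p u' X (⊤_ (p.Fiber T))) (h : u = u') :
    φ.hom = ψ.hom := by
  subst h
  rw [terminal_overHom_ext p φ ψ]

/-- The conjunction `X[q] ∧ Y[r]`. -/
noncomputable def meet {S T₁ T₂ : B} (q : S ⟶ T₁) (r : S ⟶ T₂) (X : p.Fiber T₁)
    (Y : p.Fiber T₂) : p.Fiber S :=
  pull p q X ⨯ pull p r Y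

section

variable {S T₁ T₂ : B} (q : S ⟶ T₁) (r : S ⟶ T₂) (X : p.Fiber T₁) (Y : p.Fiber T₂)

/-- The first projection from a conjunction. -/
noncomputable def meetFst : OverHom p q (meet q r X Y) X :=
  (OverHom.ofFiber (prod.fst : meet q r X Y ⟶ pull p q X)).comp (pullMap p q X)
    (Category.id_comp _)

/-- The second projection from a conjunction. -/
noncomputable def meetSnd : OverHom p r (meet q r X Y) Y :=
  (OverHom.ofFiber (prod.snd : meet q r X Y ⟶ pull p r Y)).comp (pullMap p r Y)
    (Category.id_comp _)

/-- Base change preserves fibre products, so a product in a fibre receives pairings from every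
fibre, over any arrow of the base. The cartesian arrows `a` and `b` then carry this property to
members in other fibres. -/
theorem isMeet_prod {M₁ M₂ : p.Fiber S} {X : p.Fiber T₁} {Y : p.Fiber T₂} (a : OverHom p q M₁ X)
    [p.IsStronglyCartesian q a.hom] (b : OverHom p r M₂ Y) [p.IsStronglyCartesian r b.hom] :
    IsMeet ((OverHom.ofFiber (prod.fst : M₁ ⨯ M₂ ⟶ M₁)).comp a (Category.id_comp _))
      ((OverHom.ofFiber (prod.snd : M₁ ⨯ M₂ ⟶ M₂)).comp b (Category.id_comp _)) := by
  intro R u N q' r' x y hq hr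
  have h₁ := Functor.IsStronglyCartesian.fac p q a.hom (g := u) hq.symm x.hom
  set z₁ := Functor.IsStronglyCartesian.map p q a.hom (g := u) hq.symm x.hom
  have h₂ := Functor.IsStronglyCartesian.fac p r b.hom (g := u) hr.symm y.hom
  set z₂ := Functor.IsStronglyCartesian.map p r b.hom (g := u) hr.symm y.hom
  refine ⟨prodLift p (⟨z₁, inferInstance⟩ : OverHom p u N M₁)
    (⟨z₂, inferInstance⟩ : OverHom p u N M₂), ⟨?_, ?_⟩, ?_⟩
  · refine Eq.trans ?_ h₁
    rw [OverHom.comp_hom, ← Category.assoc]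
    exact congrArg (· ≫ _) (prodLift_fst p _ _)
  · refine Eq.trans ?_ h₂
    rw [OverHom.comp_hom, ← Category.assoc]
    exact congrArg (· ≫ _) (prodLift_snd p _ _)
  · rintro z ⟨k₁, k₂⟩
    refine prod_overHom_ext p ?_ ?_
    · refine Eq.trans ?_ (prodLift_fst p _ _).symm
      have : p.IsHomLift u (z.hom ≫ Functor.Fiber.fiberInclusion.map (prod.fst : M₁ ⨯ M₂ ⟶ M₁)) :=
        inferInstance
      refine Functor.IsStronglyCartesian.ext p q a.hom u ?_
      exact (Category.assoc _ _ _).trans (k₁.trans h₁.symm)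
    · refine Eq.trans ?_ (prodLift_snd p _ _).symm
      have : p.IsHomLift u (z.hom ≫ Functor.Fiber.fiberInclusion.map (prod.snd : M₁ ⨯ M₂ ⟶ M₂)) :=
        inferInstance
      refine Functor.IsStronglyCartesian.ext p r b.hom u ?_
      exact (Category.assoc _ _ _).trans (k₂.trans h₂.symm)

theorem isMeet_meet : IsMeet (meetFst q r X Y) (meetSnd q r X Y) :=
  isMeet_prod q r (pullMap p q X) (pullMap p r Y)

end

/-- Conjunction with ⊤ is no condition. This is how statements without a conjunct are read as
instances of statements with one. -/
theorem isMeet_terminal {S T₁ T₂ : B} {q : S ⟶ T₁} {r : S ⟶ T₂} {M : p.Fiber S}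
    {X : p.Fiber T₁} (a : OverHom p q M X) [p.IsStronglyCartesian q a.hom]
    (b : OverHom p r M (⊤_ (p.Fiber T₂))) : IsMeet a b := by
  intro R u N q' r' x y hq hr
  have h₁ := Functor.IsStronglyCartesian.fac p q a.hom (g := u) hq.symm x.hom
  set z₁ := Functor.IsStronglyCartesian.map p q a.hom (g := u) hq.symm x.hom
  refine ⟨⟨z₁, inferInstance⟩, ⟨h₁, ?_⟩, fun z hz => OverHom.ext ?_⟩
  · exact terminal_hom_ext (OverHom.comp ⟨z₁, inferInstance⟩ b rfl) y hr
  · exact Functor.IsStronglyCartesian.ext p q a.hom u (hz.1.trans h₁.symm)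

theorem isMeet_conj {I J K : B} (α : Rel p I J) (P : LPath (Rel p) J K) :
    IsMeet (conjHead α P) (conjTail α P) :=
  isMeet_meet _ _ _ _

end

end Fibration

namespace Fibration

section

variable {B : Type u₁} [Category.{v₁} B] [HasFiniteProducts B] {E : Type u₂} [Category.{v₂} E]
  {p : E ⥤ B} [IsCartesianFibration p]

/-! ### Stably opcartesian arrows -/

section

variable {S T S' T' : B} {g : S ⟶ T} {X : p.Fiber S} {Z : p.Fiber T}

/-- The arrow `φ : X ⟶ Z` over `g` stays opcartesian after base change along a square
`h ≫ g = g' ≫ k` and conjunction with any object over the codomain of `g'`. -/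
def IsStableAlong (φ : OverHom p g X Z) (h : S' ⟶ S) (g' : S' ⟶ T') (k : T' ⟶ T) : Prop :=
  ∀ ⦃Y : p.Fiber T'⦄ ⦃M : p.Fiber S'⦄ ⦃N : p.Fiber T'⦄ ⦃a : OverHom p h M X⦄
    ⦃b : OverHom p g' M Y⦄ ⦃c : OverHom p k N Z⦄ ⦃d : OverHom p (𝟙 T') N Y⦄
    (θ : OverHom p g' M N), IsMeet a b → IsMeet c d → θ.hom ≫ c.hom = a.hom ≫ φ.hom →
    θ.hom ≫ d.hom = b.hom → IsOpcart θ

/-- The arrow `φ` stays opcartesian in any context. -/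
def IsStablyOpcart (φ : OverHom p g X Z) : Prop :=
  ∀ ⦃S' T' K : B⦄ (h : S' ⟶ S) (g' : S' ⟶ T') (k : T' ⟶ T) (κ : T' ⟶ K), IsProd κ k →
    IsProd (g' ≫ κ) h → IsStableAlong φ h g' k

/-- The conjunct may live over any base V instead of over T': it enters a conjunction only through
its base change to T', to which the definition applies. -/
theorem IsStableAlong.isOpcart_of_meet {φ : OverHom p g X Z} {h : S' ⟶ S} {g' : S' ⟶ T'}
    {k : T' ⟶ T} (H : IsStableAlong φ h g' k) {V : B} {r : T' ⟶ V} {s : S' ⟶ V} {Y : p.Fiber V}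
    {M : p.Fiber S'} {N : p.Fiber T'} {a : OverHom p h M X} {b : OverHom p s M Y}
    {c : OverHom p k N Z} {d : OverHom p r N Y} (θ : OverHom p g' M N) (hM : IsMeet a b)
    (hN : IsMeet c d) (h₁ : θ.hom ≫ c.hom = a.hom ≫ φ.hom) (h₂ : θ.hom ≫ d.hom = b.hom) :
    IsOpcart θ := by
  have hs : g' ≫ r = s := OverHom.base_eq (φ := θ.comp d rfl) h₂
  refine H (b := pullLift p hs b) (c := c) (d := pullLift p (Category.id_comp r) d) θ
    (hM.of_cartesian (OverHom.id M) (pullMap p r Y) (Category.id_comp _).symm ?_)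
    (hN.of_cartesian (OverHom.id N) (pullMap p r Y) (Category.id_comp _).symm ?_) h₁ ?_
  · rw [pullLift_fac]; exact (Category.id_comp _).symm
  · rw [pullLift_fac]; exact (Category.id_comp _).symm
  · refine congrArg OverHom.hom (pull_ext p
      (φ := θ.comp (pullLift p (Category.id_comp r) d) (Category.comp_id _))
      (ψ := pullLift p hs b) ?_)
    rw [OverHom.comp_hom, Category.assoc, pullLift_fac, pullLift_fac, h₂]

/-- The given arrow is conjugated by the cartesian lifts of `e.inv` and `r.inv`. These are
invertible, hence opcartesian, and the conjugate is an instance of the hypothesis. -/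
theorem IsStableAlong.of_iso {φ : OverHom p g X Z} {h : S' ⟶ S} {g' : S' ⟶ T'}
    {k : T' ⟶ T} (H : IsStableAlong φ h g' k) {S'' T'' : B} {h' : S'' ⟶ S} {g'' : S'' ⟶ T''}
    {k' : T'' ⟶ T} (e : S'' ≅ S') (r : T'' ≅ T') (w : e.hom ≫ g' = g'' ≫ r.hom)
    (hh : e.hom ≫ h = h') (hk : r.hom ≫ k = k') : IsStableAlong φ h' g'' k' := by
  intro Y M N a b c d θ hM hN h₁ h₂
  have w' : e.inv ≫ g'' = g' ≫ r.inv := by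
    rw [Iso.inv_comp_eq, ← Category.assoc, Iso.eq_comp_inv, w]
  let m := pullMap p e.inv M
  let n := pullMap p r.inv N
  let y := pullMap p r.inv Y
  have hθ := pullLift_fac p w'.symm (m.comp θ rfl)
  have hb := pullLift_fac p w'.symm (m.comp b rfl)
  have hd := pullLift_fac p (Category.id_comp r.inv) (n.comp d (Category.comp_id _))
  set θ' := pullLift p w'.symm (m.comp θ rfl)
  set b' := pullLift p w'.symm (m.comp b rfl)
  set d' := pullLift p (Category.id_comp r.inv) (n.comp d (Category.comp_id _))
  have hm := hM.of_cartesian m y (a' := m.comp a (by rw [← hh, Iso.inv_hom_id_assoc])) (b' := b')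
    rfl hb
  have hn := hN.of_cartesian n y (a' := n.comp c (by rw [← hk, Iso.inv_hom_id_assoc])) (b' := d')
    rfl hd
  have key := H θ' hm hn (by
    rw [OverHom.comp_hom, ← Category.assoc]
    refine (congrArg (· ≫ c.hom) hθ).trans ?_
    simp [h₁]) (congrArg OverHom.hom (pull_ext p
      (φ := θ'.comp d' (Category.comp_id _)) (ψ := b') (by
        rw [OverHom.comp_hom, Category.assoc, hd, hb, OverHom.comp_hom, ← Category.assoc]
        refine (congrArg (· ≫ d.hom) hθ).trans ?_
        simp [h₂])))
  have k₁ : IsIso m.hom := inferInstanceAs (IsIso (pullMap p e.inv M).hom)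
  have k₂ : IsIso n.hom := inferInstanceAs (IsIso (pullMap p r.inv N).hom)
  have := ((IsOpcart.of_isIso (m.inv e.hom e.inv_hom_id)).comp key w).comp (IsOpcart.of_isIso n)
    (k := g'') (by simp)
  intro T₁ x x' W ψ hx
  obtain ⟨χ, hχ, hχ'⟩ := this x ψ hx
  have e' : θ.hom = (((m.inv e.hom e.inv_hom_id).comp θ' w).comp n (k := g'') (by simp)).hom := by
    change _ = (inv m.hom ≫ _) ≫ _
    rw [Category.assoc]
    refine Eq.trans ?_ (congrArg (inv m.hom ≫ ·) hθ.symm)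
    simp
  refine ⟨χ, ?_, fun χ₁ h₁ => hχ' _ ?_⟩
  · change _ ≫ χ.hom = _
    rw [e']; exact hχ
  · change _ ≫ χ₁.hom = _
    rw [← e']; exact h₁

/-- Products with a given K are unique up to isomorphism, so one convenient choice of square for
each K is enough. -/
theorem IsStablyOpcart.of_forall_context {φ : OverHom p g X Z}
    (H : ∀ K : B, ∃ (S' T' : B) (h : S' ⟶ S) (g' : S' ⟶ T') (k : T' ⟶ T) (κ : T' ⟶ K),
      IsProd κ k ∧ IsProd (g' ≫ κ) h ∧ h ≫ g = g' ≫ k ∧ IsStableAlong φ h g' k) :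
    IsStablyOpcart φ := by
  intro S'' T'' K h' g'' k' κ' P₁ P₂ Y M N a b c d θ hM hN h₁ h₂
  obtain ⟨S', T', h, g', k, κ, Q₁, Q₂, w, hφ⟩ := H K
  have w' : h' ≫ g = g'' ≫ k' :=
    (OverHom.base_eq (φ := θ.comp c rfl) (ψ := a.comp φ rfl) h₁).symm
  obtain ⟨e, e₁, e₂⟩ := Q₂.exists_lift (g'' ≫ κ') h'
  obtain ⟨e', e₁', e₂'⟩ := P₂.exists_lift (g' ≫ κ) h
  obtain ⟨r, r₁, r₂⟩ := Q₁.exists_lift κ' k'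
  obtain ⟨r', r₁', r₂'⟩ := P₁.exists_lift κ k
  refine hφ.of_iso ⟨e, e', P₂.hom_ext ?_ ?_, Q₂.hom_ext ?_ ?_⟩
    ⟨r, r', P₁.hom_ext ?_ ?_, Q₁.hom_ext ?_ ?_⟩ (Q₁.hom_ext ?_ ?_) e₂ r₂ θ hM hN h₁ h₂
  · rw [Category.assoc, e₁', e₁, Category.id_comp]
  · rw [Category.assoc, e₂', e₂, Category.id_comp]
  · rw [Category.assoc, e₁, e₁', Category.id_comp]
  · rw [Category.assoc, e₂, e₂', Category.id_comp]
  · rw [Category.assoc, r₁', r₁, Category.id_comp]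
  · rw [Category.assoc, r₂', r₂, Category.id_comp]
  · rw [Category.assoc, r₁, r₁', Category.id_comp]
  · rw [Category.assoc, r₂, r₂', Category.id_comp]
  · rw [Category.assoc, e₁, Category.assoc, r₁]
  · change (e ≫ g') ≫ k = (g'' ≫ r) ≫ k
    rw [Category.assoc, Category.assoc, r₂, ← w', ← w, ← Category.assoc, e₂]

end

namespace IsStablyOpcart

variable {R S T : B} {f : R ⟶ S} {g : S ⟶ T} {k : R ⟶ T} {X : p.Fiber R} {Y : p.Fiber S}
  {Z : p.Fiber T}

/-- The case of the terminal context and the conjunct ⊤. -/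
theorem isOpcart {φ : OverHom p f X Y} (H : IsStablyOpcart φ) : IsOpcart φ :=
  H (𝟙 R) f (𝟙 S) (terminal.from S) (isProd_terminal S)
    ((Subsingleton.elim (terminal.from R) (f ≫ terminal.from S)) ▸ isProd_terminal R)
    (Y := ⊤_ (p.Fiber S)) (a := OverHom.id X) (b := terminalLift p X f) (c := OverHom.id Y)
    (d := terminalLift p Y (𝟙 S)) φ
    (isMeet_terminal _ _)
    (isMeet_terminal _ _)
    ((Category.comp_id _).trans (Category.id_comp _).symm)
    (terminal_hom_ext (φ.comp (terminalLift p Y (𝟙 S)) rfl) _ (Category.comp_id _))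

/-- If f is invertible then so is its enlargement by K, and the conjunctions upstairs are then
isomorphic by their universal property. -/
theorem of_isIso (φ : OverHom p f X Y) [IsIso φ.hom] : IsStablyOpcart φ := by
  intro S' T' K h g' k κ P₁ P₂ Y' M N a b c d θ hM hN h₁ h₂
  have := IsHomLift.isIso_of_lift_isIso p f φ.hom
  have w : h ≫ f = g' ≫ k :=
    (OverHom.base_eq (φ := θ.comp c rfl) (ψ := a.comp φ rfl) h₁).symm
  obtain ⟨v, v₁, v₂⟩ := P₂.exists_lift κ (k ≫ inv f)
  have e₁ : g' ≫ v = 𝟙 S' := P₂.hom_ext (by rw [Category.assoc, v₁, Category.id_comp])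
    (by rw [Category.assoc, v₂, ← Category.assoc, ← w, Category.assoc, IsIso.hom_inv_id,
      Category.comp_id, Category.id_comp])
  have e₂ : v ≫ g' = 𝟙 T' := P₁.hom_ext (by rw [Category.assoc, v₁, Category.id_comp])
    (by rw [Category.assoc, ← w, ← Category.assoc, v₂, Category.assoc, IsIso.inv_hom_id,
      Category.comp_id, Category.id_comp])
  let θ' : OverHom p v N M := hM.lift v (c.comp (φ.inv (inv f) (by simp)) rfl) d v₂ e₂
  have : IsIso θ.hom := by
    refine ⟨θ'.hom, ?_, ?_⟩
    · refine hM.hom_ext (z := θ.comp θ' e₁) (z' := OverHom.id M) ?_ ?_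
      · simp only [θ', OverHom.comp_hom, Category.assoc, IsMeet.lift_left, OverHom.inv_hom]
        rw [← Category.assoc, h₁]
        simp
      · simp [θ', h₂]
    · refine hN.hom_ext (z := θ'.comp θ e₂) (z' := OverHom.id N) ?_ ?_
      · simp [θ', h₁]
      · simp [θ', h₂]
  exact IsOpcart.of_isIso θ

/-- The enlarged arrow factors through the conjunction of Y and V over K × S. The two factors are
enlargements of φ and of ψ, hence opcartesian. -/
theorem comp {φ : OverHom p f X Y} {ψ : OverHom p g Y Z} (H : IsStablyOpcart φ)
    (H' : IsStablyOpcart ψ) (w : f ≫ g = k) : IsStablyOpcart (φ.comp ψ w) := by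
  intro S' T' K h G k' κ P₁ P₂ V M N a b c d θ hM hN h₁ h₂
  have sq : h ≫ k = G ≫ k' :=
    (OverHom.base_eq (φ := θ.comp c rfl) (ψ := a.comp (φ.comp ψ w) rfl) h₁).symm
  obtain ⟨g₂, hg₂, hg₂'⟩ := P₁.exists_lift (prod.fst : K ⨯ S ⟶ K) (prod.snd ≫ g)
  let g₁ : S' ⟶ K ⨯ S := prod.lift (G ≫ κ) (h ≫ f)
  have hg₁ : g₁ ≫ prod.fst = G ≫ κ := prod.lift_fst _ _
  have hg₁' : g₁ ≫ prod.snd = h ≫ f := prod.lift_snd _ _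
  have hg : g₁ ≫ g₂ = G := P₁.hom_ext (by rw [Category.assoc, hg₂, hg₁])
    (by rw [Category.assoc, hg₂', ← Category.assoc, hg₁', Category.assoc, w, sq])
  have hQ := isMeet_meet (prod.snd : K ⨯ S ⟶ S) g₂ Y V
  let θ₁ := hQ.lift g₁ (a.comp φ rfl) b hg₁' hg
  let θ₂ := hN.lift g₂ ((meetFst (prod.snd : K ⨯ S ⟶ S) g₂ Y V).comp ψ rfl)
    (meetSnd (prod.snd : K ⨯ S ⟶ S) g₂ Y V) hg₂' (Category.comp_id _)
  have k₁ : IsOpcart θ₁ := (H h g₁ prod.snd prod.fst (isProd_fst_snd K S)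
    (hg₁ ▸ P₂)).isOpcart_of_meet θ₁ hM hQ (by simp [θ₁]) (by simp [θ₁])
  have k₂ : IsOpcart θ₂ := (H' prod.snd g₂ k' κ P₁ (hg₂ ▸ isProd_fst_snd K S)).isOpcart_of_meet θ₂
    hQ hN (by simp [θ₂]) (by simp [θ₂])
  have e : θ = θ₁.comp θ₂ hg := OverHom.ext (hN.hom_ext
    (by simp [θ₁, θ₂, h₁]) (by simp [θ₁, θ₂, h₂]))
  exact e ▸ k₁.comp k₂ hg

/-- Stably opcartesian arrows stay so after base change along a product projection and
conjunction. -/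
theorem whisker {φ : OverHom p f X Y} (H : IsStablyOpcart φ) {S' T' K V : B} {h : S' ⟶ R}
    {g' : S' ⟶ T'} {k : T' ⟶ S} (κ : T' ⟶ K) (P₁ : IsProd κ k) (P₂ : IsProd (g' ≫ κ) h)
    {r : T' ⟶ V} {s : S' ⟶ V} {W : p.Fiber V}
    {M : p.Fiber S'} {N : p.Fiber T'} {a : OverHom p h M X} {b : OverHom p s M W}
    {c : OverHom p k N Y} {d : OverHom p r N W} (θ : OverHom p g' M N) (hM : IsMeet a b)
    (hN : IsMeet c d) (h₁ : θ.hom ≫ c.hom = a.hom ≫ φ.hom) (h₂ : θ.hom ≫ d.hom = b.hom) :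
    IsStablyOpcart θ := by
  intro S₂ T₂ K₂ l g₂ k₂ κ₂ Q₁ Q₂ Y₂ M₂ N₂ a₂ b₂ c₂ d₂ θ₂ hM₂ hN₂ h₁₂ h₂₂
  have hs : g' ≫ r = s := OverHom.base_eq (φ := θ.comp d rfl) h₂
  have sq : l ≫ g' = g₂ ≫ k₂ :=
    (OverHom.base_eq (φ := θ₂.comp c₂ rfl) (ψ := a₂.comp θ rfl) h₁₂).symm
  -- The conjunction (X ∧ W) ∧ Y₂ is regrouped as X ∧ (W ∧ Y₂), and the contexts K₂ and K are
  -- merged, so that stability of φ applies once.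
  have hK := isMeet_meet (k₂ ≫ r) (𝟙 T₂) W Y₂
  let e := hK.lift g₂ (a₂.comp b rfl) b₂ (by rw [← hs, ← Category.assoc, ← sq, Category.assoc])
    (Category.comp_id _)
  let e' := hK.lift (𝟙 T₂) (c₂.comp d rfl) d₂ (Category.id_comp _) (Category.id_comp _)
  have m₁ := hM.assoc hM₂ hK e (by simp [e]) (by simp [e]) (a₂.comp a rfl) rfl
  have m₂ := hN.assoc hN₂ hK e' (by simp [e']) (by simp [e']) (c₂.comp c rfl) rfl
  refine H (l ≫ h) g₂ (k₂ ≫ k) (prod.lift κ₂ (k₂ ≫ κ)) ?_ ?_ θ₂ m₁ m₂ ?_ ?_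
  · exact P₁.comp Q₁
  · rw [prod.comp_lift, reassoc_of% sq.symm]
    exact P₂.comp Q₂
  · rw [OverHom.comp_hom, ← Category.assoc, h₁₂, OverHom.comp_hom, Category.assoc, Category.assoc,
      h₁]
  · refine hK.hom_ext (z := θ₂.comp e' (Category.comp_id _)) ?_ ?_
    · simp only [e', e, OverHom.comp_hom, Category.assoc, IsMeet.lift_left]
      rw [← Category.assoc, h₁₂, Category.assoc, h₂]
    · simp only [e', e, OverHom.comp_hom, Category.assoc, IsMeet.lift_right, h₂₂]

/-- An opcartesian arrow is stably opcartesian if there is a stably opcartesian arrow over the same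
arrow of the base, with the same domain. -/
theorem of_isOpcart {φ : OverHom p f X Y} (H : IsStablyOpcart φ) {Y' : p.Fiber S}
    {φ' : OverHom p f X Y'} (H' : IsOpcart φ') : IsStablyOpcart φ' := by
  obtain ⟨j, hj, -⟩ := H.isOpcart (𝟙 S) φ' (Category.comp_id f)
  have := H.isOpcart.isIso H' hj
  have e : φ' = φ.comp j (Category.comp_id f) := OverHom.ext hj.symm
  exact e ▸ H.comp (of_isIso j) _

end IsStablyOpcart

/-- Stability along a square is invariant under isomorphisms of the codomain. -/
theorem IsStableAlong.of_isOpcart {S T S' T' : B} {g : S ⟶ T} {X : p.Fiber S} {Z Z' : p.Fiber T}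
    {φ : OverHom p g X Z} {h : S' ⟶ S} {g' : S' ⟶ T'} {k : T' ⟶ T} (H : IsStableAlong φ h g' k)
    (hφ : IsOpcart φ) {φ' : OverHom p g X Z'} (hφ' : IsOpcart φ') :
    IsStableAlong φ' h g' k := by
  intro Y M N a b c d θ hM hN h₁ h₂
  obtain ⟨j, hj, -⟩ := hφ' (𝟙 T) φ (Category.comp_id g)
  have := hφ'.isIso hφ hj
  refine H (c := c.comp j (Category.comp_id k)) θ hM ?_ ?_ h₂
  · intro R u W q' r' x y hq hr
    obtain ⟨z, ⟨hz, hz'⟩, hu⟩ := hN u (x.comp (j.inv (𝟙 T) (Category.comp_id _))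
      (Category.comp_id _)) y hq hr
    refine ⟨z, ⟨?_, hz'⟩, fun z' hz' => hu z' ⟨?_, hz'.2⟩⟩
    · rw [OverHom.comp_hom, ← Category.assoc, hz]; simp
    · rw [OverHom.comp_hom, ← hz'.1]; simp
  · rw [OverHom.comp_hom, ← Category.assoc, h₁, Category.assoc, hj]

end

end Fibration

namespace Fibration

section

variable {B : Type u₁} [Category.{v₁} B] [HasFiniteProducts B] {E : Type u₂} [Category.{v₂} E]
  {p : E ⥤ B} [IsCartesianFibration p]

/-! ### Composing cells of `Bil[p]` -/

section

variable {I J K : B} {P : LPath (Rel p) I J} {γ : Rel p I J}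
  (κ : (bilData p).Cell P (𝟙 I) (𝟙 J) γ) (C : LPath (Rel p) J K)

/-- Arrows into the conjunction of a nonempty path are determined by their head and tail. This
equation and the next three therefore describe whiskering completely, by recursion on the left path.
-/
theorem whisker_nil_head :
    (pathArrow ((Bil p).whisker (.nil I) κ C)).hom ≫ (conjHead γ C).hom =
      (segInit (rfl : P.append C = P.append C)).hom ≫ κ.hom :=
  pathArrow_head _ _ _

theorem whisker_nil_tail :
    (pathArrow ((Bil p).whisker (.nil I) κ C)).hom ≫ (conjTail γ C).hom =
      (segFin (rfl : P.append C = P.append C)).hom := by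
  refine (pathArrow_tail _ _ _).trans ?_
  refine (congrArg (_ ≫ ·) (pathArrow_idPath p C)).trans (Category.comp_id _)

variable {H G : B} (α : Rel p G H) (A : LPath (Rel p) H I)

theorem whisker_cons_head :
    (pathArrow ((Bil p).whisker (.cons α A) κ C)).hom ≫ (conjHead α (A.append (.cons γ C))).hom =
      (conjHead α (A.append (P.append C))).hom := by
  refine (pathArrow_head (p := p) (P₁ := .single α) (P₂ := A.append (P.append C))
    ((Bil p).idCell α) ((Bil p).whisker A κ C) rfl).trans ?_
  refine (congrArg (_ ≫ ·) (bilId_hom p α)).trans ?_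
  exact segInit_head rfl

theorem whisker_cons_tail :
    (pathArrow ((Bil p).whisker (.cons α A) κ C)).hom ≫ (conjTail α (A.append (.cons γ C))).hom =
      (conjTail α (A.append (P.append C))).hom ≫ (pathArrow ((Bil p).whisker A κ C)).hom := by
  refine (pathArrow_tail (p := p) (P₁ := .single α) (P₂ := A.append (P.append C))
    ((Bil p).idCell α) ((Bil p).whisker A κ C) rfl).trans ?_
  refine congrArg (· ≫ _) ?_
  exact (segFin_cons (P := A.append (P.append C)) (P₁ := .nil _) rfl rfl).trans
    (Category.comp_id _)

end

/-- Factorisation through a composing cell. -/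
theorem existsUnique_of_isComposing {H I J K H' K' : B} {P : LPath (Rel p) I J} {γ : Rel p I J}
    {κ : (bilData p).Cell P (𝟙 I) (𝟙 J) γ} (h : (Bil p).IsComposing κ) (A : LPath (Rel p) H I)
    (C : LPath (Rel p) J K)
    {θ : Functor.Fiber.fiberInclusion.obj (conj (A.append (P.append C))) ⟶
      Functor.Fiber.fiberInclusion.obj (conj (A.append (.cons γ C)))}
    (hθ : (pathArrow ((Bil p).whisker A κ C)).hom = θ) (f : H ⟶ H') (g : K ⟶ K')
    {δ : Rel p H' K'} {w : ctx (A.append (P.append C)) ⟶ H' ⨯ K'}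
    (ν : OverHom p w (conj (A.append (P.append C))) δ)
    (hw : w = prod.lift (src _ ≫ f) (tgt _ ≫ g)) :
    ∃! ν' : OverHom p (prod.lift (src (A.append (.cons γ C)) ≫ f)
      (tgt (A.append (.cons γ C)) ≫ g)) (conj (A.append (.cons γ C))) δ,
      θ ≫ ν'.hom = ν.hom := by
  subst hw hθ
  obtain ⟨ν', h₁, h₂⟩ := h A C f g δ ν
  exact ⟨ν', congrArg OverHom.hom h₁, fun ν'' h'' => h₂ ν'' (OverHom.ext h'')⟩

/-! ### Conjunctions of two and three loose arrows -/

section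

variable {H I J L : B} (A : Rel p H I) (U : Rel p I J) (C : Rel p J L)

/-- The conjunction `A[⟨0,1⟩] ∧ U[⟨1,2⟩]`. -/
noncomputable def conj₂ : p.Fiber (H ⨯ (I ⨯ J)) := conj (.cons A (.single U))

/-- The first projection. -/
noncomputable def conj₂Fst : OverHom p (prod.lift prod.fst (prod.snd ≫ prod.fst)) (conj₂ A U) A :=
  conjHead A (.single U)

/-- The second projection. -/
noncomputable def conj₂Snd : OverHom p prod.snd (conj₂ A U) U :=
  (conjTail A (.single U)).comp (conjHead U (.nil J)) (by
    refine (congrArg (_ ≫ ·) ?_).trans (Category.comp_id _)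
    exact Limits.prod.hom_ext ((prod.lift_fst _ _).trans (Category.id_comp _).symm)
      ((prod.lift_snd _ _).trans ((Category.comp_id _).trans (Category.id_comp _).symm)))

/-- The conjunction of a two-term path carries a superfluous factor ⊤ for its empty end, and the
base arrow of its last member is an identity only up to a proof. Both are discarded here. -/
theorem isMeet_conj₂ : IsMeet (conj₂Fst A U) (conj₂Snd A U) := by
  intro R u N q' r' x y hq hr
  have hu : u ≫ prod.snd ≫ headBase U (.nil J) = r' := by
    rw [← hr]
    refine congrArg (u ≫ ·) ?_
    refine (congrArg (_ ≫ ·) ?_).trans (Category.comp_id _)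
    exact Limits.prod.hom_ext ((prod.lift_fst _ _).trans (Category.id_comp _).symm)
      ((prod.lift_snd _ _).trans ((Category.comp_id _).trans (Category.id_comp _).symm))
  let y' : OverHom p (u ≫ prod.snd) N (conj (.single U)) :=
    conjLift (P := .nil J) _ y (terminalLift p N (u ≫ prod.snd ≫ prod.snd))
      ((Category.assoc _ _ _).trans hu) (Category.assoc _ _ _)
  have hy' : y'.hom ≫ (conjHead U (.nil J)).hom = y.hom := conjLift_head _ _ _ _
  let z₀ : OverHom p u N (conj₂ A U) := conjLift (α := A) (P := .single U) u x y' hq rfl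
  have h₁ : z₀.hom ≫ (conjHead A (.single U)).hom = x.hom := conjLift_head _ _ _ _
  have h₂ : z₀.hom ≫ (conjTail A (.single U)).hom = y'.hom := conjLift_tail _ _ _ _
  refine ⟨z₀, ⟨h₁, ?_⟩, fun z hz => OverHom.ext
    (conjCons_ext (α := A) (P := .single U) (φ := z) ?_ ?_)⟩
  · refine (Category.assoc _ _ _).symm.trans ((congrArg (· ≫ _) h₂).trans hy')
  · exact hz.1.trans h₁.symm
  · refine Eq.trans ?_ h₂.symm
    refine conjCons_ext (φ := z.comp (conjTail A (.single U)) rfl) (ψ := y') ?_ ?_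
    · exact (Category.assoc _ _ _).trans (hz.2.trans hy'.symm)
    · exact terminal_hom_ext ((z.comp (conjTail A (.single U)) rfl).comp (conjTail U (.nil J)) rfl)
        (y'.comp (conjTail U (.nil J)) rfl) rfl

variable {A U} in
-- The base arrows are not assumed equal: the first projection determines their coordinate in H, the
-- second those in I and J.
theorem conj₂_hom_ext {R : B} {u u' : R ⟶ H ⨯ (I ⨯ J)} {N : p.Fiber R}
    {z : OverHom p u N (conj₂ A U)} {z' : OverHom p u' N (conj₂ A U)}
    (h₁ : z.hom ≫ (conj₂Fst A U).hom = z'.hom ≫ (conj₂Fst A U).hom)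
    (h₂ : z.hom ≫ (conj₂Snd A U).hom = z'.hom ≫ (conj₂Snd A U).hom) : z.hom = z'.hom := by
  have e₁ := OverHom.base_eq (φ := z.comp (conj₂Fst A U) rfl) (ψ := z'.comp (conj₂Fst A U) rfl) h₁
  have e₂ := OverHom.base_eq (φ := z.comp (conj₂Snd A U) rfl) (ψ := z'.comp (conj₂Snd A U) rfl) h₂
  obtain rfl : u = u' := Limits.prod.hom_ext (by
    simpa only [Category.assoc, prod.lift_fst] using e₁ =≫ prod.fst) e₂
  exact (isMeet_conj₂ A U).hom_ext h₁ h₂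

/-- The conjunction `A[⟨0,1⟩] ∧ U[⟨1,2⟩] ∧ C[⟨2,3⟩]`. -/
noncomputable def conj₃ : p.Fiber (H ⨯ (I ⨯ (J ⨯ L))) := conj (.cons A (.cons U (.single C)))

/-- The first projection. -/
noncomputable def conj₃Fst : OverHom p (prod.lift prod.fst (prod.snd ≫ prod.fst)) (conj₃ A U C) A :=
  conjHead A (.cons U (.single C))

/-- The projection to the last two members. -/
noncomputable def conj₃Snd : OverHom p prod.snd (conj₃ A U C) (conj₂ U C) :=
  conjTail A (.cons U (.single C))

theorem isMeet_conj₃ : IsMeet (conj₃Fst A U C) (conj₃Snd A U C) :=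
  isMeet_conj _ _

variable {A U C} in
theorem conj₃_hom_ext {R : B} {u u' : R ⟶ H ⨯ (I ⨯ (J ⨯ L))} {N : p.Fiber R}
    {z : OverHom p u N (conj₃ A U C)} {z' : OverHom p u' N (conj₃ A U C)}
    (h₁ : z.hom ≫ (conj₃Fst A U C).hom = z'.hom ≫ (conj₃Fst A U C).hom)
    (h₂ : z.hom ≫ (conj₃Snd A U C).hom ≫ (conj₂Fst U C).hom =
      z'.hom ≫ (conj₃Snd A U C).hom ≫ (conj₂Fst U C).hom)
    (h₃ : z.hom ≫ (conj₃Snd A U C).hom ≫ (conj₂Snd U C).hom =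
      z'.hom ≫ (conj₃Snd A U C).hom ≫ (conj₂Snd U C).hom) : z.hom = z'.hom := by
  have h : (z.comp (conj₃Snd A U C) rfl).hom = (z'.comp (conj₃Snd A U C) rfl).hom :=
    conj₂_hom_ext (by simpa using h₂) (by simpa using h₃)
  have e₁ := OverHom.base_eq (φ := z.comp (conj₃Fst A U C) rfl)
    (ψ := z'.comp (conj₃Fst A U C) rfl) h₁
  obtain rfl : u = u' := Limits.prod.hom_ext (by
    simpa only [Category.assoc, prod.lift_fst] using e₁ =≫ prod.fst)
    (OverHom.base_eq h)
  exact (isMeet_conj₃ A U C).hom_ext h₁ h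

end

/-! ### Units -/

section

variable {I : B} {U : Rel p I I} (η : (bilData p).Cell (.nil I) (𝟙 I) (𝟙 I) U)

/-- Reflexivity. -/
noncomputable def unitRefl {S : B} (Γ : p.Fiber S) (i : S ⟶ I) :
    OverHom p (prod.lift i i) Γ U :=
  (terminalLift p Γ i).comp η (lift_sides _
    ((congrArg (i ≫ ·) (Category.comp_id _)).trans (Category.comp_id _)).symm
    ((congrArg (i ≫ ·) (Category.comp_id _)).trans (Category.comp_id _)))

/-- Reflexivity factors through ⊤, so it is compatible with substitution. -/
theorem comp_unitRefl {S S' : B} {Γ : p.Fiber S} {Γ' : p.Fiber S'} {v : S' ⟶ S} {i : S ⟶ I}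
    {i' : S' ⟶ I} (r : OverHom p v Γ' Γ) (h : v ≫ i = i') :
    r.hom ≫ (unitRefl η Γ i).hom = (unitRefl η Γ' i').hom := by
  refine (Category.assoc _ _ _).symm.trans (congrArg (· ≫ η.hom) ?_)
  exact terminal_hom_ext (r.comp (terminalLift p Γ i) rfl) _ h

end

end

end Fibration

/-! ### Transport along units -/

namespace Fibration

attribute [local simp] prod.lift_fst prod.lift_snd prod.lift_fst_assoc prod.lift_snd_assoc

section

variable {B : Type u₁} [Category.{v₁} B] [HasFiniteProducts B] {E : Type u₂} [Category.{v₂} E]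
  {p : E ⥤ B} [IsCartesianFibration p]

section

variable {I : B} {U : Rel p I I} {η : (bilData p).Cell (.nil I) (𝟙 I) (𝟙 I) U}

/-- The conjunction of `X[⟨0,1⟩]` with reflexivity at `1`. -/
theorem exists_single_refl {K : B} (X : Rel p K I) (η : (bilData p).Cell (.nil I) (𝟙 I) (𝟙 I) U) :
    ∃ (t : ctx (.single X) ⟶ K ⨯ (I ⨯ I)) (θ : OverHom p t (conj (.single X)) (conj₂ X U)),
      (pathArrow ((Bil p).whisker (.single X) η (.nil I))).hom = θ.hom ∧
      θ.hom ≫ (conj₂Fst X U).hom = (conjHead X (.nil I)).hom ∧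
      θ.hom ≫ (conj₂Snd X U).hom = (unitRefl η (conj (.single X)) prod.snd).hom := by
  refine ⟨_, pathArrow ((Bil p).whisker (.single X) η (.nil I)), rfl,
    whisker_cons_head η (.nil I) X (.nil I), ?_⟩
  refine (Category.assoc _ _ _).symm.trans ?_
  refine (congrArg (· ≫ _) (whisker_cons_tail η (.nil I) X (.nil I))).trans ?_
  refine (Category.assoc _ _ _).trans ?_
  refine (congrArg (_ ≫ ·) (whisker_nil_head η (.nil I))).trans ?_
  refine (Category.assoc _ _ _).symm.trans (congrArg (· ≫ η.hom) ?_)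
  let r : OverHom p (S := I) (𝟙 I) (conj (.nil I)) (⊤_ (p.Fiber I)) :=
    segInit (p := p) (P := .nil I) (P₁ := .nil I) (P₂ := .nil I) rfl
  exact terminal_hom_ext ((conjTail X (.nil I)).comp r rfl) _ (Category.comp_id _)

/-- The conjunction of `X[⟨0,1⟩]` with reflexivity at `0`. -/
theorem exists_refl_single {K : B} (X : Rel p I K) (η : (bilData p).Cell (.nil I) (𝟙 I) (𝟙 I) U) :
    ∃ (t : ctx (.single X) ⟶ I ⨯ (I ⨯ K)) (θ : OverHom p t (conj (.single X)) (conj₂ U X)),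
      (pathArrow ((Bil p).whisker (.nil I) η (.single X))).hom = θ.hom ∧
      θ.hom ≫ (conj₂Fst U X).hom = (unitRefl η (conj (.single X)) prod.fst).hom ∧
      θ.hom ≫ (conj₂Snd U X).hom = (conjHead X (.nil K)).hom := by
  refine ⟨_, pathArrow ((Bil p).whisker (.nil I) η (.single X)), rfl, ?_, ?_⟩
  · refine (whisker_nil_head η (.single X)).trans (congrArg (· ≫ η.hom) ?_)
    let r : OverHom p (S := I ⨯ K) prod.fst (conj (.single X)) (⊤_ (p.Fiber I)) :=
      segInit (p := p) (P := .single X) (P₁ := .nil I) (P₂ := .single X) rfl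
    exact terminal_hom_ext r _ rfl
  · refine (Category.assoc _ _ _).symm.trans ?_
    refine (congrArg (· ≫ _) (whisker_nil_tail η (.single X))).trans ?_
    exact Category.id_comp _

/-- Substitution of equals. The object X(e(k,i)) is read as a loose arrow K → I and its identity is
factored through the whiskered unit cell, which gives X(k,i) ∧ U(i,j) ⟶ X(k,j). The factorisation
equation becomes the clause that transport does nothing where the proof of U is a reflexivity. -/
theorem exists_transport (hη : (Bil p).IsComposing η) {K T : B} (e : K ⨯ I ⟶ T)
    (X : p.Fiber T) :
    ∃ tr : OverHom p (prod.lift prod.fst (prod.snd ≫ prod.snd) ≫ e)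
      (meet (prod.lift prod.fst (prod.snd ≫ prod.fst) ≫ e) (prod.snd : K ⨯ (I ⨯ I) ⟶ _) X U) X,
      ∀ {S : B} {Γ : p.Fiber S} {v : S ⟶ K ⨯ (I ⨯ I)} {i : S ⟶ I} (z : OverHom p v Γ _),
        z.hom ≫ (meetSnd _ _ _ _).hom = (unitRefl η Γ i).hom →
        z.hom ≫ tr.hom = z.hom ≫ (meetFst _ _ _ _).hom := by
  let X' : Rel p K I := pull p e X
  obtain ⟨t, θ, hθ, hθ₁, hθ₂⟩ := exists_single_refl X' η
  -- The factored cell is the identity of X', written as the projection from its one-term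
  -- conjunction.
  obtain ⟨ν, hν, -⟩ := existsUnique_of_isComposing hη (.single X') (.nil I) hθ (𝟙 K) (𝟙 I)
    (δ := X') (conjHead X' (.nil I)) (by
      rw [Category.comp_id]; exact congrArg _ (Category.comp_id _).symm)
  let m : OverHom p (𝟙 _) (meet (prod.lift prod.fst (prod.snd ≫ prod.fst) ≫ e) prod.snd X U)
      (conj₂ X' U) := (isMeet_conj₂ X' U).lift (𝟙 _) (pullLift p rfl (meetFst _ _ X U))
      (meetSnd _ _ X U) (Category.id_comp _) (Category.id_comp _)
  let ν₁ : OverHom p (prod.lift prod.fst (prod.snd ≫ prod.snd)) (conj₂ X' U) X' :=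
    ν.rebase (by
      refine Limits.prod.hom_ext ((prod.lift_fst _ _).trans ?_) ((prod.lift_snd _ _).trans ?_)
      · exact (Category.comp_id _).trans (prod.lift_fst _ _).symm
      · exact (Category.comp_id _).trans ((congrArg (_ ≫ ·) (Category.comp_id _)).trans
          (prod.lift_snd _ _).symm))
  refine ⟨(m.comp ν₁ (Category.id_comp _)).comp (pullMap p e X) rfl, fun {S Γ v i} z hz => ?_⟩
  have hv : v ≫ prod.snd = prod.lift i i :=
    OverHom.base_eq (φ := z.comp (meetSnd _ _ _ _) rfl) hz
  let w : S ⟶ K ⨯ I := v ≫ prod.lift prod.fst (prod.snd ≫ prod.fst)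
  have hw : w ≫ prod.snd = i := by
    simpa only [w, Category.assoc, prod.lift_fst, prod.lift_snd] using hv =≫ prod.fst
  have hw' : w ≫ headBase X' (.nil I) = w := by
    refine (congrArg (w ≫ ·) (?_ : headBase X' (.nil I) = 𝟙 (K ⨯ I))).trans (Category.comp_id w)
    refine Limits.prod.hom_ext ((prod.lift_fst _ _).trans (Category.id_comp _).symm)
      ((prod.lift_snd _ _).trans ((Category.comp_id _).trans (Category.id_comp _).symm))
  let x : OverHom p w Γ X' := pullLift p (Category.assoc _ _ _) (z.comp (meetFst _ _ X U) rfl)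
  -- As the U-component of z is a reflexivity, z followed by m factors through θ, by way of the
  -- X-component of z alone.
  let y : OverHom p w Γ (conj (.single X')) := conjLift (P := .nil I) w x (terminalLift p Γ i)
    hw' hw
  have hy : y.hom ≫ (conjHead X' (.nil I)).hom = x.hom := conjLift_head _ _ _ _
  have key : y.hom ≫ θ.hom =
      z.hom ≫ m.hom := by
    refine conj₂_hom_ext (A := X') (U := U) (z := y.comp θ rfl) (z' := z.comp m rfl) ?_ ?_
    · refine (Category.assoc _ _ _).trans ?_
      refine (congrArg (_ ≫ ·) hθ₁).trans (hy.trans ?_)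
      rw [OverHom.comp_hom, Category.assoc, IsMeet.lift_left]
      refine congrArg OverHom.hom (pull_ext p (φ := x) (ψ := z.comp (pullLift p rfl _) rfl) ?_)
      rw [pullLift_fac, OverHom.comp_hom, OverHom.comp_hom, Category.assoc, pullLift_fac]
    · refine (Category.assoc _ _ _).trans ?_
      refine (congrArg (_ ≫ ·) hθ₂).trans ?_
      rw [OverHom.comp_hom, Category.assoc, IsMeet.lift_right, hz]
      exact comp_unitRefl η y hw
  have h₁ : z.hom ≫ m.hom ≫ ν₁.hom = x.hom := by
    rw [← Category.assoc, ← key]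
    exact (Category.assoc _ _ _).trans ((congrArg (_ ≫ ·) hν).trans hy)
  calc z.hom ≫ (m.hom ≫ ν₁.hom) ≫ (pullMap p e X).hom
      = (z.hom ≫ m.hom ≫ ν₁.hom) ≫ (pullMap p e X).hom := (Category.assoc _ _ _).symm
    _ = x.hom ≫ (pullMap p e X).hom := by rw [h₁]
    _ = _ := pullLift_fac p _ _

/-- No symmetry of U is invoked: X is read as a loose arrow I → K and the unit is inserted in front
of it instead of behind, which transports from j back to i. -/
theorem exists_transport_symm (hη : (Bil p).IsComposing η) {K T : B} (e : K ⨯ I ⟶ T)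
    (X : p.Fiber T) :
    ∃ tr : OverHom p (prod.lift prod.fst (prod.snd ≫ prod.fst) ≫ e)
      (meet (prod.lift prod.fst (prod.snd ≫ prod.snd) ≫ e) (prod.snd : K ⨯ (I ⨯ I) ⟶ _) X U) X,
      ∀ {S : B} {Γ : p.Fiber S} {v : S ⟶ K ⨯ (I ⨯ I)} {i : S ⟶ I} (z : OverHom p v Γ _),
        z.hom ≫ (meetSnd _ _ _ _).hom = (unitRefl η Γ i).hom →
        z.hom ≫ tr.hom = z.hom ≫ (meetFst _ _ _ _).hom := by
  let σ : I ⨯ K ⟶ K ⨯ I := prod.lift prod.snd prod.fst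
  let X' : Rel p I K := pull p (σ ≫ e) X
  obtain ⟨t, θ, hθ, hθ₁, hθ₂⟩ := exists_refl_single X' η
  obtain ⟨ν, hν, -⟩ := existsUnique_of_isComposing hη (.nil I) (.single X') hθ (𝟙 I) (𝟙 K)
    (δ := X') (conjHead X' (.nil K)) (by
      rw [Category.comp_id]; exact congrArg _ (Category.comp_id _).symm)
  let μ : K ⨯ (I ⨯ I) ⟶ I ⨯ (I ⨯ K) :=
    prod.lift (prod.snd ≫ prod.fst) (prod.lift (prod.snd ≫ prod.snd) prod.fst)
  let m : OverHom p μ (meet (prod.lift prod.fst (prod.snd ≫ prod.snd) ≫ e) prod.snd X U)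
      (conj₂ U X') := (isMeet_conj₂ U X').lift μ (meetSnd _ _ X U)
        (pullLift p (g := prod.lift (prod.snd ≫ prod.snd) prod.fst) (by
          rw [← Category.assoc]; congr 1; ext <;> simp [σ]) (meetFst _ _ X U))
      (by ext <;> simp [μ]) (by ext <;> simp [μ])
  let ν₁ : OverHom p (prod.lift prod.fst (prod.snd ≫ prod.snd)) (conj₂ U X') X' :=
    ν.rebase (by
      refine Limits.prod.hom_ext ((prod.lift_fst _ _).trans ?_) ((prod.lift_snd _ _).trans ?_)
      · exact (Category.comp_id _).trans (prod.lift_fst _ _).symm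
      · exact (Category.comp_id _).trans ((congrArg (_ ≫ ·) (Category.comp_id _)).trans
          (prod.lift_snd _ _).symm))
  refine ⟨(m.comp ν₁ rfl).comp (pullMap p (σ ≫ e) X) (by
    simp only [← Category.assoc]; congr 1; ext <;> simp [σ, μ]), fun {S Γ v i} z hz => ?_⟩
  have hv : v ≫ prod.snd = prod.lift i i :=
    OverHom.base_eq (φ := z.comp (meetSnd _ _ _ _) rfl) hz
  let w : S ⟶ I ⨯ K := v ≫ prod.lift (prod.snd ≫ prod.snd) prod.fst
  have hw : w ≫ prod.fst = i := by
    simpa only [w, Category.assoc, prod.lift_fst, prod.lift_snd] using hv =≫ prod.snd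
  have hw' : w ≫ headBase X' (.nil K) = w := by
    refine (congrArg (w ≫ ·) (?_ : headBase X' (.nil K) = 𝟙 (I ⨯ K))).trans (Category.comp_id w)
    refine Limits.prod.hom_ext ((prod.lift_fst _ _).trans (Category.id_comp _).symm)
      ((prod.lift_snd _ _).trans ((Category.comp_id _).trans (Category.id_comp _).symm))
  let x : OverHom p w Γ X' := pullLift p (by
    simp only [w, Category.assoc]; rw [← Category.assoc _ σ]; congr 2; ext <;> simp [σ])
    (z.comp (meetFst _ _ X U) rfl)
  let y : OverHom p w Γ (conj (.single X')) := conjLift (P := .nil K) w x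
    (terminalLift p Γ (w ≫ prod.snd)) hw' rfl
  have hy : y.hom ≫ (conjHead X' (.nil K)).hom = x.hom := conjLift_head _ _ _ _
  have key : y.hom ≫ θ.hom =
      z.hom ≫ m.hom := by
    refine conj₂_hom_ext (A := U) (U := X') (z := y.comp θ rfl) (z' := z.comp m rfl) ?_ ?_
    · refine (Category.assoc _ _ _).trans ?_
      refine (congrArg (_ ≫ ·) hθ₁).trans ?_
      rw [OverHom.comp_hom, Category.assoc, IsMeet.lift_left, hz]
      exact comp_unitRefl η y hw
    · refine (Category.assoc _ _ _).trans ?_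
      refine (congrArg (_ ≫ ·) hθ₂).trans (hy.trans ?_)
      rw [OverHom.comp_hom, Category.assoc, IsMeet.lift_right]
      refine congrArg OverHom.hom (pull_ext p (φ := x) (ψ := z.comp (pullLift p _ _) rfl) ?_)
      rw [pullLift_fac, OverHom.comp_hom, OverHom.comp_hom, Category.assoc, pullLift_fac]
  have h₁ : z.hom ≫ m.hom ≫ ν₁.hom = x.hom := by
    rw [← Category.assoc, ← key]
    exact (Category.assoc _ _ _).trans ((congrArg (_ ≫ ·) hν).trans hy)
  calc z.hom ≫ (m.hom ≫ ν₁.hom) ≫ (pullMap p (σ ≫ e) X).hom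
      = (z.hom ≫ m.hom ≫ ν₁.hom) ≫ (pullMap p (σ ≫ e) X).hom := (Category.assoc _ _ _).symm
    _ = x.hom ≫ (pullMap p (σ ≫ e) X).hom := by rw [h₁]
    _ = _ := pullLift_fac p _ _

end

end

end Fibration

namespace Fibration

attribute [local simp] prod.lift_fst prod.lift_snd prod.lift_fst_assoc prod.lift_snd_assoc

section

variable {B : Type u₁} [Category.{v₁} B] [HasFiniteProducts B] {E : Type u₂} [Category.{v₂} E]
  {p : E ⥤ B} [IsCartesianFibration p]

section

variable {I : B} {U : Rel p I I} {η : (bilData p).Cell (.nil I) (𝟙 I) (𝟙 I) U}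
  (hη : (Bil p).IsComposing η) {K T : B} (e : K ⨯ I ⟶ T) {X : p.Fiber T}

section

variable {S : B} {Γ : p.Fiber S} (k : S ⟶ K) (i j : S ⟶ I)

/-- Transport along `U(i, j)`. -/
noncomputable def transport {a c : S ⟶ T} {b : S ⟶ I ⨯ I} (x : OverHom p a Γ X)
    (u : OverHom p b Γ U) (ha : prod.lift k i ≫ e = a) (hb : prod.lift i j = b)
    (hc : prod.lift k j ≫ e = c) : OverHom p c Γ X :=
  ((isMeet_meet (prod.lift prod.fst (prod.snd ≫ prod.fst) ≫ e) prod.snd X U).lift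
    (prod.lift k b) x u (by
      subst ha hb; rw [← Category.assoc]; congr 1; ext <;> simp) (by simp)).comp
    (exists_transport hη e X).choose (by
      subst hc hb; rw [← Category.assoc]; congr 1; ext <;> simp)

/-- Transport along `U(i, j)`, backwards. -/
noncomputable def transportSymm {a c : S ⟶ T} {b : S ⟶ I ⨯ I} (x : OverHom p c Γ X)
    (u : OverHom p b Γ U) (ha : prod.lift k i ≫ e = a) (hb : prod.lift i j = b)
    (hc : prod.lift k j ≫ e = c) : OverHom p a Γ X :=
  ((isMeet_meet (prod.lift prod.fst (prod.snd ≫ prod.snd) ≫ e) prod.snd X U).lift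
    (prod.lift k b) x u (by
      subst hc hb; rw [← Category.assoc]; congr 1; ext <;> simp) (by simp)).comp
    (exists_transport_symm hη e X).choose (by
      subst ha hb; rw [← Category.assoc]; congr 1; ext <;> simp)

end

section

variable {S S' : B} {Γ : p.Fiber S} {Γ' : p.Fiber S'} {k : S ⟶ K} {i j : S ⟶ I} {k' : S' ⟶ K}
  {i' j' : S' ⟶ I} {a c : S ⟶ T} {b : S ⟶ I ⨯ I} {a' c' : S' ⟶ T} {b' : S' ⟶ I ⨯ I}
  {u : OverHom p b Γ U} {u' : OverHom p b' Γ' U} {v : S' ⟶ S} (r : OverHom p v Γ' Γ)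
  (ha : prod.lift k i ≫ e = a) (hb : prod.lift i j = b) (hc : prod.lift k j ≫ e = c)
  (ha' : prod.lift k' i' ≫ e = a') (hb' : prod.lift i' j' = b') (hc' : prod.lift k' j' ≫ e = c')

theorem comp_transport {x : OverHom p a Γ X} {x' : OverHom p a' Γ' X}
    (hk : v ≫ k = k') (hx : r.hom ≫ x.hom = x'.hom) (hu : r.hom ≫ u.hom = u'.hom) :
    r.hom ≫ (transport hη e k i j x u ha hb hc).hom =
      (transport hη e k' i' j' x' u' ha' hb' hc').hom := by
  have h : v ≫ b = b' := OverHom.base_eq (φ := r.comp u rfl) hu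
  refine (Category.assoc _ _ _).symm.trans (congrArg (· ≫ _) ?_)
  refine (isMeet_meet _ _ X U).hom_ext (z := r.comp _ (by rw [prod.comp_lift, hk, h])) ?_ ?_
  · simp [hx]
  · simp [hu]

theorem comp_transportSymm {x : OverHom p c Γ X} {x' : OverHom p c' Γ' X}
    (hk : v ≫ k = k') (hx : r.hom ≫ x.hom = x'.hom) (hu : r.hom ≫ u.hom = u'.hom) :
    r.hom ≫ (transportSymm hη e k i j x u ha hb hc).hom =
      (transportSymm hη e k' i' j' x' u' ha' hb' hc').hom := by
  have h : v ≫ b = b' := OverHom.base_eq (φ := r.comp u rfl) hu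
  refine (Category.assoc _ _ _).symm.trans (congrArg (· ≫ _) ?_)
  refine (isMeet_meet _ _ X U).hom_ext (z := r.comp _ (by rw [prod.comp_lift, hk, h])) ?_ ?_
  · simp [hx]
  · simp [hu]

/-- Here x and x₁ need to agree only after precomposition with r, while k, i, j and u stay fixed. -/
theorem comp_transport_congr {x x₁ : OverHom p a Γ X} (hx : r.hom ≫ x.hom = r.hom ≫ x₁.hom) :
    r.hom ≫ (transport hη e k i j x u ha hb hc).hom =
      r.hom ≫ (transport hη e k i j x₁ u ha hb hc).hom := by
  refine (Category.assoc _ _ _).symm.trans ((congrArg (· ≫ _) ?_).trans (Category.assoc _ _ _))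
  refine (isMeet_meet _ _ X U).hom_ext (z := r.comp _ rfl) (z' := r.comp _ rfl) ?_ ?_
  · simp [hx]
  · simp

/-- The computation rule: after a substitution that turns u into a reflexivity, transport
disappears. -/
theorem comp_transport_refl {x : OverHom p a Γ X} {i₀ : S' ⟶ I}
    (hu : r.hom ≫ u.hom = (unitRefl η Γ' i₀).hom) :
    r.hom ≫ (transport hη e k i j x u ha hb hc).hom = r.hom ≫ x.hom := by
  refine (Category.assoc _ _ _).symm.trans ((exists_transport hη e X).choose_spec (i := i₀)
    (r.comp _ rfl) ?_ |>.trans ?_)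
  · rw [OverHom.comp_hom, Category.assoc, IsMeet.lift_right, hu]
  · rw [OverHom.comp_hom, Category.assoc, IsMeet.lift_left]

theorem comp_transportSymm_refl {x : OverHom p c Γ X} {i₀ : S' ⟶ I}
    (hu : r.hom ≫ u.hom = (unitRefl η Γ' i₀).hom) :
    r.hom ≫ (transportSymm hη e k i j x u ha hb hc).hom = r.hom ≫ x.hom := by
  refine (Category.assoc _ _ _).symm.trans ((exists_transport_symm hη e X).choose_spec (i := i₀)
    (r.comp _ rfl) ?_ |>.trans ?_)
  · rw [OverHom.comp_hom, Category.assoc, IsMeet.lift_right, hu]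
  · rw [OverHom.comp_hom, Category.assoc, IsMeet.lift_left]

end

end

/-- The conjunction of `A[⟨0,1⟩]`, reflexivity, and `C[⟨1,2⟩]`. -/
theorem exists_single_refl_single {H I L : B} {U : Rel p I I} (A : Rel p H I) (C : Rel p I L)
    (η : (bilData p).Cell (.nil I) (𝟙 I) (𝟙 I) U) :
    ∃ (t : H ⨯ (I ⨯ L) ⟶ H ⨯ (I ⨯ (I ⨯ L))) (θ : OverHom p t (conj₂ A C) (conj₃ A U C)),
      (pathArrow ((Bil p).whisker (.single A) η (.single C))).hom = θ.hom ∧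
      θ.hom ≫ (conj₃Fst A U C).hom = (conj₂Fst A C).hom ∧
      θ.hom ≫ (conj₃Snd A U C).hom ≫ (conj₂Fst U C).hom =
        (unitRefl η (conj₂ A C) (prod.snd ≫ prod.fst)).hom ∧
      θ.hom ≫ (conj₃Snd A U C).hom ≫ (conj₂Snd U C).hom = (conj₂Snd A C).hom := by
  obtain ⟨t, θ, hθ, hθ₁, hθ₂⟩ := exists_refl_single C η
  have h := whisker_cons_tail η (.single C) A (.nil I)
  refine ⟨_, pathArrow ((Bil p).whisker (.single A) η (.single C)), rfl,
    whisker_cons_head η (.single C) A (.nil I), ?_, ?_⟩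
  · refine (Category.assoc _ _ _).symm.trans ((congrArg (· ≫ _) h).trans ?_)
    refine (congrArg (fun z => (_ ≫ z) ≫ _) hθ).trans ((Category.assoc _ _ _).trans ?_)
    refine (congrArg (_ ≫ ·) hθ₁).trans ?_
    exact comp_unitRefl η (conjTail A (.single C)) rfl
  · refine (Category.assoc _ _ _).symm.trans ((congrArg (· ≫ _) h).trans ?_)
    refine (congrArg (fun z => (_ ≫ z) ≫ _) hθ).trans ((Category.assoc _ _ _).trans ?_)
    exact (congrArg (_ ≫ ·) hθ₂)

end

end Fibration

/-! ### Arrows out of a conjunction with a unit -/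

namespace Fibration

attribute [local simp] prod.lift_fst prod.lift_snd prod.lift_fst_assoc prod.lift_snd_assoc

section

variable {B : Type u₁} [Category.{v₁} B] [HasFiniteProducts B] {E : Type u₂} [Category.{v₂} E]
  {p : E ⥤ B} [IsCartesianFibration p]

/-- The uniqueness half of composition. The form required of w confines it to targets over the outer
objects of the path; `conj_unit_hom_ext` removes this restriction for units. -/
theorem hom_ext_of_isComposing {H I J K H' K' : B} {P : LPath (Rel p) I J} {γ : Rel p I J}
    {κ : (bilData p).Cell P (𝟙 I) (𝟙 J) γ} (h : (Bil p).IsComposing κ) (A : LPath (Rel p) H I)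
    (C : LPath (Rel p) J K)
    {θ : Functor.Fiber.fiberInclusion.obj (conj (A.append (P.append C))) ⟶
      Functor.Fiber.fiberInclusion.obj (conj (A.append (.cons γ C)))}
    (hθ : (pathArrow ((Bil p).whisker A κ C)).hom = θ) (f : H ⟶ H') (g : K ⟶ K')
    {δ : Rel p H' K'} {w : ctx (A.append (.cons γ C)) ⟶ H' ⨯ K'}
    {ν ν' : OverHom p w (conj (A.append (.cons γ C))) δ}
    (hw : w = prod.lift (src _ ≫ f) (tgt _ ≫ g)) (hν : θ ≫ ν.hom = θ ≫ ν'.hom) :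
    ν.hom = ν'.hom := by
  subst hw hθ
  exact congrArg OverHom.hom ((h A C f g δ ((Bil p).comp ((Bil p).whisker A κ C) ν'
    (Category.id_comp f) (Category.id_comp g))).unique (OverHom.ext hν) rfl)

/-- An arrow from `A[⟨0,1⟩] ∧ U[⟨1,2⟩] ∧ C[⟨2,3⟩]`, where `U` is a unit, is determined by its
restriction along reflexivity. -/
theorem conj_unit_hom_ext {H I L T : B} {U : Rel p I I}
    {η : (bilData p).Cell (.nil I) (𝟙 I) (𝟙 I) U} (hη : (Bil p).IsComposing η) (Y₀ : Rel p H I)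
    (Y₁ : Rel p I L) {t : H ⨯ (I ⨯ L) ⟶ H ⨯ (I ⨯ (I ⨯ L))}
    {θ : OverHom p t (conj₂ Y₀ Y₁) (conj₃ Y₀ U Y₁)}
    (hθ₁ : θ.hom ≫ (conj₃Fst Y₀ U Y₁).hom = (conj₂Fst Y₀ Y₁).hom)
    (hθ₂ : θ.hom ≫ (conj₃Snd Y₀ U Y₁).hom ≫ (conj₂Fst U Y₁).hom =
        (unitRefl η (conj₂ Y₀ Y₁) (prod.snd ≫ prod.fst)).hom)
    (hθ₃ : θ.hom ≫ (conj₃Snd Y₀ U Y₁).hom ≫ (conj₂Snd U Y₁).hom = (conj₂Snd Y₀ Y₁).hom)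
    {w : H ⨯ (I ⨯ (I ⨯ L)) ⟶ T} {W : p.Fiber T} {F F' : OverHom p w (conj₃ Y₀ U Y₁) W}
    (hF : θ.hom ≫ F.hom = θ.hom ≫ F'.hom) : F.hom = F'.hom := by
  -- the contexts of the two outer loose arrows carry a copy of the unit
  let A : Rel p (H ⨯ I) I := meet (prod.map prod.fst (𝟙 I))
    (prod.lift prod.snd (prod.fst ≫ prod.snd)) Y₀ U
  let aY : OverHom p _ A Y₀ := meetFst _ _ Y₀ U
  let aU : OverHom p _ A U := meetSnd _ _ Y₀ U
  have hA : IsMeet aY aU := isMeet_meet _ _ Y₀ U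
  let C : Rel p I (L ⨯ I) := meet (prod.map (𝟙 I) prod.fst)
    (prod.lift prod.fst (prod.snd ≫ prod.snd)) Y₁ U
  let cY : OverHom p _ C Y₁ := meetFst _ _ Y₁ U
  let cU : OverHom p _ C U := meetSnd _ _ Y₁ U
  have hC : IsMeet cY cU := isMeet_meet _ _ Y₁ U
  obtain ⟨t', θ', hθ', h₁, h₂, h₃⟩ := exists_single_refl_single A C η
  -- With variables ((h,i'),(i,(j,(l,j')))), the path A, U, C has the conjunction Y₀(h,i) ∧ U(i,i')
  -- ∧ U(i,j) ∧ Y₁(j,l) ∧ U(j,j').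
  let R := (H ⨯ I) ⨯ (I ⨯ (I ⨯ (L ⨯ I)))
  let h : R ⟶ H := prod.fst ≫ prod.fst
  let i' : R ⟶ I := prod.fst ≫ prod.snd
  let i : R ⟶ I := prod.snd ≫ prod.fst
  let j : R ⟶ I := prod.snd ≫ prod.snd ≫ prod.fst
  let l : R ⟶ L := prod.snd ≫ prod.snd ≫ prod.snd ≫ prod.fst
  let j' : R ⟶ I := prod.snd ≫ prod.snd ≫ prod.snd ≫ prod.snd
  let m : OverHom p (prod.lift h (prod.lift i (prod.lift j l))) (conj₃ A U C) (conj₃ Y₀ U Y₁) :=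
    (isMeet_conj₃ Y₀ U Y₁).lift _ ((conj₃Fst A U C).comp aY rfl)
      ((isMeet_conj₂ U Y₁).lift (prod.lift i (prod.lift j l))
        ((conj₃Snd A U C).comp (conj₂Fst U C) rfl)
        (((conj₃Snd A U C).comp (conj₂Snd U C) rfl).comp cY rfl)
        (by ext <;> simp [i, j]) (by ext <;> simp [j, l]))
      (by ext <;> simp [h, i]) (by simp)
  let m₂ : OverHom p (prod.lift (prod.fst ≫ prod.fst) (prod.snd ≫ prod.map (𝟙 I) prod.fst))
      (conj₂ A C) (conj₂ Y₀ Y₁) :=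
    (isMeet_conj₂ Y₀ Y₁).lift _ ((conj₂Fst A C).comp aY rfl) ((conj₂Snd A C).comp cY rfl)
      (by ext <;> simp) (by simp)
  have hm : θ'.hom ≫ m.hom = m₂.hom ≫ θ.hom := by
    refine conj₃_hom_ext (z := θ'.comp m rfl) (z' := m₂.comp θ rfl) ?_ ?_ ?_
    · simp [m, m₂, hθ₁, ← h₁]
    · simp only [m, m₂, OverHom.comp_hom, Category.assoc, IsMeet.lift_left, IsMeet.lift_right_assoc,
        hθ₂, h₂]
      exact (comp_unitRefl η m₂ (by simp)).symm
    · simp [m, m₂, hθ₃, ← h₃]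
  let u : OverHom p _ (conj₃ A U C) U := (conj₃Fst A U C).comp aU rfl
  let u' : OverHom p _ (conj₃ A U C) U := ((conj₃Snd A U C).comp (conj₂Snd U C) rfl).comp cU rfl
  -- transport to the context of the outer objects
  let e₁ : (I ⨯ (H ⨯ L)) ⨯ I ⟶ T := prod.lift (prod.fst ≫ prod.snd ≫ prod.fst)
    (prod.lift prod.snd (prod.lift (prod.fst ≫ prod.fst) (prod.fst ≫ prod.snd ≫ prod.snd))) ≫ w
  let e₂ : (I ⨯ (H ⨯ L)) ⨯ I ⟶ T := prod.lift (prod.fst ≫ prod.snd ≫ prod.fst)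
    (prod.lift (prod.fst ≫ prod.fst) (prod.lift prod.snd (prod.fst ≫ prod.snd ≫ prod.snd))) ≫ w
  have he₁ {S : B} (a b c d) : (prod.lift (prod.lift a (prod.lift b c)) d : S ⟶ _) ≫ e₁ =
      prod.lift b (prod.lift d (prod.lift a c)) ≫ w := by
    rw [← Category.assoc]; congr 1; ext <;> simp
  have he₂ {S : B} (a b c d) : (prod.lift (prod.lift a (prod.lift b c)) d : S ⟶ _) ≫ e₂ =
      prod.lift b (prod.lift a (prod.lift d c)) ≫ w := by
    rw [← Category.assoc]; congr 1; ext <;> simp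
  -- This is W(h,i',j',l). It mentions only variables of the outer objects H × I and L × I, so it is
  -- a legitimate target for the unit property.
  let D : Rel p (H ⨯ I) (L ⨯ I) := pull p (prod.lift (prod.fst ≫ prod.fst)
    (prod.lift (prod.fst ≫ prod.snd) (prod.lift (prod.snd ≫ prod.snd) (prod.snd ≫ prod.fst))) ≫ w) W
  -- First i is replaced by i' along U(i,i'); then `G₂` replaces j by j' along U(j,j').
  let G₁ (F : OverHom p w (conj₃ Y₀ U Y₁) W) :
      OverHom p (prod.lift h (prod.lift i' (prod.lift j l)) ≫ w) (conj₃ A U C) W :=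
    transport hη e₁ (prod.lift j (prod.lift h l)) i i' (m.comp F rfl) u (he₁ _ _ _ _)
      (by ext <;> simp [i, i']) (he₁ _ _ _ _)
  let G₂ (F : OverHom p w (conj₃ Y₀ U Y₁) W) :
      OverHom p (prod.lift h (prod.lift i' (prod.lift j' l)) ≫ w) (conj₃ A U C) W :=
    transport hη e₂ (prod.lift i' (prod.lift h l)) j j' (G₁ F) u' (he₂ _ _ _ _)
      (by ext <;> simp [j, j']) (he₂ _ _ _ _)
  let G (F : OverHom p w (conj₃ Y₀ U Y₁) W) : OverHom p _ (conj₃ A U C) D :=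
    pullLift p (g := prod.lift prod.fst (prod.snd ≫ prod.snd ≫ prod.snd)) (by
      rw [← Category.assoc]; congr 1; ext <;> simp [h, i', j', l]) (G₂ F)
  have hG (F) : (G F).hom ≫ (pullMap p _ W).hom = (G₂ F).hom := pullLift_fac p _ _
  have key : θ'.hom ≫ (G F).hom = θ'.hom ≫ (G F').hom := by
    refine congrArg OverHom.hom (pull_ext p (φ := θ'.comp (G F) rfl) (ψ := θ'.comp (G F') rfl) ?_)
    have e : θ'.hom ≫ m.hom ≫ F.hom = θ'.hom ≫ m.hom ≫ F'.hom := by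
      rw [← Category.assoc, ← Category.assoc, hm, Category.assoc, Category.assoc, hF]
    rw [OverHom.comp_hom, OverHom.comp_hom, Category.assoc, Category.assoc, hG, hG]
    exact comp_transport_congr hη e₂ θ' _ _ _ (comp_transport_congr hη e₁ θ' _ _ _ e)
  -- Uniqueness for the composing cell η, whiskered by the enlarged loose arrows A and C.
  have hGG : (G F).hom = (G F').hom := by
    refine hom_ext_of_isComposing hη (.single A) (.single C) hθ' (𝟙 _) (𝟙 _) ?_ key
    change _ = prod.lift ((prod.fst : R ⟶ H ⨯ I) ≫ 𝟙 _)
      (((prod.snd : R ⟶ _) ≫ (prod.snd : I ⨯ (I ⨯ (L ⨯ I)) ⟶ _) ≫ prod.snd ≫ 𝟙 (L ⨯ I)) ≫ 𝟙 _)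
    simp only [Category.comp_id]
  have hGG₂ : (G₂ F).hom = (G₂ F').hom := by rw [← hG, ← hG, hGG]
  let N := conj₃ Y₀ U Y₁
  -- The substitution i' = i, j' = j, with reflexivities for the two copies of the unit. It makes
  -- both transports trivial and so recovers F from `G₂ F`.
  let n : OverHom p (prod.lift (prod.lift prod.fst (prod.snd ≫ prod.fst))
      (prod.snd ≫ prod.map (𝟙 I) (prod.lift prod.fst (prod.lift prod.snd prod.fst)))) N
      (conj₃ A U C) :=
    (isMeet_conj₃ A U C).lift _
      (hA.lift (prod.lift (prod.lift prod.fst (prod.snd ≫ prod.fst)) (prod.snd ≫ prod.fst))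
        (conj₃Fst Y₀ U Y₁) (unitRefl η N (prod.snd ≫ prod.fst)) (by simp) (by simp))
      ((isMeet_conj₂ U C).lift (prod.snd ≫
          prod.map (𝟙 I) (prod.lift prod.fst (prod.lift prod.snd prod.fst)))
        ((conj₃Snd Y₀ U Y₁).comp (conj₂Fst U Y₁) rfl)
        (hC.lift (prod.lift (prod.snd ≫ prod.snd ≫ prod.fst)
          (prod.lift (prod.snd ≫ prod.snd ≫ prod.snd) (prod.snd ≫ prod.snd ≫ prod.fst)))
          ((conj₃Snd Y₀ U Y₁).comp (conj₂Snd U Y₁) rfl)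
          (unitRefl η N (prod.snd ≫ prod.snd ≫ prod.fst)) (by ext <;> simp) (by ext <;> simp))
          (by ext <;> simp) (by ext <;> simp))
      (by simp) (by simp)
  have hn : n.hom ≫ m.hom = 𝟙 _ := by
    refine conj₃_hom_ext (z := n.comp m rfl) (z' := OverHom.id N) ?_ ?_ ?_ <;> simp [n, m, N]
  have hn' (F) : n.hom ≫ (G₂ F).hom = F.hom := by
    refine (comp_transport_refl (i₀ := prod.snd ≫ prod.snd ≫ prod.fst) hη e₂ n _ _ _ ?_).trans
      ((comp_transport_refl (i₀ := prod.snd ≫ prod.fst) hη e₁ n _ _ _ ?_).trans ?_)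
    · simp [n, u']
    · simp [n, u]
    · rw [OverHom.comp_hom, ← Category.assoc, hn, Category.id_comp]
  rw [← hn' F, ← hn' F', hGG₂]

end

end Fibration

/-! ### Units are stably opcartesian -/

namespace Fibration

attribute [local simp] prod.lift_fst prod.lift_snd prod.lift_fst_assoc prod.lift_snd_assoc

section

variable {B : Type u₁} [Category.{v₁} B] [HasFiniteProducts B] {E : Type u₂} [Category.{v₂} E]
  {p : E ⥤ B} [IsCartesianFibration p] {I : B} {U : Rel p I I}
  {η : (bilData p).Cell (.nil I) (𝟙 I) (𝟙 I) U} (hη : (Bil p).IsComposing η)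

section

variable {K T : B} (e : K ⨯ I ⟶ T) {X : p.Fiber T} {S : B} {Γ : p.Fiber S} {k : S ⟶ K}
  {i j : S ⟶ I} {a c : S ⟶ T} {b : S ⟶ I ⨯ I} (u : OverHom p b Γ U)
  (ha : prod.lift k i ≫ e = a) (hb : prod.lift i j = b) (hc : prod.lift k j ≫ e = c)

/-- It suffices to treat the universal instance, where the context is U(i,j) ∧ X(k,j). There
`conj_unit_hom_ext` reduces the equation to the case of reflexivity, in which both transports are
trivial. -/
theorem transport_transportSymm (y : OverHom p c Γ X) :
    (transport hη e k i j (transportSymm hη e k i j y u ha hb hc) u ha hb hc).hom = y.hom := by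
  let Y₁ : Rel p I K := pull p (prod.lift prod.snd prod.fst ≫ e) X
  let Y₀ : Rel p (⊤_ B) I := ⊤_ _
  obtain ⟨t, θ, -, h₁, h₂, h₃⟩ := exists_single_refl_single Y₀ Y₁ η
  let u₀ : OverHom p _ (conj₃ Y₀ U Y₁) U := (conj₃Snd Y₀ U Y₁).comp (conj₂Fst U Y₁) rfl
  let y₀ : OverHom p _ (conj₃ Y₀ U Y₁) X := ((conj₃Snd Y₀ U Y₁).comp (conj₂Snd U Y₁) rfl).comp
    (pullMap p _ X) rfl
  have hb₀ : prod.lift (prod.snd ≫ prod.fst) (prod.snd ≫ prod.snd ≫ prod.fst) =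
    (prod.snd ≫ prod.lift prod.fst (prod.snd ≫ prod.fst) : (⊤_ B) ⨯ (I ⨯ (I ⨯ K)) ⟶ I ⨯ I) := by
    ext <;> simp
  have hc₀ : prod.lift (prod.snd ≫ prod.snd ≫ prod.snd) (prod.snd ≫ prod.snd ≫ prod.fst) ≫ e =
    (prod.snd ≫ prod.snd : (⊤_ B) ⨯ (I ⨯ (I ⨯ K)) ⟶ I ⨯ K) ≫ prod.lift prod.snd prod.fst ≫ e := by
    rw [← Category.assoc _ _ e]; congr 1; ext <;> simp
  have hu₀ : θ.hom ≫ u₀.hom = (unitRefl η (conj₂ Y₀ Y₁) (prod.snd ≫ prod.fst)).hom := h₂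
  let s₀ := transportSymm hη e _ _ _ y₀ u₀ rfl hb₀ hc₀
  have key : (transport hη e _ _ _ s₀ u₀ rfl hb₀ hc₀).hom = y₀.hom := by
    refine conj_unit_hom_ext hη Y₀ Y₁ h₁ h₂ h₃ ?_
    exact (comp_transport_refl hη e θ _ _ _ hu₀).trans (comp_transportSymm_refl hη e θ _ _ _ hu₀)
  -- The given u and y form a substitution into the universal instance; the trivial member `Y₀`
  -- contributes only arrows to terminal objects.
  let z : OverHom p (prod.lift (terminal.from S) (prod.lift i (prod.lift j k))) Γ (conj₃ Y₀ U Y₁) :=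
    (isMeet_conj₃ Y₀ U Y₁).lift _ (terminalLift p Γ _)
      ((isMeet_conj₂ U Y₁).lift (prod.lift i (prod.lift j k)) u
        (pullLift p (g := prod.lift j k) (by
          rw [← hc, ← Category.assoc]; congr 1; ext <;> simp) y)
          (by rw [← hb]; ext <;> simp) (by simp)) rfl (by simp)
  have hz : z.hom ≫ y₀.hom = y.hom := by simp [z, y₀, pullLift_fac, Y₁]
  have hz' : z.hom ≫ u₀.hom = u.hom := by simp [z, u₀]
  rw [← hz, ← key]
  refine (comp_transport hη e z _ _ _ _ _ _ (by simp) ?_ hz').symm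
  exact comp_transportSymm hη e z _ _ _ _ _ _ (by simp) hz hz'

end

include hη in
/-- Units of `Bil[p]` are stably opcartesian. -/
theorem isStablyOpcart_of_isComposing_nil : IsStablyOpcart η := by
  refine .of_forall_context fun K => ⟨K ⨯ I, K ⨯ (I ⨯ I), prod.snd,
    prod.lift prod.fst (prod.lift prod.snd prod.snd), prod.snd, prod.fst, isProd_fst_snd _ _,
    by rw [prod.lift_fst]; exact isProd_fst_snd _ _, ?_, ?_⟩
  · change (prod.snd : K ⨯ I ⟶ I) ≫ prod.lift (𝟙 I ≫ 𝟙 I) (𝟙 I ≫ 𝟙 I) = _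
    ext <;> simp
  intro Y M N a b c d θ hM hN h₁ h₂
  let g : K ⨯ I ⟶ K ⨯ (I ⨯ I) := prod.lift prod.fst (prod.lift prod.snd prod.snd)
  let c₀ : OverHom p (prod.snd : K ⨯ (I ⨯ I) ⟶ I ⨯ I) N U := c
  have hb : prod.lift (prod.snd ≫ prod.fst) (prod.snd ≫ prod.snd) =
    (prod.snd : K ⨯ (I ⨯ I) ⟶ I ⨯ I) := by ext <;> simp
  let e : (K ⨯ I) ⨯ I ⟶ K ⨯ (I ⨯ I) :=
    prod.lift (prod.fst ≫ prod.fst) (prod.lift (prod.fst ≫ prod.snd) prod.snd)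
  have hc : prod.lift (prod.lift prod.fst (prod.snd ≫ prod.fst)) (prod.snd ≫ prod.snd) ≫ e =
    𝟙 (K ⨯ (I ⨯ I)) := by ext <;> simp [e]
  let s := transportSymm hη e _ _ _ d c₀ rfl hb hc
  -- Backward transport of Y(k,i,j) to Y(k,i,i) along U(i,j). By the computation rule, q is a
  -- retraction of θ.
  let q : OverHom p (prod.lift prod.fst (prod.snd ≫ prod.fst)) N M :=
    hM.lift _ (terminalLift p N _) s rfl (by ext <;> simp [e])
  have hrefl : θ.hom ≫ c₀.hom = (unitRefl η M prod.snd).hom := by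
    refine h₁.trans (congrArg (· ≫ η.hom) ?_)
    exact terminal_hom_ext a _ rfl
  have hqb : q.hom ≫ b.hom = s.hom := hM.lift_right _ _ _ _ _
  have hg : g ≫ prod.lift prod.fst (prod.snd ≫ prod.fst) = 𝟙 _ := by ext <;> simp [g]
  have hqθ : θ.hom ≫ q.hom = 𝟙 _ := by
    refine hM.hom_ext (z := θ.comp q hg) (z' := OverHom.id M) ?_ ?_
    · exact terminal_hom_ext ((θ.comp q hg).comp a rfl) ((OverHom.id M).comp a rfl) rfl
    · refine (Category.assoc _ _ _).trans ((congrArg (_ ≫ ·) hqb).trans ?_)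
      refine (comp_transportSymm_refl hη e θ _ _ _ hrefl).trans (h₂.trans ?_)
      exact (Category.id_comp _).symm
  have hq : prod.lift (prod.lift prod.fst (prod.snd ≫ prod.fst)) (prod.snd ≫ prod.fst) ≫ e =
      (prod.lift prod.fst (prod.snd ≫ prod.fst) : K ⨯ (I ⨯ I) ⟶ K ⨯ I) ≫ g := by
    ext <;> simp [e, g]
  have uniq {W : p.Fiber (K ⨯ (I ⨯ I))} {χ χ' : OverHom p (𝟙 _) N W}
      (hχ : θ.hom ≫ χ.hom = θ.hom ≫ χ'.hom) : χ.hom = χ'.hom := by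
    -- The object N is U(i,j) ∧ Y(k,i,j), and Y involves both i and j, so N is not itself a
    -- conjunction along a path. It is compared with Y(k,i,i) ∧ U(i,j) ∧ ⊤, which is one.
    let Y₀ : Rel p K I := pull p g Y
    let Y₁ : Rel p I (⊤_ B) := ⊤_ _
    obtain ⟨t, θ₃, -, k₁, k₂, k₃⟩ := exists_single_refl_single Y₀ Y₁ η
    let u₀ : OverHom p _ (conj₃ Y₀ U Y₁) U := (conj₃Snd Y₀ U Y₁).comp (conj₂Fst U Y₁) rfl
    let y₀ : OverHom p _ (conj₃ Y₀ U Y₁) Y := (conj₃Fst Y₀ U Y₁).comp (pullMap p _ Y) rfl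
    have hb₀ : prod.lift (prod.snd ≫ prod.fst) (prod.snd ≫ prod.snd ≫ prod.fst) =
      (prod.snd ≫ prod.lift prod.fst (prod.snd ≫ prod.fst) : K ⨯ (I ⨯ (I ⨯ (⊤_ B))) ⟶ I ⨯ I) := by
      ext <;> simp
    have ha₀ : prod.lift (prod.lift prod.fst (prod.snd ≫ prod.fst)) (prod.snd ≫ prod.fst) ≫ e =
        (prod.lift prod.fst (prod.snd ≫ prod.fst) : K ⨯ (I ⨯ (I ⨯ (⊤_ B))) ⟶ K ⨯ I) ≫ g := by
      ext <;> simp [e, g]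
    let s₀ := transport hη e _ _ _ y₀ u₀ ha₀ hb₀ rfl
    let n : OverHom p (prod.lift prod.fst (prod.lift (prod.snd ≫ prod.fst)
        (prod.snd ≫ prod.snd ≫ prod.fst))) (conj₃ Y₀ U Y₁) N :=
      hN.lift _ u₀ s₀ (by ext <;> simp) (by ext <;> simp [e])
    let r : OverHom p (prod.lift prod.fst (prod.snd ≫ prod.fst)) (conj₂ Y₀ Y₁) M :=
      hM.lift _ (terminalLift p _ _) ((conj₂Fst Y₀ Y₁).comp (pullMap p _ Y) rfl) rfl rfl
    have hu₀ : θ₃.hom ≫ u₀.hom = (unitRefl η (conj₂ Y₀ Y₁) (prod.snd ≫ prod.fst)).hom := k₂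
    have hn : θ₃.hom ≫ n.hom = r.hom ≫ θ.hom := by
      have hd : (θ₃.comp n rfl).hom ≫ d.hom = (r.comp θ rfl).hom ≫ d.hom := by
        refine (Category.assoc _ _ _).trans ((congrArg (_ ≫ ·) (hN.lift_right _ _ _ _ _)).trans ?_)
        refine (comp_transport_refl hη e θ₃ _ _ _ hu₀).trans ((Category.assoc _ _ _).trans ?_).symm
        refine (congrArg (_ ≫ ·) h₂).trans ((hM.lift_right _ _ _ _ _).trans ?_)
        refine Eq.trans ?_ (Category.assoc _ _ _)
        exact congrArg (· ≫ _) k₁.symm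
      have hbase := OverHom.base_eq (φ := (θ₃.comp n rfl).comp d (Category.comp_id _))
        (ψ := (r.comp θ rfl).comp d (Category.comp_id _)) hd
      refine hN.hom_ext (z := θ₃.comp n rfl) (z' := (r.comp θ rfl).rebase hbase.symm) ?_ hd
      refine (Category.assoc _ _ _).trans ((congrArg (_ ≫ ·) (hN.lift_left _ _ _ _ _)).trans ?_)
      refine hu₀.trans ((Category.assoc _ _ _).trans ?_).symm
      exact (congrArg (_ ≫ ·) hrefl).trans (comp_unitRefl η r (by simp))
    -- By `transport_transportSymm`, z is a section of n. Hence n is a split epimorphism, and χ and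
    -- χ' need to be compared only after n, where `conj_unit_hom_ext` applies.
    let z : OverHom p (prod.lift prod.fst (prod.lift (prod.snd ≫ prod.fst)
        (prod.lift (prod.snd ≫ prod.snd) (terminal.from _)))) N (conj₃ Y₀ U Y₁) :=
      (isMeet_conj₃ Y₀ U Y₁).lift _ (pullLift p rfl (s.rebase hq))
        ((isMeet_conj₂ U Y₁).lift (prod.lift (prod.snd ≫ prod.fst)
          (prod.lift (prod.snd ≫ prod.snd) (terminal.from _))) c₀ (terminalLift p N _)
          (by ext <;> simp) rfl) (by ext <;> simp) (by ext <;> simp)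
    have hz' : z.hom ≫ u₀.hom = c₀.hom := by simp [z, u₀]
    have hz'' : z.hom ≫ y₀.hom = s.hom := by simp [z, y₀, pullLift_fac, Y₀]
    have hz : z.hom ≫ n.hom = 𝟙 _ := by
      refine hN.hom_ext (z := z.comp n (by ext <;> simp)) (z' := OverHom.id N) ?_ ?_
      · refine (Category.assoc _ _ _).trans ((congrArg (_ ≫ ·) (hN.lift_left _ _ _ _ _)).trans ?_)
        exact (hz' : z.hom ≫ u₀.hom = c.hom).trans (Category.id_comp _).symm
      · refine (Category.assoc _ _ _).trans ((congrArg (_ ≫ ·) (hN.lift_right _ _ _ _ _)).trans ?_)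
        refine (comp_transport hη e z _ _ _ hq hb hc (x' := s.rebase hq) (u' := c₀)
          ?_ hz'' hz').trans ?_
        · ext <;> simp
        · refine (transport_transportSymm hη e c₀ rfl hb hc d).trans (Category.id_comp _).symm
    have key : n.hom ≫ χ.hom = n.hom ≫ χ'.hom := by
      refine conj_unit_hom_ext hη Y₀ Y₁ k₁ k₂ k₃ (F := n.comp χ rfl) (F' := n.comp χ' rfl) ?_
      simp only [OverHom.comp_hom]
      refine (Category.assoc _ _ _).symm.trans (Eq.trans ?_ (Category.assoc _ _ _))
      rw [hn, Category.assoc, Category.assoc, hχ]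
    rw [← Category.id_comp χ.hom, ← hz, Category.assoc, key, ← Category.assoc, hz,
      Category.id_comp]
  -- The factorisation: move to the diagonal by q, apply ψ there, and transport the result from
  -- W(k,i,i) to W(k,i,j).
  refine IsOpcart.of_fiber fun {W} ψ => ⟨transport hη e _ _ _ (q.comp ψ rfl) c₀
    hq hb hc, ?_, fun χ hχ => ?_⟩
  · refine (comp_transport_refl hη e θ _ _ _ hrefl).trans ?_
    rw [OverHom.comp_hom, ← Category.assoc, hqθ, Category.id_comp]
  · refine OverHom.ext (uniq (hχ.trans ?_))
    refine Eq.symm ((comp_transport_refl hη e θ _ _ _ hrefl).trans ?_)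
    rw [OverHom.comp_hom, ← Category.assoc, hqθ, Category.id_comp]

end

end Fibration

namespace Fibration

section

variable {B : Type u₁} [Category.{v₁} B] [HasFiniteProducts B] {E : Type u₂} [Category.{v₂} E]
  {p : E ⥤ B} [IsCartesianFibration p]

/-! ### Left adjoints of base change functors -/

theorem ofPull_hom {S T : B} {f : S ⟶ T} {X : p.Fiber S} {Y : p.Fiber T}
    (φ : X ⟶ (baseChange p f).obj Y) :
    (ofPull p φ).hom = Functor.Fiber.fiberInclusion.map φ ≫ (pullMap p f Y).hom := rfl

theorem ofPull_comp_left {S T : B} {f : S ⟶ T} {X X' : p.Fiber S} {Y : p.Fiber T} (ψ : X' ⟶ X)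
    (φ : X ⟶ (baseChange p f).obj Y) :
    (ofPull p (ψ ≫ φ)).hom = Functor.Fiber.fiberInclusion.map ψ ≫ (ofPull p φ).hom :=
  (congrArg (· ≫ (pullMap p f Y).hom) (Functor.Fiber.fiberInclusion.map_comp ψ φ)).trans
    (Category.assoc _ _ _)

theorem toPull_ofPull {S T : B} {f : S ⟶ T} {X : p.Fiber S} {Y : p.Fiber T}
    (φ : X ⟶ (baseChange p f).obj Y) : toPull p (ofPull p φ) = φ :=
  fiber_ext p (toPull_fac p _)

theorem pullSwap_fac {S S' T T' : B} {h : S' ⟶ S} {g : S ⟶ T} {g' : S' ⟶ T'} {k : T' ⟶ T}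
    (w : h ≫ g = g' ≫ k) (Y : p.Fiber T) :
    (ofPull p (pullSwap p w Y)).hom ≫ (pullMap p k Y).hom =
      (pullMap p h (pull p g Y)).hom ≫ (pullMap p g Y).hom := by
  refine (congrArg (· ≫ _) (pullLift_fac p (Category.id_comp g') _)).trans ?_
  exact pullLift_fac p _ _

/-- An opcartesian lift of X represents the functor of arrows from X to base changes along f; a
choice of lifts is a left adjoint. -/
theorem isRightAdjoint_baseChange {S T : B} (f : S ⟶ T)
    (H : ∀ X : p.Fiber S, ∃ (Z : p.Fiber T) (φ : OverHom p f X Z), IsOpcart φ) :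
    (baseChange p f).IsRightAdjoint := by
  choose Z φ hφ using H
  refine (Adjunction.adjunctionOfEquivLeft (G := baseChange p f) (F_obj := Z) (fun X Y =>
    Equiv.ofBijective (fun χ => toPull p ((φ X).comp (OverHom.ofFiber χ) (Category.comp_id f)))
      ⟨fun χ χ' h => ?_, fun ψ => ?_⟩) ?_).isRightAdjoint
  · have h' := congrArg (fun ψ => (ofPull p ψ).hom) h
    simp only [ofPull_toPull] at h'
    exact Functor.Fiber.hom_ext ((hφ X).hom_ext (χ := OverHom.ofFiber χ)
      (χ' := OverHom.ofFiber χ') h')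
  · obtain ⟨χ, hχ, -⟩ := hφ X (𝟙 T) (ofPull p ψ) (Category.comp_id f)
    refine ⟨χ.toFiber, ?_⟩
    rw [← toPull_ofPull ψ]
    exact congrArg _ (OverHom.ext hχ)
  · intro X Y Y' g h
    change toPull p _ = toPull p _ ≫ _
    rw [toPull_comp]
    refine congrArg _ (OverHom.ext ?_)
    simp

section

variable {S T : B} {g : S ⟶ T} {L : p.Fiber S ⥤ p.Fiber T} (adj : L ⊣ baseChange p g)

theorem unit_comp {X : p.Fiber S} {W : p.Fiber T} (χ : L.obj X ⟶ W) :
    (ofPull p (adj.unit.app X)).hom ≫ Functor.Fiber.fiberInclusion.map χ =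
      (ofPull p (adj.homEquiv X W χ)).hom := by
  rw [Adjunction.homEquiv_unit, ofPull_comp, toPull_ofPull]

/-- The unit of an adjunction is opcartesian. -/
theorem isOpcart_unit (X : p.Fiber S) : IsOpcart (ofPull p (adj.unit.app X)) := by
  refine IsOpcart.of_fiber fun {W} ψ =>
    ⟨OverHom.ofFiber ((adj.homEquiv X W).symm (toPull p ψ)), ?_, fun χ hχ => OverHom.ext ?_⟩
  · change _ ≫ Functor.Fiber.fiberInclusion.map _ = _
    rw [unit_comp, Equiv.apply_symm_apply, ofPull_toPull]
  · have h : adj.homEquiv X W χ.toFiber = toPull p ψ := by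
      rw [← toPull_ofPull (adj.homEquiv X W χ.toFiber)]
      exact congrArg _ (OverHom.ext ((unit_comp adj _).symm.trans hχ))
    exact congrArg Functor.Fiber.fiberInclusion.map ((Equiv.eq_symm_apply _).2 h)

/-- The transpose is the unit followed by χ; the unit is opcartesian, and opcartesian lifts are
unique up to isomorphism. This turns the Beck–Chevalley and Frobenius conditions into statements
about opcartesian arrows. -/
theorem isIso_iff_isOpcart {X : p.Fiber S} {W : p.Fiber T} (χ : L.obj X ⟶ W) :
    IsIso χ ↔ IsOpcart (ofPull p (adj.homEquiv X W χ)) := by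
  constructor
  · intro h
    have : IsIso (OverHom.ofFiber χ).hom := by rw [OverHom.ofFiber_hom]; infer_instance
    have e : ofPull p (adj.homEquiv X W χ) = (ofPull p (adj.unit.app X)).comp (OverHom.ofFiber χ)
      (Category.comp_id g) := OverHom.ext (unit_comp adj χ).symm
    exact e ▸ (isOpcart_unit adj X).comp (IsOpcart.of_isIso _) _
  · intro h
    have := (isOpcart_unit adj X).isIso h (j := OverHom.ofFiber χ) (unit_comp adj χ)
    exact OverHom.isIso_toFiber (OverHom.ofFiber χ)

theorem unit_naturality {X X' : p.Fiber S} (f : X ⟶ X') :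
    (ofPull p (adj.unit.app X)).hom ≫ Functor.Fiber.fiberInclusion.map (L.map f) =
      Functor.Fiber.fiberInclusion.map f ≫ (ofPull p (adj.unit.app X')).hom := by
  have e : adj.homEquiv _ _ (L.map f) = f ≫ adj.unit.app X' := by simp [Adjunction.homEquiv_unit]
  rw [unit_comp, e, ofPull_comp_left]

theorem unit_counit (Y : p.Fiber T) :
    (ofPull p (adj.unit.app ((baseChange p g).obj Y))).hom ≫
      Functor.Fiber.fiberInclusion.map (adj.counit.app Y) = (pullMap p g Y).hom := by
  have e : adj.homEquiv _ _ (adj.counit.app Y) = 𝟙 _ := by simp [Adjunction.homEquiv_unit]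
  rw [unit_comp, e]
  exact (congrArg (· ≫ (pullMap p g Y).hom)
    (CategoryTheory.Functor.map_id Functor.Fiber.fiberInclusion _)).trans (Category.id_comp _)

end

/-- Characterises the transposed comparison by its composite with a cartesian arrow: it is the base
change of the unit along the square. -/
theorem bcComparison_fac {S S' T T' : B} {h : S' ⟶ S} {g : S ⟶ T} {g' : S' ⟶ T'}
    {k : T' ⟶ T} (w : h ≫ g = g' ≫ k) {L : p.Fiber S ⥤ p.Fiber T} (adj : L ⊣ baseChange p g)
    {L' : p.Fiber S' ⥤ p.Fiber T'} (adj' : L' ⊣ baseChange p g') (X : p.Fiber S) :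
    (ofPull p (adj'.homEquiv _ _ (bcComparison p w adj adj' X))).hom ≫ (pullMap p k (L.obj X)).hom =
      (pullMap p h X).hom ≫ (ofPull p (adj.unit.app X)).hom := by
  have e : adj'.homEquiv _ _ (bcComparison p w adj adj' X) = _ := Equiv.apply_symm_apply _ _
  rw [e, ofPull_comp_left]
  refine (Category.assoc _ _ _).trans ((congrArg (_ ≫ ·) (pullSwap_fac w (L.obj X))).trans ?_)
  rw [ofPull_hom]
  refine (Category.assoc _ _ _).symm.trans (Eq.trans ?_ (Category.assoc _ _ _))
  exact congrArg (· ≫ _) (baseChange_map_fac p h (adj.unit.app X))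

/-- Characterises the transposed comparison by its two projections: it is the unit conjoined with
the cartesian arrow into Y. -/
theorem frobeniusComparison_fac {S T : B} {g : S ⟶ T} {L : p.Fiber S ⥤ p.Fiber T}
    (adj : L ⊣ baseChange p g) (X : p.Fiber S) (Y : p.Fiber T) :
    (ofPull p (adj.homEquiv _ _ (frobeniusComparison p adj X Y))).hom ≫
        Functor.Fiber.fiberInclusion.map prod.fst =
      Functor.Fiber.fiberInclusion.map prod.fst ≫ (ofPull p (adj.unit.app X)).hom ∧
    (ofPull p (adj.homEquiv _ _ (frobeniusComparison p adj X Y))).hom ≫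
        Functor.Fiber.fiberInclusion.map prod.snd =
      Functor.Fiber.fiberInclusion.map prod.snd ≫ (pullMap p g Y).hom := by
  constructor
  · rw [← unit_comp, Category.assoc, ← Functor.map_comp, frobeniusComparison, prod.lift_fst,
      unit_naturality]
    rfl
  · rw [← unit_comp, Category.assoc, ← Functor.map_comp, frobeniusComparison, prod.lift_snd,
      Functor.map_comp, ← Category.assoc, unit_naturality, Category.assoc]
    exact congrArg (_ ≫ ·) (unit_counit adj Y)

/-- The case of stability with conjunct ⊤. The unit and φ are opcartesian with the same domain, so
the stability of one passes to the other. -/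
theorem beckChevalley_of_isStableAlong {S S' T T' : B} {h : S' ⟶ S} {g : S ⟶ T} {g' : S' ⟶ T'}
    {k : T' ⟶ T} (w : h ≫ g = g' ≫ k) (H : ∀ X : p.Fiber S, ∃ (Z : p.Fiber T)
      (φ : OverHom p g X Z), IsOpcart φ ∧ IsStableAlong φ h g' k) : BeckChevalley p w := by
  intro L adj L' adj' X
  obtain ⟨Z, φ, hφ, hs⟩ := H X
  rw [isIso_iff_isOpcart adj']
  exact hs.of_isOpcart hφ (isOpcart_unit adj X) (a := pullMap p h X) (c := pullMap p k (L.obj X))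
    (b := terminalLift p _ g') (d := terminalLift p _ (𝟙 T')) _ (isMeet_terminal _ _)
    (isMeet_terminal _ _) (bcComparison_fac w adj adj' X)
    (terminal_hom_ext ((ofPull p _).comp (terminalLift p _ (𝟙 T')) rfl) _ (Category.comp_id _))

/-- The case of stability along an identity square, with an arbitrary conjunct. -/
theorem frobenius_of_isStableAlong {S T : B} {g : S ⟶ T} (H : ∀ X : p.Fiber S, ∃ (Z : p.Fiber T)
    (φ : OverHom p g X Z), IsOpcart φ ∧ IsStableAlong φ (𝟙 S) g (𝟙 T)) : Frobenius p g := by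
  intro L adj X Y
  obtain ⟨Z, φ, hφ, hs⟩ := H X
  rw [isIso_iff_isOpcart adj]
  obtain ⟨h₁, h₂⟩ := frobeniusComparison_fac adj X Y
  refine hs.of_isOpcart hφ (isOpcart_unit adj X) _
    (isMeet_prod (𝟙 S) g (OverHom.id X) (pullMap p g Y))
    (isMeet_prod (𝟙 T) (𝟙 T) (OverHom.id (L.obj X)) (OverHom.id Y)) ?_ ?_
  · refine (congrArg (_ ≫ ·) (Category.comp_id _)).trans (h₁.trans ?_)
    exact congrArg (· ≫ _) (Category.comp_id _).symm
  · exact (congrArg (_ ≫ ·) (Category.comp_id _)).trans h₂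

theorem IsMeet.isIso {S T₁ T₂ : B} {q : S ⟶ T₁} {r : S ⟶ T₂} {M M' : p.Fiber S} {X : p.Fiber T₁}
    {Y : p.Fiber T₂} {a : OverHom p q M X} {b : OverHom p r M Y} {a' : OverHom p q M' X}
    {b' : OverHom p r M' Y} (H : IsMeet a b) (H' : IsMeet a' b') (z : OverHom p (𝟙 S) M' M)
    (h₁ : z.hom ≫ a.hom = a'.hom) (h₂ : z.hom ≫ b.hom = b'.hom) : IsIso z.hom := by
  let y := H'.lift (𝟙 S) a b (Category.id_comp _) (Category.id_comp _)
  refine ⟨y.hom, ?_, ?_⟩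
  · refine H'.hom_ext (z := z.comp y (Category.comp_id _)) (z' := OverHom.id M') ?_ ?_ <;>
      simp [y, h₁, h₂]
  · refine H.hom_ext (z := y.comp z (Category.comp_id _)) (z' := OverHom.id M) ?_ ?_ <;>
      simp [y, h₁, h₂]

/-- The unit of an adjunction along the left side of a square that satisfies the Beck–Chevalley
condition is stable along the square, given Frobenius reciprocity for the right side. -/
theorem isStableAlong_unit {S S' T T' : B} {h : S' ⟶ S} {g : S ⟶ T} {g' : S' ⟶ T'}
    {k : T' ⟶ T} (w : h ≫ g = g' ≫ k) (hbc : BeckChevalley p w) (hf : Frobenius p g')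
    (hadj : (baseChange p g').IsRightAdjoint) {L : p.Fiber S ⥤ p.Fiber T}
    (adj : L ⊣ baseChange p g) (X : p.Fiber S) :
    IsStableAlong (ofPull p (adj.unit.app X)) h g' k := by
  intro Y M N a b c d θ hM hN h₁ h₂
  let adj' := Adjunction.ofIsRightAdjoint (baseChange p g')
  let L' := (baseChange p g').leftAdjoint
  let A := (baseChange p h).obj X
  let Z := L.obj X
  have i₁ := (isIso_iff_isOpcart adj' _).1 (hf _ adj' ((baseChange p h).obj X) Y)
  obtain ⟨f₁, f₂⟩ := frobeniusComparison_fac adj' ((baseChange p h).obj X) Y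
  have i₂ := hbc _ adj _ adj' X
  have e₂ := bcComparison_fac w adj adj' X
  -- By Beck–Chevalley, ∑ X[h] along g' serves as Z[k], so N is the conjunction of it with Y.
  let χ : OverHom p (𝟙 T') (L'.obj A) (pull p k Z) := OverHom.ofFiber (bcComparison p w adj adj' X)
  have : IsIso χ.hom :=
    inferInstanceAs (IsIso (Functor.Fiber.fiberInclusion.map (bcComparison p w adj adj' X)))
  let cZ : OverHom p k (L'.obj A) Z := χ.comp (pullMap p k Z) (Category.id_comp k)
  have : p.IsStronglyCartesian k cZ.hom := by
    have : p.IsStronglyCartesian (𝟙 T') χ.hom := inferInstance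
    have : p.IsStronglyCartesian (𝟙 T' ≫ k) (χ.hom ≫ (pullMap p k Z).hom) := inferInstance
    rwa [Category.id_comp] at this
  have hN' := isMeet_prod k (𝟙 T') cZ (OverHom.id Y)
  have hM' := isMeet_prod h g' (pullMap p h X) (pullMap p g' Y)
  let ζ := hN.lift (𝟙 T') ((OverHom.ofFiber (prod.fst : L'.obj A ⨯ Y ⟶ _)).comp cZ
    (Category.id_comp _)) ((OverHom.ofFiber (prod.snd : L'.obj A ⨯ Y ⟶ _)).comp (OverHom.id Y)
    (Category.id_comp _)) (Category.id_comp _) (Category.id_comp _)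
  have hζ : IsIso ζ.hom := hN.isIso hN' ζ (hN.lift_left _ _ _ _ _) (hN.lift_right _ _ _ _ _)
  let ξ := hM'.lift (𝟙 S') a b (Category.id_comp _) (Category.id_comp _)
  have hξ : IsIso ξ.hom := hM'.isIso hM ξ (hM'.lift_left _ _ _ _ _) (hM'.lift_right _ _ _ _ _)
  let τ : OverHom p g' (A ⨯ (baseChange p g').obj Y) (L'.obj A ⨯ Y) :=
    ofPull p (adj'.homEquiv _ _ (frobeniusComparison p adj' A Y))
  have k₁ : τ.hom ≫ ζ.hom ≫ c.hom = ((OverHom.ofFiber (prod.fst : A ⨯ _ ⟶ A)).comp (pullMap p h X)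
      (Category.id_comp _)).hom ≫ (ofPull p (adj.unit.app X)).hom := by
    refine (congrArg (_ ≫ ·) (hN.lift_left _ _ _ _ _)).trans ?_
    refine (Category.assoc _ _ _).symm.trans ((congrArg (· ≫ _) f₁).trans ?_)
    refine (Category.assoc _ _ _).trans (Eq.trans ?_ (Category.assoc _ _ _).symm)
    refine congrArg (_ ≫ ·) (Eq.trans ?_ e₂)
    refine (Category.assoc _ _ _).symm.trans (congrArg (· ≫ _) (unit_comp adj' _))
  have k₂ : τ.hom ≫ ζ.hom ≫ d.hom = ((OverHom.ofFiber (prod.snd : A ⨯ _ ⟶ _)).comp (pullMap p g' Y)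
      (Category.id_comp _)).hom := by
    refine (congrArg (_ ≫ ·) ((hN.lift_right _ _ _ _ _).trans (Category.comp_id _))).trans f₂
  -- Up to the isomorphisms ξ and ζ between conjunctions, θ is the transposed Frobenius comparison τ
  -- along g', which is opcartesian.
  have e : θ = (ξ.comp (τ.comp ζ (Category.comp_id _)) (Category.id_comp _)) := by
    refine OverHom.ext (hN.hom_ext ?_ ?_)
    · refine h₁.trans (Eq.trans ?_ (congrArg (ξ.hom ≫ ·) k₁.symm |>.trans ?_))
      · exact (congrArg (· ≫ _) (hM'.lift_left _ _ _ _ _).symm).trans (Category.assoc _ _ _)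
      · exact (congrArg (ξ.hom ≫ ·) (Category.assoc _ _ _).symm).trans (Category.assoc _ _ _).symm
    · refine h₂.trans (Eq.trans ?_ (congrArg (ξ.hom ≫ ·) k₂.symm |>.trans ?_))
      · exact (hM'.lift_right _ _ _ _ _).symm
      · exact (congrArg (ξ.hom ≫ ·) (Category.assoc _ _ _).symm).trans (Category.assoc _ _ _).symm
  exact e ▸ (IsOpcart.of_isIso ξ).comp (i₁.comp (IsOpcart.of_isIso ζ) _) _

end

end Fibration

namespace Fibration

attribute [local simp] prod.lift_fst prod.lift_snd prod.lift_fst_assoc prod.lift_snd_assoc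

section

variable {B : Type u₁} [Category.{v₁} B] [HasFiniteProducts B] {E : Type u₂} [Category.{v₂} E]
  {p : E ⥤ B} [IsCartesianFibration p]

/-! ### Units give an elementary fibration -/

/-- Both M and Q are conjunctions of the same X and Y, so M is the base change of Q along g, and the
additional member ⊤ is no condition. -/
theorem IsMeet.terminal_left {S T T₁ T₂ V : B} {q : T ⟶ T₁} {r : T ⟶ T₂} {q' : S ⟶ T₁}
    {r' : S ⟶ T₂} {g : S ⟶ T} {v : S ⟶ V} {M : p.Fiber S} {Q : p.Fiber T} {X : p.Fiber T₁}
    {Y : p.Fiber T₂} {a : OverHom p q' M X} {b : OverHom p r' M Y} {c : OverHom p q Q X}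
    {d : OverHom p r Q Y} (hM : IsMeet a b) (hQ : IsMeet c d) (e : OverHom p g M Q)
    (h₁ : e.hom ≫ c.hom = a.hom) (h₂ : e.hom ≫ d.hom = b.hom)
    (t : OverHom p v M (⊤_ (p.Fiber V))) : IsMeet t e := by
  have e₁ : g ≫ q = q' := OverHom.base_eq (φ := e.comp c rfl) h₁
  have e₂ : g ≫ r = r' := OverHom.base_eq (φ := e.comp d rfl) h₂
  intro R u N q'' r'' x y hq hr
  refine ⟨hM.lift u (y.comp c rfl) (y.comp d rfl) (by rw [← e₁, ← Category.assoc, hr])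
    (by rw [← e₂, ← Category.assoc, hr]), ⟨terminal_hom_ext (OverHom.comp _ t rfl) x hq,
    hQ.hom_ext (z := OverHom.comp _ e hr) ?_ ?_⟩, fun z hz => OverHom.ext (hM.hom_ext ?_ ?_)⟩
  · simp [h₁]
  · simp [h₂]
  · rw [IsMeet.lift_left, ← h₁, ← Category.assoc, hz.2, OverHom.comp_hom]
  · rw [IsMeet.lift_right, ← h₂, ← Category.assoc, hz.2, OverHom.comp_hom]

/-- Here φ is the arrow X(i,k) ⟶ U(i,i') ∧ X(i',k). The variable of X is one of those being
duplicated, so X cannot be put into the context. Instead X(i',k) ∧ Y is taken as a single conjunct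
over the codomain, which the stability of η allows. -/
theorem isStableAlong_refl {I K : B} {U : Rel p I I}
    {η : (bilData p).Cell (.nil I) (𝟙 I) (𝟙 I) U} (hη : IsStablyOpcart η) {X : p.Fiber (I ⨯ K)}
    {Z : p.Fiber (I ⨯ (I ⨯ K))} {zU : OverHom p (prod.lift prod.fst (prod.snd ≫ prod.fst)) Z U}
    {zX : OverHom p prod.snd Z X} (hZ : IsMeet zU zX) {φ : OverHom p (dup I K) X Z}
    (hU : φ.hom ≫ zU.hom = (unitRefl η X prod.fst).hom) (hX : φ.hom ≫ zX.hom = 𝟙 _)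
    {S T K' : B} {h : S ⟶ I ⨯ K} {g : S ⟶ T} {k : T ⟶ I ⨯ (I ⨯ K)} (κ : T ⟶ K')
    (h₁ : IsProd κ (k ≫ prod.lift prod.fst (prod.snd ≫ prod.fst)))
    (h₂ : IsProd (g ≫ κ) (h ≫ prod.fst)) : IsStableAlong φ h g k := by
  intro Y M N a b c d θ hM hN k₁ k₂
  have hQ := isMeet_meet (k ≫ prod.snd) (𝟙 T) X Y
  have w : h ≫ dup I K = g ≫ k :=
    (OverHom.base_eq (φ := θ.comp c rfl) (ψ := a.comp φ rfl) k₁).symm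
  let e := hQ.lift g a b (by rw [← Category.assoc, ← w, Category.assoc, dup, prod.lift_snd,
    Category.comp_id]) (Category.comp_id g)
  let e' := hQ.lift (𝟙 T) (c.comp zX rfl) d (Category.id_comp _) (Category.id_comp _)
  refine hη (h ≫ prod.fst) g _ κ h₁ h₂ (b := e) (d := e') θ
    (hM.terminal_left hQ e (hQ.lift_left _ _ _ _ _) (hQ.lift_right _ _ _ _ _)
      (terminalLift p M (h ≫ prod.fst)))
    (hZ.assoc hN hQ e' (hQ.lift_left _ _ _ _ _) (hQ.lift_right _ _ _ _ _) (c.comp zU rfl) rfl)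
    ?_ ?_
  · rw [OverHom.comp_hom, ← Category.assoc, k₁, Category.assoc, hU]
    exact comp_unitRefl η a rfl
  · refine hQ.hom_ext (z := θ.comp e' (Category.comp_id _)) ?_ ?_
    · simp only [e, e', OverHom.comp_hom, Category.assoc, IsMeet.lift_left]
      rw [← Category.assoc, k₁, Category.assoc, hX, Category.comp_id]
    · simp [e, e', k₂]

/-- The sum of X along ⟨0,0,1⟩ is U(i,i') ∧ X(i',k): equality conjoined with X. -/
theorem isElementary_of_isComposable (H : (Bil p).IsComposable) : IsElementary p := by
  have key (I K : B) (X : p.Fiber (I ⨯ K)) : ∃ (Z : p.Fiber (I ⨯ (I ⨯ K)))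
      (φ : OverHom p (dup I K) X Z), IsOpcart φ ∧ ∀ {K' : B} (f : K' ⟶ K),
        IsStableAlong φ (prod.map (𝟙 I) f) (dup I K') (prod.map (𝟙 I) (prod.map (𝟙 I) f)) := by
    obtain ⟨U, η, hη⟩ := H (.nil I)
    have hη' := isStablyOpcart_of_isComposing_nil (p := p) (η := η) hη
    have hZ := isMeet_meet (prod.lift prod.fst (prod.snd ≫ prod.fst)) prod.snd U X
    let φ : OverHom p (dup I K) X _ := hZ.lift (dup I K) (unitRefl η X prod.fst) (OverHom.id X)
      (by ext <;> simp [dup]) (by simp [dup])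
    have hφ {K' : B} (f : K' ⟶ K) : IsStableAlong φ (prod.map (𝟙 I) f) (dup I K')
        (prod.map (𝟙 I) (prod.map (𝟙 I) f)) := by
      -- The complementary context is K': I × (I × K') is the product of I × I and K', and I × K'
      -- that of I and K'.
      refine isStableAlong_refl hη' hZ (hZ.lift_left _ _ _ _ _) (hZ.lift_right _ _ _ _ _)
        (K' := K') (prod.snd ≫ prod.snd) ?_ ?_
      · intro A a b
        refine ⟨prod.lift (b ≫ prod.fst) (prod.lift (b ≫ prod.snd) a), ⟨by simp, by ext <;> simp⟩,
          fun u hu => ?_⟩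
        rw [← hu.1, ← hu.2]
        ext <;> simp
      · have e₁ : dup I K' ≫ prod.snd ≫ prod.snd = prod.snd := by simp [dup]
        have e₂ : prod.map (𝟙 I) f ≫ prod.fst = prod.fst := by simp
        rw [e₁, e₂]
        intro A a b
        obtain ⟨u, hu, hu'⟩ := isProd_fst_snd I K' b a
        exact ⟨u, hu.symm, fun u' h => hu' u' h.symm⟩
    refine ⟨_, φ, ?_, hφ⟩
    -- The identity square with conjunct ⊤ returns plain opcartesianness.
    have h := hφ (𝟙 K)
    rw [prod.map_id_id, prod.map_id_id] at h
    exact h (Y := ⊤_ _) (a := OverHom.id X) (b := terminalLift p X _) (c := OverHom.id _)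
      (d := terminalLift p _ (𝟙 _)) φ (isMeet_terminal _ _) (isMeet_terminal _ _)
      ((Category.comp_id _).trans (Category.id_comp _).symm)
      (terminal_hom_ext (φ.comp (terminalLift p _ (𝟙 _)) rfl) _ (Category.comp_id _))
  refine ⟨fun I K => ?_, fun I K' K f => ?_, fun I K => ?_⟩
  · refine isRightAdjoint_baseChange _ fun X => ?_
    obtain ⟨Z, φ, hφ, -⟩ := key I K X
    exact ⟨Z, φ, hφ⟩
  · refine beckChevalley_of_isStableAlong _ fun X => ?_
    obtain ⟨Z, φ, hφ, hφ'⟩ := key I K X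
    exact ⟨Z, φ, hφ, hφ' f⟩
  · refine frobenius_of_isStableAlong fun X => ?_
    obtain ⟨Z, φ, hφ, hφ'⟩ := key I K X
    have h := hφ' (𝟙 K)
    rw [prod.map_id_id, prod.map_id_id] at h
    exact ⟨Z, φ, hφ, h⟩

/-! ### Composites give an existential fibration -/

/-- Transport is natural in the family transported. As for `transport_transportSymm`, the universal
instance X(k,i) ∧ U(i,j) is compared at reflexivity, and the general case follows by substitution.
-/
theorem transport_comp {I : B} {U : Rel p I I} {η : (bilData p).Cell (.nil I) (𝟙 I) (𝟙 I) U}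
    (hη : (Bil p).IsComposing η) {K K' T T' : B} (e : K ⨯ I ⟶ T) (e' : K' ⨯ I ⟶ T') {g : T ⟶ T'}
    {σ : K ⟶ K'} (he : e ≫ g = prod.map σ (𝟙 I) ≫ e') {X : p.Fiber T} {Z : p.Fiber T'}
    (φ : OverHom p g X Z) {S : B} {Γ : p.Fiber S} {k : S ⟶ K} {k' : S ⟶ K'} {i j : S ⟶ I}
    {a c : S ⟶ T} {a' c' : S ⟶ T'} {b : S ⟶ I ⨯ I} (u : OverHom p b Γ U)
    (ha : prod.lift k i ≫ e = a) (hb : prod.lift i j = b) (hc : prod.lift k j ≫ e = c)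
    (ha' : prod.lift k' i ≫ e' = a') (hc' : prod.lift k' j ≫ e' = c') (hk : k ≫ σ = k')
    (x : OverHom p a Γ X) (x' : OverHom p a' Γ Z) (hx : x'.hom = x.hom ≫ φ.hom) :
    (transport hη e' k' i j x' u ha' hb hc').hom =
      (transport hη e k i j x u ha hb hc).hom ≫ φ.hom := by
  let Y₀ : Rel p K I := pull p e X
  let Y₁ : Rel p I (⊤_ B) := ⊤_ _
  obtain ⟨t, θ, -, h₁, h₂, h₃⟩ := exists_single_refl_single Y₀ Y₁ η
  let u₀ : OverHom p _ (conj₃ Y₀ U Y₁) U := (conj₃Snd Y₀ U Y₁).comp (conj₂Fst U Y₁) rfl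
  let x₀ : OverHom p _ (conj₃ Y₀ U Y₁) X := (conj₃Fst Y₀ U Y₁).comp (pullMap p _ X) rfl
  have hb₀ : prod.lift (prod.snd ≫ prod.fst) (prod.snd ≫ prod.snd ≫ prod.fst) =
    (prod.snd ≫ prod.lift prod.fst (prod.snd ≫ prod.fst) : K ⨯ (I ⨯ (I ⨯ (⊤_ B))) ⟶ I ⨯ I) := by
    ext <;> simp
  have he' {A : B} (r : A ⟶ K) (s : A ⟶ I) :
      prod.lift (r ≫ σ) s ≫ e' = (prod.lift r s ≫ e) ≫ g := by
    rw [Category.assoc, he, ← Category.assoc]; congr 1; ext <;> simp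
  let s₀ := transport hη e _ _ _ x₀ u₀ rfl hb₀ rfl
  let s₀' := transport hη e' _ _ _ (x₀.comp φ rfl) u₀ (he' _ _) hb₀ (he' _ _)
  have hu₀ : θ.hom ≫ u₀.hom = (unitRefl η (conj₂ Y₀ Y₁) (prod.snd ≫ prod.fst)).hom := h₂
  have key : s₀'.hom = (s₀.comp φ rfl).hom := by
    refine conj_unit_hom_ext hη Y₀ Y₁ h₁ h₂ h₃ ?_
    refine (comp_transport_refl hη e' θ _ _ _ hu₀).trans ?_
    refine (Category.assoc _ _ _).symm.trans (Eq.trans ?_ (Category.assoc _ _ _))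
    exact congrArg (· ≫ φ.hom) (comp_transport_refl hη e θ _ _ _ hu₀).symm
  let z : OverHom p (prod.lift k (prod.lift i (prod.lift j (terminal.from S)))) Γ
      (conj₃ Y₀ U Y₁) :=
    (isMeet_conj₃ Y₀ U Y₁).lift _ (pullLift p (g := prod.lift k i) ha x)
      ((isMeet_conj₂ U Y₁).lift (prod.lift i (prod.lift j (terminal.from S))) u
        (terminalLift p Γ _)
          (by rw [← hb]; ext <;> simp) rfl) (by ext <;> simp) (by simp)
  have hz : z.hom ≫ x₀.hom = x.hom := by simp [z, x₀, pullLift_fac, Y₀]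
  have hz' : z.hom ≫ u₀.hom = u.hom := by simp [z, u₀]
  refine (comp_transport hη e' z (x := x₀.comp φ rfl) (he' _ _) hb₀ (he' _ _) _ _ _ (by simp [hk])
    ?_ hz').symm.trans ?_
  · rw [hx, ← hz, OverHom.comp_hom, Category.assoc]
  · refine (congrArg (_ ≫ ·) key).trans ((Category.assoc _ _ _).symm.trans (congrArg (· ≫ _) ?_))
    exact comp_transport hη e z _ _ _ _ _ _ (by simp) hz hz'

end

end Fibration

namespace Fibration

attribute [local simp] prod.lift_fst prod.lift_snd prod.lift_fst_assoc prod.lift_snd_assoc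

section

variable {B : Type u₁} [Category.{v₁} B] [HasFiniteProducts B] {E : Type u₂} [Category.{v₂} E]
  {p : E ⥤ B} [IsCartesianFibration p]

/-- The composite of `⊤` and `X` followed by a loose arrow. -/
theorem exists_composite_single {H I J L : B} {A : Rel p H I} {X : Rel p I J} {Z : Rel p H J}
    (κ : (bilData p).Cell (.cons A (.single X)) (𝟙 H) (𝟙 J) Z) (C : Rel p J L) :
    ∃ (t : H ⨯ (I ⨯ (J ⨯ L)) ⟶ H ⨯ (J ⨯ L)) (θ : OverHom p t (conj₃ A X C) (conj₂ Z C))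
      (m : OverHom p (prod.map (𝟙 H) (prod.map (𝟙 I) prod.fst)) (conj₃ A X C) (conj₂ A X)),
      (pathArrow ((Bil p).whisker (.nil H) κ (.single C))).hom = θ.hom ∧
      θ.hom ≫ (conj₂Fst Z C).hom = m.hom ≫ κ.hom ∧
      θ.hom ≫ (conj₂Snd Z C).hom = (conj₃Snd A X C).hom ≫ (conj₂Snd X C).hom ∧
      m.hom ≫ (conj₂Fst A X).hom = (conj₃Fst A X C).hom ∧
      m.hom ≫ (conj₂Snd A X).hom = (conj₃Snd A X C).hom ≫ (conj₂Fst X C).hom := by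
  let s := segInit (p := p) (P := (LPath.cons A (.single X)).append (.single C)) rfl
  refine ⟨_, pathArrow ((Bil p).whisker (.nil H) κ (.single C)), s, rfl,
    whisker_nil_head κ (.single C), ?_, ?_, ?_⟩
  · refine (Category.assoc _ _ _).symm.trans ?_
    refine (congrArg (· ≫ _) (whisker_nil_tail κ (.single C))).trans ?_
    exact (Category.assoc _ _ _).trans (congrArg (_ ≫ ·) ((Category.assoc _ _ _).trans
      (congrArg (_ ≫ ·) (Category.id_comp _))))
  · exact segInit_head rfl
  · refine (Category.assoc _ _ _).symm.trans ((congrArg (· ≫ _)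
      (segInit_tail (P := (LPath.single X).append (.single C)) rfl rfl)).trans ?_)
    exact (Category.assoc _ _ _).trans (congrArg (_ ≫ ·) (segInit_head rfl))

/-- The cell κ is composing for ⊤ : 1 → I followed by X, and φ is κ without the trivial variable.
Whiskering κ by C(j,j') = U(j, f j') ∧ Y(j') gives an arrow θ₀ from X(i,j) ∧ U(j, f j') ∧ Y(j') to
Z(j) ∧ U(j, f j') ∧ Y(j'), up to ⊤. Transport along U and reflexivity exhibit the arrow θ from X(i,
f j') ∧ Y(j') to Z(f j') ∧ Y(j') as a retract of θ₀. -/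
theorem isStableAlong_composite {I J : B} {U : Rel p J J}
    {η : (bilData p).Cell (.nil J) (𝟙 J) (𝟙 J) U} (hη : (Bil p).IsComposing η) {X : Rel p I J}
    {Z : Rel p (⊤_ B) J}
    {κ : (bilData p).Cell (.cons (⊤_ (p.Fiber ((⊤_ B) ⨯ I))) (.single X)) (𝟙 _) (𝟙 J) Z}
    (hκ : (Bil p).IsComposing κ) {x : OverHom p (prod.lift (terminal.from _) (𝟙 (I ⨯ J))) X
      (conj₂ (⊤_ (p.Fiber ((⊤_ B) ⨯ I))) X)} (hx : x.hom ≫ (conj₂Snd _ X).hom = 𝟙 _)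
    {Z' : p.Fiber J} {ζ : OverHom p (prod.lift (terminal.from J) (𝟙 J)) Z' Z} [IsIso ζ.hom]
    {φ : OverHom p prod.snd X Z'} (hφ : φ.hom ≫ ζ.hom = x.hom ≫ κ.hom) {J' : B} (f : J' ⟶ J) :
    IsStableAlong φ (prod.map (𝟙 I) f) prod.snd f := by
  let A : Rel p (⊤_ B) I := ⊤_ _
  intro Y M N a b c d θ hM hN k₁ k₂
  -- The loose arrow U(j, f j') ∧ Y(j'): the graph of f, expressed by the unit, with the conjunct Y.
  let C : Rel p J J' := meet (prod.map (𝟙 J) f) prod.snd U Y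
  let cU : OverHom p _ C U := meetFst _ _ U Y
  let cY : OverHom p _ C Y := meetSnd _ _ U Y
  have hC : IsMeet cU cY := isMeet_meet _ _ U Y
  obtain ⟨t, θ₀, m₀, hθ₀, h₁, h₂, h₃, h₄⟩ := exists_composite_single κ C
  let N₃ := conj₃ A X C
  let x₃ : OverHom p _ N₃ X := (conj₃Snd A X C).comp (conj₂Fst X C) rfl
  have hmx : m₀.hom = x₃.hom ≫ x.hom := by
    refine conj₂_hom_ext (z := m₀) (z' := x₃.comp x rfl) ?_ ?_
    · refine terminal_hom_ext (m₀.comp (conj₂Fst A X) rfl)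
        ((x₃.comp x rfl).comp (conj₂Fst A X) rfl) ?_
      refine Limits.prod.hom_ext (Subsingleton.elim _ _) ?_
      simp
    · refine h₄.trans (Eq.symm ((Category.assoc _ _ _).trans ((congrArg (_ ≫ ·) hx).trans ?_)))
      exact Category.comp_id _
  have hmκ : m₀.hom ≫ κ.hom = x₃.hom ≫ φ.hom ≫ ζ.hom := by
    rw [hφ]
    exact (congrArg (· ≫ κ.hom) hmx).trans (Category.assoc _ _ _)
  let ζ' : OverHom p prod.snd Z Z' := ζ.inv prod.snd (prod.lift_snd _ _)
  -- transport in `X` and in `Z`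
  let c₃ : OverHom p _ N₃ C := (conj₃Snd A X C).comp (conj₂Snd X C) rfl
  let u₃ : OverHom p _ N₃ U := c₃.comp cU rfl
  let y₃ : OverHom p _ N₃ Y := c₃.comp cY rfl
  let i : (⊤_ B) ⨯ (I ⨯ (J ⨯ J')) ⟶ I := prod.snd ≫ prod.fst
  let j : (⊤_ B) ⨯ (I ⨯ (J ⨯ J')) ⟶ J := prod.snd ≫ prod.snd ≫ prod.fst
  let j' : (⊤_ B) ⨯ (I ⨯ (J ⨯ J')) ⟶ J' := prod.snd ≫ prod.snd ≫ prod.snd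
  let s₃ : OverHom p (prod.lift i (j' ≫ f)) N₃ X := transport hη (𝟙 (I ⨯ J)) i j (j' ≫ f) x₃ u₃
    (by ext <;> simp [i, j]) (by ext <;> simp [j, j']) (Category.comp_id _)
  let q : OverHom p (prod.lift i j') N₃ M := hM.lift _ s₃ y₃ (by ext <;> simp)
    (by simp [j'])
  let N₂ := conj₂ Z C
  let z₂ : OverHom p _ N₂ Z' := (conj₂Fst Z C).comp ζ' rfl
  let u₂ : OverHom p _ N₂ U := (conj₂Snd Z C).comp cU rfl
  let y₂ : OverHom p _ N₂ Y := (conj₂Snd Z C).comp cY rfl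
  let l : (⊤_ B) ⨯ (J ⨯ J') ⟶ J := prod.snd ≫ prod.fst
  let l' : (⊤_ B) ⨯ (J ⨯ J') ⟶ J' := prod.snd ≫ prod.snd
  let s₂ : OverHom p (l' ≫ f) N₂ Z' := transport hη (prod.snd : (⊤_ B) ⨯ J ⟶ J) (terminal.from _)
    l (l' ≫ f) z₂ u₂
    (by simp [l]) (by ext <;> simp [l, l']) (by simp)
  let r : OverHom p l' N₂ N := hN.lift l' s₂ y₂ rfl (by simp [l'])
  let s₂' : OverHom p (j' ≫ f) N₃ Z' := transport hη (prod.snd : (⊤_ B) ⨯ J ⟶ J)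
    (terminal.from _) j (j' ≫ f) (x₃.comp φ rfl) u₃ (by simp [j]) (by ext <;> simp [j, j'])
    (by simp)
  -- Transport commutes with the substitution θ₀, and by `e₂` also with φ; so replacing j by f j' in
  -- Z after θ₀ is replacing it in X and then applying φ.
  have e₁ : θ₀.hom ≫ s₂.hom = s₂'.hom := by
    refine comp_transport hη _ θ₀ _ _ _ _ _ _ (Subsingleton.elim _ _) ?_ ?_
    · simp only [z₂, ζ', OverHom.comp_hom, ← Category.assoc, h₁]
      rw [hmκ, Category.assoc, Category.assoc, OverHom.inv_hom, IsIso.hom_inv_id, Category.comp_id]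
    · exact (Category.assoc _ _ _).symm.trans (congrArg (· ≫ cU.hom) h₂)
  have e₂ : s₂'.hom = s₃.hom ≫ φ.hom :=
    transport_comp hη _ _ (σ := terminal.from I) (by simp) φ u₃ _ _ _ _ _ (Subsingleton.elim _ _)
      x₃ (x₃.comp φ rfl) rfl
  have hr : θ₀.hom ≫ r.hom = q.hom ≫ θ.hom := by
    have hd : (θ₀.comp r rfl).hom ≫ d.hom = (q.comp θ rfl).hom ≫ d.hom := by
      simp only [OverHom.comp_hom, Category.assoc, k₂, r, q, IsMeet.lift_right, y₂, y₃, c₃]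
      exact (Category.assoc _ _ _).symm.trans ((congrArg (· ≫ cY.hom) h₂).trans
        (Category.assoc _ _ _))
    have hbase := OverHom.base_eq (φ := (θ₀.comp r rfl).comp d (Category.comp_id _))
      (ψ := (q.comp θ rfl).comp d (Category.comp_id _)) hd
    refine hN.hom_ext (z := θ₀.comp r rfl) (z' := (q.comp θ rfl).rebase hbase.symm) ?_ hd
    simp only [OverHom.comp_hom, OverHom.rebase_hom, Category.assoc, k₁, r, q, IsMeet.lift_left,
      IsMeet.lift_left_assoc]
    refine e₁.trans e₂
  let cN : OverHom p (prod.lift f (𝟙 J')) N C :=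
    hC.lift _ (unitRefl η N f) d (by ext <;> simp) (by simp)
  let n : OverHom p (prod.lift (terminal.from _) (prod.lift f (𝟙 J'))) N N₂ :=
    (isMeet_conj₂ Z C).lift _ (c.comp ζ rfl)
      cN (by ext <;> simp) (by simp)
  have hn : n.hom ≫ r.hom = 𝟙 _ := by
    refine hN.hom_ext (z := n.comp r (by simp [l'])) (z' := OverHom.id N) ?_ ?_
    · simp only [OverHom.comp_hom, Category.assoc, r, IsMeet.lift_left]
      refine (comp_transport_refl (i₀ := f) hη _ n _ _ _ ?_).trans ?_
      · simp [n, cN, u₂]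
      · simp [n, z₂, ζ']
    · simp [r, n, cN, y₂]
  let cM : OverHom p (prod.lift (prod.snd ≫ f) prod.snd) M C :=
    hC.lift _ (unitRefl η M (prod.snd ≫ f)) b (by ext <;> simp) (by simp)
  let m : OverHom p (prod.lift (terminal.from _) (prod.lift prod.fst
      (prod.lift (prod.snd ≫ f) prod.snd))) M N₃ :=
    (isMeet_conj₃ A X C).lift _ (terminalLift p M _) ((isMeet_conj₂ X C).lift
      (prod.lift prod.fst (prod.lift (prod.snd ≫ f) prod.snd)) a
      cM (by ext <;> simp) (by simp)) rfl (by simp)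
  have hmc : m.hom ≫ c₃.hom = cM.hom := by simp [m, c₃]
  have hm : m.hom ≫ θ₀.hom = θ.hom ≫ n.hom := by
    refine conj₂_hom_ext (z := m.comp θ₀ rfl) (z' := θ.comp n rfl) ?_ ?_
    · simp only [OverHom.comp_hom, Category.assoc, h₁, hmκ, n, m, IsMeet.lift_left, x₃,
        IsMeet.lift_left_assoc, IsMeet.lift_right_assoc]
      rw [← Category.assoc, ← Category.assoc, k₁]
    · refine (Category.assoc _ _ _).trans ((congrArg (_ ≫ ·) h₂).trans (hmc.trans (Eq.trans ?_
        ((Category.assoc _ _ _).trans (congrArg (_ ≫ ·)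
          ((isMeet_conj₂ Z C).lift_right _ _ _ _ _))).symm)))
      refine hC.hom_ext (z := cM) (z' := θ.comp cN (by ext <;> simp)) ?_ ?_
      · simp only [cM, cN, OverHom.comp_hom, Category.assoc, IsMeet.lift_left]
        exact (comp_unitRefl η θ rfl).symm
      · simp [cM, cN, k₂]
  have hq : m.hom ≫ q.hom = 𝟙 _ := by
    refine hM.hom_ext (z := m.comp q (by ext <;> simp [i, j'])) (z' := OverHom.id M) ?_ ?_
    · simp only [OverHom.comp_hom, Category.assoc, q, IsMeet.lift_left]
      refine (comp_transport_refl (i₀ := prod.snd ≫ f) hη _ m _ _ _ ?_).trans ?_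
      · simp [m, cM, u₃, c₃]
      · simp [m, x₃]
    · simp [q, m, cM, y₃, c₃]
  -- By `hr`, `hm`, `hn` and `hq`, θ is a retract of θ₀, so its factorisations come from those
  -- through θ₀. The target W over J' is read as a loose arrow 1 → J' to make it admissible for κ.
  refine IsOpcart.of_fiber fun {W} ψ => ?_
  have hν := existsUnique_of_isComposing hκ (.nil _) (.single C) hθ₀ (𝟙 _) (𝟙 _)
    (δ := pull p prod.snd W) (pullLift p (g := prod.lift prod.fst j') (by simp) (q.comp ψ rfl))
    (by
      change _ = prod.lift (prod.fst ≫ 𝟙 _) (((prod.snd : (⊤_ B) ⨯ (I ⨯ (J ⨯ J')) ⟶ _) ≫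
        (prod.snd : I ⨯ (J ⨯ J') ⟶ _) ≫ prod.snd ≫ 𝟙 J') ≫ 𝟙 _)
      simp [j'])
  obtain ⟨ν, hν, huniq⟩ := hν
  have hbase : prod.lift (src ((LPath.nil _).append (.cons Z (.single C))) ≫ 𝟙 _)
      (tgt ((LPath.nil _).append (.cons Z (.single C))) ≫ 𝟙 _) ≫ prod.snd = l' := by
    refine (prod.lift_snd _ _).trans ?_
    change ((prod.snd : (⊤_ B) ⨯ (J ⨯ J') ⟶ _) ≫ (prod.snd : J ⨯ J' ⟶ J') ≫ 𝟙 J') ≫ 𝟙 _ = _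
    simp [l']
  let ν' : OverHom p l' N₂ W := OverHom.comp ν (pullMap p prod.snd W) hbase
  have hν' : θ₀.hom ≫ ν'.hom = q.hom ≫ ψ.hom := by
    refine (Category.assoc _ _ _).symm.trans ((congrArg (· ≫ (pullMap p prod.snd W).hom) hν).trans ?_)
    exact pullLift_fac p _ _
  refine ⟨n.comp ν' (by simp [l']), ?_, fun χ hχ => ?_⟩
  · change θ.hom ≫ n.hom ≫ ν'.hom = _
    rw [← Category.assoc, ← hm, Category.assoc, hν', ← Category.assoc, hq,
      Category.id_comp]
  · have hχ' : r.hom ≫ χ.hom = ν'.hom := by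
      let ρ : OverHom p _ N₂ (pull p prod.snd W) :=
        pullLift p hbase (r.comp χ (Category.comp_id _))
      have e : ρ = ν := huniq ρ (congrArg OverHom.hom (pull_ext p
        (φ := θ₀.comp ρ (OverHom.base_eq (φ := θ₀.comp ν rfl) hν)) ?_))
      · exact (pullLift_fac p _ _).symm.trans (congrArg (fun τ => τ.hom ≫ _) e)
      · refine (Category.assoc _ _ _).trans ((congrArg (_ ≫ ·) (pullLift_fac p _ _)).trans ?_)
        refine Eq.trans ?_ (pullLift_fac p _ _).symm
        refine (Category.assoc _ _ _).symm.trans ((congrArg (· ≫ χ.hom) hr).trans ?_)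
        exact (Category.assoc _ _ _).trans (congrArg (_ ≫ ·) hχ)
    refine OverHom.ext ?_
    change χ.hom = n.hom ≫ ν'.hom
    rw [← hχ', ← Category.assoc, hn, Category.id_comp]

end

end Fibration

namespace Fibration

attribute [local simp] prod.lift_fst prod.lift_snd prod.lift_fst_assoc prod.lift_snd_assoc

section

variable {B : Type u₁} [Category.{v₁} B] [HasFiniteProducts B] {E : Type u₂} [Category.{v₂} E]
  {p : E ⥤ B} [IsCartesianFibration p]

theorem IsStableAlong.isOpcart {S T : B} {g : S ⟶ T} {X : p.Fiber S} {Z : p.Fiber T}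
    {φ : OverHom p g X Z} (h : IsStableAlong φ (𝟙 S) g (𝟙 T)) : IsOpcart φ :=
  h (Y := ⊤_ _) (a := OverHom.id X) (b := terminalLift p X _) (c := OverHom.id _)
    (d := terminalLift p _ (𝟙 _)) φ (isMeet_terminal _ _) (isMeet_terminal _ _)
    ((Category.comp_id _).trans (Category.id_comp _).symm)
    (terminal_hom_ext (φ.comp (terminalLift p _ (𝟙 _)) rfl) _ (Category.comp_id _))

/-- Existential quantification over I is composition with ⊤ : 1 → I, read through J ≅ 1 × J. -/
theorem isExistential_of_isComposable (H : (Bil p).IsComposable) : IsExistential p := by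
  have key (I J : B) (X : p.Fiber (I ⨯ J)) : ∃ (Z : p.Fiber J)
      (φ : OverHom p prod.snd X Z), IsStableAlong φ (𝟙 _) prod.snd (𝟙 J) ∧ ∀ {J' : B} (f : J' ⟶ J),
        IsStableAlong φ (prod.map (𝟙 I) f) prod.snd f := by
    obtain ⟨U, η, hη⟩ := H (.nil J)
    let A : Rel p (⊤_ B) I := ⊤_ _
    obtain ⟨(Z : Rel p (⊤_ B) J), κ, hκ⟩ := H (.cons A (.single X))
    let x : OverHom p (prod.lift (terminal.from _) (𝟙 (I ⨯ J))) X (conj₂ A X) :=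
      (isMeet_conj₂ A X).lift _ (terminalLift p X _) (OverHom.id X) rfl (prod.lift_snd _ _)
    -- The composite is an object over 1 × J; base change along ι turns it into an object over J.
    let ι : J ⟶ (⊤_ B) ⨯ J := prod.lift (terminal.from J) (𝟙 J)
    have : IsIso ι := ⟨prod.snd, prod.lift_snd _ _, by
      refine Limits.prod.hom_ext (Subsingleton.elim _ _) (by simp [ι])⟩
    have hb : (prod.snd : I ⨯ J ⟶ J) ≫ ι = prod.lift (terminal.from _) (𝟙 (I ⨯ J)) ≫
        prod.lift (src (.cons A (.single X)) ≫ 𝟙 _) (tgt (.cons A (.single X)) ≫ 𝟙 _) := by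
      refine Limits.prod.hom_ext (Subsingleton.elim _ _) ?_
      refine Eq.trans ?_ ((Category.assoc _ _ _).trans
        (congrArg (_ ≫ ·) (prod.lift_snd _ _))).symm
      change _ = prod.lift (terminal.from _) (𝟙 (I ⨯ J)) ≫ ((prod.snd : (⊤_ B) ⨯ (I ⨯ J) ⟶ _) ≫
        prod.snd ≫ 𝟙 J) ≫ 𝟙 J
      simp [ι]
    let φ : OverHom p prod.snd X (pull p ι Z) := pullLift p hb (x.comp κ rfl)
    have hφ {J' : B} (f : J' ⟶ J) : IsStableAlong φ (prod.map (𝟙 I) f) prod.snd f :=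
      isStableAlong_composite (p := p) (η := η) hη hκ (IsMeet.lift_right _ _ _ _ _ _)
        (ζ := pullMap p ι Z) (pullLift_fac p _ _) f
    refine ⟨_, φ, ?_, hφ⟩
    have h := hφ (𝟙 J)
    rwa [prod.map_id_id] at h
  refine ⟨fun I J => ?_, fun I J' J f => ?_, fun I J => ?_⟩
  · refine isRightAdjoint_baseChange _ fun X => ?_
    obtain ⟨Z, φ, hφ, -⟩ := key I J X
    exact ⟨Z, φ, hφ.isOpcart⟩
  · refine beckChevalley_of_isStableAlong _ fun X => ?_
    obtain ⟨Z, φ, hφ, hφ'⟩ := key I J X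
    exact ⟨Z, φ, hφ.isOpcart, hφ' f⟩
  · refine frobenius_of_isStableAlong fun X => ?_
    obtain ⟨Z, φ, hφ, -⟩ := key I J X
    exact ⟨Z, φ, hφ.isOpcart, hφ⟩

theorem isElementaryExistential_of_isComposable (H : (Bil p).IsComposable) :
    IsElementaryExistential p :=
  ⟨isElementary_of_isComposable H, isExistential_of_isComposable H⟩

end

end Fibration

namespace Fibration

attribute [local simp] prod.lift_fst prod.lift_snd prod.lift_fst_assoc prod.lift_snd_assoc

section

variable {B : Type u₁} [Category.{v₁} B] [HasFiniteProducts B] {E : Type u₂} [Category.{v₂} E]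
  {p : E ⥤ B} [IsCartesianFibration p]

/-! ### Stably opcartesian arrows in elementary existential fibrations -/

theorem IsProd.symm {R K T : B} {k : R ⟶ K} {q : R ⟶ T} (H : IsProd k q) : IsProd q k :=
  fun _ a b => by
    obtain ⟨u, hu, hu'⟩ := H b a
    exact ⟨u, hu.symm, fun u' h => hu' u' h.symm⟩

/-- A variable I added to both R and T leaves K as the complementary factor. -/
theorem IsProd.map_id {R K T : B} {k : R ⟶ K} {q : R ⟶ T} (H : IsProd k q) (I : B) :
    IsProd (prod.snd ≫ k : I ⨯ R ⟶ K) (prod.map (𝟙 I) q) := by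
  intro A a b
  obtain ⟨u, ⟨h₁, h₂⟩, hu⟩ := H a (b ≫ prod.snd)
  refine ⟨prod.lift (b ≫ prod.fst) u, ⟨by simp [h₁], by ext <;> simp [h₂]⟩, fun u' hu' => ?_⟩
  refine Limits.prod.hom_ext ?_ ?_
  · rw [prod.lift_fst, ← hu'.2]; simp
  · rw [prod.lift_snd]
    refine hu _ ⟨by rw [Category.assoc, hu'.1], ?_⟩
    rw [← hu'.2]; simp

/-- The context K is absorbed into the parameter J: Beck–Chevalley is used along K × J ⟶ J, and
Frobenius reciprocity for I × (K × J) ⟶ K × J. -/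
theorem exists_isStablyOpcart_snd (H : IsExistential p) {I J : B} (X : p.Fiber (I ⨯ J)) :
    ∃ (Z : p.Fiber J) (φ : OverHom p prod.snd X Z), IsStablyOpcart φ := by
  have := H.isRightAdjoint I J
  refine ⟨_, ofPull p ((Adjunction.ofIsRightAdjoint (baseChange p prod.snd)).unit.app X),
    .of_forall_context fun K => ⟨_, K ⨯ J, prod.map (𝟙 I) prod.snd, prod.snd, prod.snd, prod.fst,
      isProd_fst_snd K J, (isProd_fst_snd K J).map_id I, snd_natural I prod.snd, ?_⟩⟩
  exact isStableAlong_unit (snd_natural I prod.snd) (H.beckChevalley I _) (H.frobenius I _)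
    (H.isRightAdjoint I _) _ X

/-- As for projections, the context K is absorbed into the parameter, L becoming K × L. -/
theorem exists_isStablyOpcart_dup (H : IsElementary p) {I L : B} (X : p.Fiber (I ⨯ L)) :
    ∃ (Z : p.Fiber (I ⨯ (I ⨯ L))) (φ : OverHom p (dup I L) X Z), IsStablyOpcart φ := by
  have := H.isRightAdjoint I L
  refine ⟨_, ofPull p ((Adjunction.ofIsRightAdjoint (baseChange p (dup I L))).unit.app X),
    .of_forall_context fun K => ⟨_, I ⨯ (I ⨯ (K ⨯ L)), prod.map (𝟙 I) prod.snd, dup I _,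
      prod.map (𝟙 I) (prod.map (𝟙 I) prod.snd), prod.snd ≫ prod.snd ≫ prod.fst,
      ((isProd_fst_snd K L).map_id I).map_id I, ?_, dup_natural I prod.snd, ?_⟩⟩
  · have h : dup I (K ⨯ L) ≫ prod.snd ≫ prod.snd ≫ prod.fst = prod.snd ≫ prod.fst := by simp [dup]
    rw [h]
    exact (isProd_fst_snd K L).map_id I
  · exact isStableAlong_unit (dup_natural I prod.snd) (H.beckChevalley I _) (H.frobenius I _)
      (H.isRightAdjoint I _) _ X

theorem exists_isStablyOpcart_of_iso {S T S' T' : B} {g : S ⟶ T} {g' : S' ⟶ T'}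
    (H : ∀ X : p.Fiber S, ∃ (Z : p.Fiber T) (φ : OverHom p g X Z), IsStablyOpcart φ) (e : S' ≅ S)
    (r : T ≅ T') (w : e.hom ≫ g ≫ r.hom = g') (X : p.Fiber S') :
    ∃ (Z : p.Fiber T') (φ : OverHom p g' X Z), IsStablyOpcart φ := by
  obtain ⟨Z, φ, hφ⟩ := H (pull p e.inv X)
  exact ⟨pull p r.inv Z, _,
    (IsStablyOpcart.of_isIso ((pullMap p e.inv X).inv e.hom e.inv_hom_id)).comp (hφ.comp
      (IsStablyOpcart.of_isIso ((pullMap p r.inv Z).inv r.hom r.inv_hom_id)) rfl) w⟩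

theorem exists_isStablyOpcart_diag (H : IsElementary p) {I : B} (X : p.Fiber I) :
    ∃ (Z : p.Fiber (I ⨯ I)) (φ : OverHom p (prod.lift (𝟙 I) (𝟙 I)) X Z), IsStablyOpcart φ :=
  exists_isStablyOpcart_of_iso (exists_isStablyOpcart_dup H (I := I) (L := ⊤_ B))
    ⟨prod.lift (𝟙 I) (terminal.from I), prod.fst, by simp, Limits.prod.hom_ext (by simp)
      (Subsingleton.elim _ _)⟩
    ⟨prod.lift prod.fst (prod.snd ≫ prod.fst),
      prod.lift prod.fst (prod.lift prod.snd (terminal.from _)),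
      Limits.prod.hom_ext (by simp) (Limits.prod.hom_ext (by simp) (Subsingleton.elim _ _)),
      by ext <;> simp⟩ (by ext <;> simp [dup]) X

/-- Forgetting the middle variable is a product projection after a permutation of the variables. -/
theorem exists_isStablyOpcart_outer (H : IsExistential p) {I J K : B}
    (X : p.Fiber (I ⨯ (J ⨯ K))) : ∃ (Z : p.Fiber (I ⨯ K))
      (φ : OverHom p (prod.lift prod.fst (prod.snd ≫ prod.snd)) X Z), IsStablyOpcart φ :=
  exists_isStablyOpcart_of_iso (exists_isStablyOpcart_snd H (I := J) (J := I ⨯ K))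
    ⟨prod.lift (prod.snd ≫ prod.fst) (prod.lift prod.fst (prod.snd ≫ prod.snd)),
      prod.lift (prod.snd ≫ prod.fst) (prod.lift prod.fst (prod.snd ≫ prod.snd)),
      by ext <;> simp, by ext <;> simp⟩ (Iso.refl _) (by simp) X

theorem IsStablyOpcart.rebase {S T : B} {g g' : S ⟶ T} {X : p.Fiber S} {Z : p.Fiber T}
    {φ : OverHom p g X Z} (H : IsStablyOpcart φ) (h : g = g') : IsStablyOpcart (φ.rebase h) := by
  subst h; exact H

/-! ### Composites of paths -/

/-- The unit is the sum of ⊤ along the diagonal. For α followed by P, the path P is first composed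
to γ in the presence of α, and the middle variable of α ∧ γ is then summed out. Both arrows are
stably opcartesian, hence so is their composite. -/
theorem exists_isStablyOpcart_path (H : IsElementaryExistential p) {I J : B}
    (P : LPath (Rel p) I J) : ∃ (γ : Rel p I J) (κ : (bilData p).Cell P (𝟙 I) (𝟙 J) γ),
      IsStablyOpcart κ := by
  induction P with
  | nil I =>
    obtain ⟨U, φ, hφ⟩ := exists_isStablyOpcart_diag H.elementary (⊤_ (p.Fiber I))
    have e : prod.lift (𝟙 I) (𝟙 I) = prod.lift (𝟙 I ≫ 𝟙 I) (𝟙 I ≫ 𝟙 I) := by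
      rw [Category.comp_id]
    exact ⟨U, φ.rebase e, hφ.rebase e⟩
  | @cons I J K α P ih =>
    obtain ⟨γ, κ, hκ⟩ := ih
    obtain ⟨δ, φ, hφ⟩ := exists_isStablyOpcart_outer H.existential (conj₂ α γ)
    have h₁ : prod.map (𝟙 I) (prod.lift (src P ≫ 𝟙 _) (tgt P ≫ 𝟙 _)) ≫
        prod.lift prod.fst (prod.snd ≫ prod.fst) = headBase α P := by
      change _ = (prod.lift prod.fst (prod.snd ≫ src P) : I ⨯ ctx P ⟶ I ⨯ J)
      ext <;> simp
    have h₂ : IsProd (prod.map (𝟙 I) (prod.lift (src P ≫ 𝟙 _) (tgt P ≫ 𝟙 _)) ≫ prod.fst)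
        (tailBase α P) := by
      rw [prod.map_fst, Category.comp_id]
      exact isProd_fst_snd _ _
    have h₃ : prod.map (𝟙 I) (prod.lift (src P ≫ 𝟙 _) (tgt P ≫ 𝟙 _)) ≫
        prod.lift prod.fst (prod.snd ≫ prod.snd) =
          prod.lift (src (.cons α P) ≫ 𝟙 _) (tgt (.cons α P) ≫ 𝟙 _) := by
      change _ = (prod.lift (prod.fst ≫ 𝟙 _) ((prod.snd ≫ tgt P) ≫ 𝟙 _) : I ⨯ ctx P ⟶ I ⨯ K)
      ext <;> simp
    -- The composing cell of P with the first object of the path as context and α as conjunct.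
    let θ : OverHom p (prod.map (𝟙 I) (prod.lift (src P ≫ 𝟙 _) (tgt P ≫ 𝟙 _)))
        (conj (.cons α P)) (conj₂ α γ) := (isMeet_conj₂ α γ).lift _ (conjHead α P)
          ((conjTail α P).comp κ rfl) h₁ (prod.map_snd _ _)
    have hθ : IsStablyOpcart θ := hκ.whisker prod.fst (isProd_fst_snd _ _) h₂ θ
      (isMeet_conj α P).symm (isMeet_conj₂ α γ).symm (IsMeet.lift_right _ _ _ _ _ _)
        (IsMeet.lift_left _ _ _ _ _ _)
    exact ⟨δ, θ.comp φ h₃, hθ.comp hφ _⟩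

/-! ### Stably opcartesian cells are composing -/

/-- Splits off the first object of a path. The other factor is the context that a path contributes
when it is composed on the right. -/
theorem exists_isProd_src {I J : B} (P : LPath (Rel p) I J) :
    ∃ (K : B) (κ : ctx P ⟶ K), IsProd κ (src P) := by
  cases P with
  | nil I => exact ⟨_, _, isProd_terminal I⟩
  | cons α P => exact ⟨_, _, (isProd_fst_snd _ _).symm⟩

/-- The last object of P is the first of C; what remains of C is the complement of the objects of P.
-/
theorem isProd_initBase {I J K L : B} (P : LPath (Rel p) I J) (C : LPath (Rel p) J K)
    {κ : ctx C ⟶ L} (h : IsProd κ (src C)) : IsProd (finBase P C ≫ κ) (initBase P C) := by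
  induction P with
  | nil I =>
    change IsProd (𝟙 _ ≫ κ) (src C)
    rwa [Category.id_comp]
  | @cons I J K α P ih =>
    change IsProd ((prod.snd ≫ finBase P C) ≫ κ) (prod.map (𝟙 I) (initBase P C))
    rw [Category.assoc]
    exact (ih C h).map_id I

theorem isMeet_conjInit {I J K : B} (P : LPath (Rel p) I J) (C : LPath (Rel p) J K) :
    IsMeet (conjInit P C) (conjFin P C) := by
  induction P with
  | nil I => exact (isMeet_terminal (OverHom.id (conj C)) (terminalLift p (conj C) (src C))).symm
  | cons α P ih =>
    exact ((ih C).symm.assoc (isMeet_conj α (P.append C)).symm (isMeet_conj α P).symm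
      (conjInit (.cons α P) C) (conjLift_tail _ _ _ _) (conjLift_head _ _ _ _)
      (conjFin (.cons α P) C) rfl).symm

/-- Whiskering adds context and conjuncts. On the right, C contributes its objects beyond the first
as context and its conjunction as conjunct. On the left, each member of A contributes one object and
one conjunct, by recursion. -/
theorem isStablyOpcart_whisker {H I J K : B} (A : LPath (Rel p) H I) {P : LPath (Rel p) I J}
    {γ : Rel p I J} {κ : (bilData p).Cell P (𝟙 I) (𝟙 J) γ} (hκ : IsStablyOpcart κ)
    (C : LPath (Rel p) J K) : IsStablyOpcart (pathArrow ((Bil p).whisker A κ C)) := by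
  induction A with
  | nil I =>
    obtain ⟨L, l, hl⟩ := exists_isProd_src C
    refine hκ.whisker (h := initBase P C) (k := headBase γ C) (prod.snd ≫ l) ?_ ?_
      (pathArrow ((Bil p).whisker (.nil I) κ C)) (isMeet_conjInit P C) (isMeet_conj γ C)
      (whisker_nil_head κ C) (whisker_nil_tail κ C)
    · have e : headBase γ C = prod.map (𝟙 _) (src C) := by
        refine Limits.prod.hom_ext ((prod.lift_fst _ _).trans ?_) ((prod.lift_snd _ _).trans ?_)
        · exact ((prod.map_fst _ _).trans (Category.comp_id _)).symm
        · exact (prod.map_snd _ _).symm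
      rw [e]
      exact hl.map_id _
    · have e := OverHom.base_eq (φ := OverHom.comp _ (conjTail γ C) rfl) (ψ := conjFin P C)
        (whisker_nil_tail κ C)
      have e' : pathBase ((Bil p).whisker (.nil I) κ C) ≫ prod.snd ≫ l = finBase P C ≫ l :=
        (Category.assoc _ _ _).symm.trans (congrArg (· ≫ l) e)
      exact (congrArg (fun x => IsProd x (initBase P C)) e').mpr (isProd_initBase P C hl)
  | cons α A ih =>
    have h := OverHom.base_eq (φ := OverHom.comp _ (conjHead α (A.append (.cons γ C))) rfl)
      (whisker_cons_head κ C α A)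
    refine (ih hκ).whisker (h := tailBase α _) (k := tailBase α _) prod.fst (isProd_fst_snd _ _)
      ?_ (pathArrow ((Bil p).whisker (.cons α A) κ C)) (isMeet_conj α (A.append (P.append C))).symm
      (isMeet_conj α (A.append (.cons γ C))).symm (whisker_cons_tail κ C α A)
      (whisker_cons_head κ C α A)
    have e₁ : headBase α (A.append (.cons γ C)) ≫ prod.fst = prod.fst := prod.lift_fst _ _
    have e₂ : headBase α (A.append (P.append C)) ≫ prod.fst = prod.fst := prod.lift_fst _ _
    have e : pathBase ((Bil p).whisker (.cons α A) κ C) ≫ prod.fst = prod.fst :=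
      (congrArg (pathBase ((Bil p).whisker (.cons α A) κ C) ≫ ·) e₁.symm).trans
        ((Category.assoc _ _ _).symm.trans ((congrArg (· ≫ prod.fst) h).trans e₂))
    exact (congrArg (fun x => IsProd x (tailBase α (A.append (P.append C)))) e).mpr
      (isProd_fst_snd _ _)

theorem pathBase_comp_sides {I I' J J' K K' : B} {P : LPath (Rel p) I I'} {Q : LPath (Rel p) J J'}
    {s : I ⟶ J} {t : I' ⟶ J'} (Ξ : VDCData.CellPath (bilData p) P Q s t) {f : J ⟶ K} {g : J' ⟶ K'}
    {a : I ⟶ K} {b : I' ⟶ K'} (ha : s ≫ f = a) (hb : t ≫ g = b) :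
    pathBase Ξ ≫ prod.lift (src Q ≫ f) (tgt Q ≫ g) = prod.lift (src P ≫ a) (tgt P ≫ b) := by
  subst ha hb
  refine lift_sides _ ?_ ?_
  · exact ((Category.assoc _ _ _).symm.trans ((congrArg (· ≫ f) (pathBase_src Ξ)).trans
      (Category.assoc _ _ _))).symm
  · exact (Category.assoc _ _ _).symm.trans ((congrArg (· ≫ g) (pathBase_tgt Ξ)).trans
      (Category.assoc _ _ _))

/-- Whiskering by κ has identity sides, so the projection of the long path to its outer objects
factors through that of the short one. Factoring a cell is therefore factoring an arrow through the
opcartesian whiskered arrow. -/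
theorem isComposing_of_isStablyOpcart {I J : B} {P : LPath (Rel p) I J}
    {γ : Rel p I J} {κ : (bilData p).Cell P (𝟙 I) (𝟙 J) γ} (hκ : IsStablyOpcart κ) :
    (Bil p).IsComposing κ := by
  have key {H K H' K' : B} (A : LPath (Rel p) H I) (C : LPath (Rel p) J K) (f : H ⟶ H')
      (g : K ⟶ K') (δ : Rel p H' K') (ν : (bilData p).Cell (A.append (P.append C)) f g δ) :
      ∃! ν' : (bilData p).Cell (A.append (.cons γ C)) f g δ,
        bilComp p ((Bil p).whisker A κ C) ν' (Category.id_comp f) (Category.id_comp g) = ν := by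
    obtain ⟨χ, hχ, hχ'⟩ := (isStablyOpcart_whisker A hκ C).isOpcart _ ν
      (pathBase_comp_sides ((Bil p).whisker A κ C) (Category.id_comp f) (Category.id_comp g))
    exact ⟨χ, OverHom.ext hχ, fun χ' h => hχ' χ' (congrArg OverHom.hom h)⟩
  intro H K H' K' A C f g δ ν
  exact key A C f g δ ν

theorem isComposable_of_isElementaryExistential (H : IsElementaryExistential p) :
    (Bil p).IsComposable := fun P => by
  obtain ⟨γ, κ, hκ⟩ := exists_isStablyOpcart_path H P
  exact ⟨γ, κ, isComposing_of_isStablyOpcart hκ⟩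

/-- A one-term conjunction is its member conjoined with ⊤. This identifies cells out of a single
loose arrow with arrows out of the object itself. -/
theorem isIso_conjHead {I J : B} (γ : Rel p I J) : IsIso (conjHead γ (.nil J)).hom := by
  have e : headBase γ (.nil J) = 𝟙 (I ⨯ J) := by
    refine Limits.prod.hom_ext ?_ ?_
    · exact (prod.lift_fst _ _).trans (Category.id_comp _).symm
    · exact (prod.lift_snd _ _).trans ((Category.comp_id _).trans (Category.id_comp _).symm)
  have H : IsMeet (OverHom.id γ) (terminalLift p γ prod.snd) := isMeet_terminal _ _
  have H' := isMeet_conj γ (.nil J)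
  let z : OverHom p (𝟙 (I ⨯ J)) (conj (.cons γ (.nil J))) γ := (conjHead γ (.nil J)).rebase e
  have H'' : IsMeet z (conjTail γ (.nil J)) := by
    intro R u N q' r' x y hq hr
    exact H' u x y ((congrArg (u ≫ ·) e).trans hq) hr
  exact H.isIso H'' z (Category.comp_id _) (terminal_hom_ext (z.comp (terminalLift p γ prod.snd) rfl)
    (conjTail γ (.nil J)) (Category.id_comp _))

/-- A cell through which all cells with the same domain factor uniquely is stably opcartesian. -/
theorem isStablyOpcart_of_existsUnique (H : IsElementaryExistential p) {I J : B}
    {P : LPath (Rel p) I J} {γ : Rel p I J} (κ : (bilData p).Cell P (𝟙 I) (𝟙 J) γ)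
    {R : LPath (Rel p) I J} (h : R = P.append (.nil J))
    (hκ : ∀ (W : Rel p I J) (ψ : (bilData p).Cell R (𝟙 I) (𝟙 J) W),
      ∃! χ : (bilData p).Cell (.single γ) (𝟙 I) (𝟙 J) W,
        (pathArrow (p := p) (.cons κ (.nil (D := bilData p) (𝟙 J)) h)).hom ≫ χ.hom = ψ.hom) :
    IsStablyOpcart κ := by
  obtain rfl : R = P := h.trans P.append_nil
  obtain ⟨γ₀, κ₀, h₀⟩ := exists_isStablyOpcart_path H R
  have := isIso_conjHead γ
  have e : (pathArrow (p := p) (.cons κ (.nil (D := bilData p) (𝟙 J)) h)).hom ≫ (conjHead γ (.nil J)).hom =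
      κ.hom :=
    (pathArrow_head _ _ _).trans ((congrArg (· ≫ κ.hom) (segInit_nil h)).trans (Category.id_comp _))
  have e₁ : headBase γ (.nil J) = prod.lift (src (.single γ) ≫ 𝟙 I) (tgt (.single γ) ≫ 𝟙 J) := by
    rw [Category.comp_id, Category.comp_id]; rfl
  have e₂ : headBase γ (.nil J) = 𝟙 (I ⨯ J) := Limits.prod.hom_ext
    ((prod.lift_fst _ _).trans (Category.id_comp _).symm)
    ((prod.lift_snd _ _).trans ((Category.comp_id _).trans (Category.id_comp _).symm))
  -- A stably opcartesian cell κ₀ with the same domain exists, so it is enough that κ be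
  -- opcartesian. For that, the hypothesis is freed of the one-term conjunction.
  refine h₀.of_isOpcart (IsOpcart.of_fiber fun {W} ψ => ?_)
  obtain ⟨χ, hχ, hχ'⟩ := hκ W ψ
  refine ⟨((conjHead γ (.nil J)).inv (𝟙 _) ((Category.comp_id _).trans e₂)).comp χ
    ((Category.id_comp _).trans (e₁.symm.trans e₂)), ?_, fun χ₁ h₁ => OverHom.ext ?_⟩
  · rw [← e, ← hχ]
    exact (Category.assoc _ _ _).trans (congrArg (_ ≫ ·)
      (IsIso.hom_inv_id_assoc (conjHead γ (.nil J)).hom χ.hom))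
  · have := hχ' ((conjHead γ (.nil J)).comp χ₁ ((Category.comp_id _).trans e₁)) (by
      refine (Category.assoc _ _ _).symm.trans ((congrArg (· ≫ χ₁.hom) e).trans h₁))
    rw [← this]
    exact (IsIso.inv_hom_id_assoc (conjHead γ (.nil J)).hom χ₁.hom).symm

end

end Fibration

namespace Fibration

section

variable {B : Type u₁} [Category.{v₁} B] [HasFiniteProducts B] {E : Type u₂} [Category.{v₂} E]
  {p : E ⥤ B} [IsCartesianFibration p]

/-! ### Restrictions in `Bil[p]` -/

theorem single_comp_hom {I I' J J' : B} {P : LPath (Rel p) I I'} {s : I ⟶ J} {t : I' ⟶ J'}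
    {β : Rel p J J'} (ξ : (bilData p).Cell P s t β) :
    (pathArrow (p := p) (.single (D := bilData p) ξ)).hom ≫ (conjHead β (.nil J')).hom =
      ξ.hom :=
  (pathArrow_head _ _ _).trans ((congrArg (· ≫ ξ.hom) (segInit_nil _)).trans (Category.id_comp _))

/-- An arrow `α' ⟶ α` over `f × g` as a cell. -/
noncomputable def cellOf {I' J' I J : B} {α' : Rel p I' J'} {f : I' ⟶ I} {g : J' ⟶ J}
    {α : Rel p I J} (r : OverHom p (prod.map f g) α' α) : (bilData p).Cell (.single α') f g α :=
  (conjHead α' (.nil J')).comp r (by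
    change (prod.lift prod.fst (prod.snd ≫ 𝟙 J') : I' ⨯ J' ⟶ _) ≫ _ =
      prod.lift (prod.fst ≫ f) ((prod.snd ≫ 𝟙 J') ≫ g)
    ext <;> simp)

theorem comp_cellOf {I' J' I J K K' : B} {α' : Rel p I' J'} {f : I' ⟶ I} {g : J' ⟶ J}
    {α : Rel p I J} (r : OverHom p (prod.map f g) α' α) {P : LPath (Rel p) K K'} {h : K ⟶ I'}
    {k : K' ⟶ J'} (ξ : (bilData p).Cell P h k α') :
    (pathArrow (p := p) (.single (D := bilData p) ξ)).hom ≫ (cellOf r).hom = ξ.hom ≫ r.hom :=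
  (Category.assoc _ _ _).symm.trans (congrArg (· ≫ r.hom) (single_comp_hom ξ))

theorem exists_cellOf {I' J' I J : B} {α' : Rel p I' J'} {f : I' ⟶ I} {g : J' ⟶ J}
    {α : Rel p I J} (ρ : (bilData p).Cell (.single α') f g α) :
    ∃ r : OverHom p (prod.map f g) α' α, cellOf r = ρ := by
  have := isIso_conjHead α'
  have e : headBase α' (.nil J') = 𝟙 (I' ⨯ J') := Limits.prod.hom_ext
    ((prod.lift_fst _ _).trans (Category.id_comp _).symm)
    ((prod.lift_snd _ _).trans ((Category.comp_id _).trans (Category.id_comp _).symm))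
  refine ⟨((conjHead α' (.nil J')).inv (𝟙 _) ((Category.comp_id _).trans e)).comp ρ ?_,
    OverHom.ext ?_⟩
  · change 𝟙 _ ≫ (prod.lift (prod.fst ≫ f) ((prod.snd ≫ 𝟙 J') ≫ g) : I' ⨯ J' ⟶ _) = _
    ext <;> simp
  · exact IsIso.hom_inv_id_assoc (conjHead α' (.nil J')).hom ρ.hom

/-- The sides (h ≫ f, k ≫ g) of a cell amount to the base arrow of (h, k) followed by f × g, so the
universal property of a restriction is an instance of that of a cartesian arrow. -/
theorem isRestriction_cellOf {I' J' I J : B} {α' : Rel p I' J'} {f : I' ⟶ I} {g : J' ⟶ J}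
    {α : Rel p I J} (r : OverHom p (prod.map f g) α' α)
    [p.IsStronglyCartesian (prod.map f g) r.hom] :
    (Bil p).IsRestriction (α' := α') (f := f) (g := g) (α := α) (cellOf r) := by
  have key {K K' : B} (P : LPath (Rel p) K K') (h : K ⟶ I') (k : K' ⟶ J')
      (ξ : (bilData p).Cell P (h ≫ f) (k ≫ g) α) : ∃! ξ' : (bilData p).Cell P h k α',
        bilComp p (.single (D := bilData p) ξ') (cellOf r) rfl rfl = ξ := by
    have e : prod.lift (src P ≫ h ≫ f) (tgt P ≫ k ≫ g) =
        prod.lift (src P ≫ h) (tgt P ≫ k) ≫ prod.map f g := by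
      ext <;> simp
    have h₁ := Functor.IsStronglyCartesian.fac p (prod.map f g) r.hom e ξ.hom
    refine ⟨⟨Functor.IsStronglyCartesian.map p (prod.map f g) r.hom e ξ.hom, inferInstance⟩,
      OverHom.ext ((comp_cellOf r _).trans h₁), fun ξ' h' => OverHom.ext ?_⟩
    refine Functor.IsStronglyCartesian.ext p (prod.map f g) r.hom (prod.lift (src P ≫ h) (tgt P ≫ k)) ?_
    exact (comp_cellOf r _).symm.trans ((congrArg OverHom.hom h').trans h₁.symm)
  intro K K' P h k ξ
  exact key P h k ξ

variable (p) in
theorem isFibrational_bil : (Bil p).IsFibrational := by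
  have key {I' J' I J : B} (f : I' ⟶ I) (g : J' ⟶ J) (α : Rel p I J) :
      ∃ (α' : Rel p I' J') (ρ : (bilData p).Cell (.single α') f g α),
        (Bil p).IsRestriction (α' := α') (f := f) (g := g) (α := α) ρ :=
    ⟨_, _, isRestriction_cellOf (pullMap p (prod.map f g) α)⟩
  intro I' J' I J f g α
  exact key f g α

/-- An arrow is cartesian if arrows over the same arrow of the base factor uniquely through it. -/
theorem isStronglyCartesian_of_existsUnique {S T : B} {u : S ⟶ T} {X : p.Fiber S} {Y : p.Fiber T}
    (r : OverHom p u X Y) (H : ∀ {W : p.Fiber S} (ψ : OverHom p u W Y),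
      ∃! χ : OverHom p (𝟙 S) W X, χ.hom ≫ r.hom = ψ.hom) : p.IsStronglyCartesian u r.hom := by
  obtain ⟨χ, hχ, -⟩ := H (pullMap p u Y)
  have h₁ := pullLift_fac p (Category.id_comp u) r
  set χ' := pullLift p (Category.id_comp u) r
  have e : r.hom = χ'.hom ≫ (pullMap p u Y).hom := h₁.symm
  have : IsIso χ'.hom := by
    refine ⟨χ.hom, ?_, ?_⟩
    · refine congrArg OverHom.hom ((H r).unique (y₁ := χ'.comp χ (Category.comp_id _))
        (y₂ := OverHom.id X) ?_ (Category.id_comp _))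
      rw [OverHom.comp_hom, Category.assoc, hχ, h₁]
    · refine congrArg OverHom.hom (pull_ext p (φ := χ.comp χ' (Category.comp_id _))
        (ψ := OverHom.id _) ?_)
      rw [OverHom.comp_hom, Category.assoc, h₁, hχ]
      exact (Category.id_comp _).symm
  rw [e]
  have : p.IsStronglyCartesian (𝟙 S) χ'.hom := inferInstance
  have := Functor.IsStronglyCartesian.comp (p := p) (f := 𝟙 S) (g := u) (φ := χ'.hom)
    (ψ := (pullMap p u Y).hom)
  simpa using this

/-! ### The terminal object -/

section

variable (p)

/-- The functor that picks out the terminal loose arrow. -/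
noncomputable def bilTerminal : VDC.Functor VDC.terminal.{u₁, v₁, u₂, v₂} (Bil p) where
  tight :=
    { obj := fun _ => (⊤_ B : B)
      map := fun _ => 𝟙 (⊤_ B)
      map_id := fun _ => rfl
      map_comp := fun _ _ => (Category.comp_id (𝟙 (⊤_ B))).symm }
  loose _ := ⊤_ (p.Fiber ((⊤_ B) ⨯ (⊤_ B)))
  cell _ := terminalLift p _ _
  map_id _ := terminal_overHom_ext p _ _
  map_comp _ _ := terminal_overHom_ext p _ _

/-- There is exactly one arrow into ⊤ over each arrow of the base, so every cell into the terminal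
loose arrow is a restriction. -/
theorem bilTerminal_preservesRestrictions : (bilTerminal p).PreservesRestrictions := by
  intro I' J' I J α' f g α ρ _ K K' P h k ξ
  let e : (bilData p).Cell P h k (⊤_ (p.Fiber ((⊤_ B) ⨯ (⊤_ B)))) := terminalLift p _ _
  exact ⟨e, terminal_overHom_ext p _ _, fun _ _ => terminal_overHom_ext p _ _⟩

variable {p} in
/-- The image of a path under the functor that picks out the terminal loose arrow. -/
noncomputable abbrev terminalPath {I J : VDC.terminal.{u₁, v₁, u₂, v₂}.Obj}
    (P : LPath VDC.terminal.{u₁, v₁, u₂, v₂}.Loose I J) : LPath (Rel p) (⊤_ B) (⊤_ B) :=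
  P.map (bilTerminal p).tight.obj (bilTerminal p).loose

variable {p} in
-- Together with `bilTerminal_hom_ext`: the conjunction of a path of terminal loose arrows on 1 is a
-- terminal object of the total category.
theorem exists_overHom_bilTerminal {I J : VDC.terminal.{u₁, v₁, u₂, v₂}.Obj}
    (P : LPath VDC.terminal.{u₁, v₁, u₂, v₂}.Loose I J) {S : B} (X : p.Fiber S) :
    ∃ u : S ⟶ ctx (terminalPath (p := p) P),
      Nonempty (OverHom p u X (conj (terminalPath (p := p) P))) := by
  induction P with
  | nil I => exact ⟨terminal.from S, ⟨terminalLift p X (terminal.from S)⟩⟩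
  | cons α P ih =>
    obtain ⟨u, ⟨φ⟩⟩ := ih
    exact ⟨prod.lift (terminal.from S) u, ⟨conjLift (I := ⊤_ B) (J := ⊤_ B) (K := ⊤_ B)
      (α := ⊤_ (p.Fiber ((⊤_ B) ⨯ (⊤_ B)))) (P := terminalPath P) _ (terminalLift p X _) φ rfl
      (prod.lift_snd _ _)⟩⟩

variable {p} in
theorem bilTerminal_hom_ext {I J : VDC.terminal.{u₁, v₁, u₂, v₂}.Obj}
    (P : LPath VDC.terminal.{u₁, v₁, u₂, v₂}.Loose I J) {S : B} {X : p.Fiber S}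
    {u u' : S ⟶ ctx (terminalPath (p := p) P)}
    (φ : OverHom p u X (conj (terminalPath (p := p) P)))
    (φ' : OverHom p u' X (conj (terminalPath (p := p) P))) :
    φ.hom = φ'.hom := by
  induction P with
  | nil I => exact terminal_hom_ext φ φ' (terminal.hom_ext (P := S) u u')
  | cons α P ih =>
    exact conjCons_ext (φ := φ) (ψ := φ')
      (terminal_hom_ext (φ.comp (conjHead _ _) rfl) (φ'.comp (conjHead _ _) rfl)
        (Limits.prod.hom_ext (terminal.hom_ext _ _) (terminal.hom_ext _ _)))
      (ih (φ.comp (conjTail _ _) rfl) (φ'.comp (conjTail _ _) rfl))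

/-- A cell from such a path to the terminal loose arrow is an arrow between terminal objects, hence
invertible and stably opcartesian. -/
theorem bilTerminal_preservesComposites : (bilTerminal p).PreservesComposites := by
  intro I J P γ κ _
  refine isComposing_of_isStablyOpcart (p := p) (P := terminalPath P)
    (γ := ⊤_ (p.Fiber ((⊤_ B) ⨯ (⊤_ B)))) ?_
  have key {u : ctx (terminalPath (p := p) P) ⟶ (⊤_ B) ⨯ (⊤_ B)}
      (ψ : OverHom p u (conj (terminalPath P)) (⊤_ (p.Fiber ((⊤_ B) ⨯ (⊤_ B))))) :
      IsStablyOpcart ψ := by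
    obtain ⟨v, ⟨φ⟩⟩ := exists_overHom_bilTerminal (p := p) P (⊤_ (p.Fiber ((⊤_ B) ⨯ (⊤_ B))))
    have : IsIso ψ.hom := ⟨φ.hom, bilTerminal_hom_ext P (ψ.comp φ rfl) (OverHom.id _),
      terminal_hom_ext (φ.comp ψ rfl) (OverHom.id _)
        (Limits.prod.hom_ext (terminal.hom_ext _ _) (terminal.hom_ext _ _))⟩
    exact IsStablyOpcart.of_isIso ψ
  exact key _

theorem hasRightAdjoint_toTerminal :
    (VDC.toTerminal.{u₁, v₁, u₂, v₂, u₁, v₁, u₂, v₂} (Bil p)).HasRightAdjoint :=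
  ⟨bilTerminal p, bilTerminal_preservesRestrictions p, bilTerminal_preservesComposites p,
    ⟨{  tight := CategoryTheory.Adjunction.mkOfUnitCounit
          { unit := { app := fun X => terminal.from (C := B) X
                      naturality := fun _ _ _ => terminal.hom_ext (C := B) _ _ }
            counit := { app := fun _ => PUnit.unit }
            left_triangle := rfl
            right_triangle := by ext; exact terminal.hom_ext (C := B) _ _ }
        unit := fun _ => terminalLift p _ _
        counit := fun _ => PUnit.unit
        unit_naturality := fun _ => terminal_overHom_ext p _ _
        counit_naturality := fun _ => rfl
        left_triangle := fun _ => rfl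
        right_triangle := fun _ => terminal_overHom_ext p _ _ }⟩⟩

end

end

end Fibration

namespace Fibration

attribute [local simp] prod.lift_fst prod.lift_snd prod.lift_fst_assoc prod.lift_snd_assoc

section

variable {B : Type u₁} [Category.{v₁} B] [HasFiniteProducts B] {E : Type u₂} [Category.{v₂} E]
  {p : E ⥤ B} [IsCartesianFibration p]

/-! ### Conjunctions of stably opcartesian arrows -/

theorem isProd_map {X X' Y Y' : B} : IsProd (prod.map prod.fst prod.fst : (X ⨯ Y) ⨯ (X' ⨯ Y') ⟶ _)
    (prod.map prod.snd prod.snd) := by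
  intro A a b
  refine ⟨prod.lift (prod.lift (a ≫ prod.fst) (b ≫ prod.fst))
    (prod.lift (a ≫ prod.snd) (b ≫ prod.snd)), ⟨by ext <;> simp, by ext <;> simp⟩, ?_⟩
  rintro u ⟨rfl, rfl⟩
  ext <;> simp

/-- The conjunction of two stably opcartesian arrows in separate variables. -/
theorem IsStablyOpcart.meet {S S₁ S₂ T T₁ T₂ : B} {f₁ : S₁ ⟶ T₁} {f₂ : S₂ ⟶ T₂} {X₁ : p.Fiber S₁}
    {X₂ : p.Fiber S₂} {Y₁ : p.Fiber T₁} {Y₂ : p.Fiber T₂} {φ₁ : OverHom p f₁ X₁ Y₁}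
    {φ₂ : OverHom p f₂ X₂ Y₂} (H₁ : IsStablyOpcart φ₁) (H₂ : IsStablyOpcart φ₂) {q₁ : S ⟶ S₁}
    {q₂ : S ⟶ S₂} {r₁ : T ⟶ T₁} {r₂ : T ⟶ T₂} (hq : IsProd q₁ q₂) (hr : IsProd r₁ r₂)
    {M : p.Fiber S} {N : p.Fiber T} {a₁ : OverHom p q₁ M X₁} {a₂ : OverHom p q₂ M X₂}
    {b₁ : OverHom p r₁ N Y₁} {b₂ : OverHom p r₂ N Y₂} (hM : IsMeet a₁ a₂) (hN : IsMeet b₁ b₂)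
    {f : S ⟶ T} (θ : OverHom p f M N) (h₁ : θ.hom ≫ b₁.hom = a₁.hom ≫ φ₁.hom)
    (h₂ : θ.hom ≫ b₂.hom = a₂.hom ≫ φ₂.hom) : IsStablyOpcart θ := by
  have e₁ := OverHom.base_eq (φ := θ.comp b₁ rfl) (ψ := a₁.comp φ₁ rfl) h₁
  have e₂ := OverHom.base_eq (φ := θ.comp b₂ rfl) (ψ := a₂.comp φ₂ rfl) h₂
  -- Factorisation through X₁ ∧ Y₂ over S₁ × T₂: first φ₂ in the context S₁ with conjunct X₁, then
  -- φ₁ in the context T₂ with conjunct Y₂.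
  have hK := isMeet_meet (prod.fst : S₁ ⨯ T₂ ⟶ S₁) (prod.snd : S₁ ⨯ T₂ ⟶ T₂) X₁ Y₂
  obtain ⟨g, hg₁, hg₂⟩ := hr.exists_lift (prod.fst ≫ f₁ : S₁ ⨯ T₂ ⟶ T₁) prod.snd
  let θ₁ := hK.lift (prod.lift q₁ (q₂ ≫ f₂)) a₁ (a₂.comp φ₂ rfl) (prod.lift_fst _ _)
    (prod.lift_snd _ _)
  let θ₂ := hN.lift g ((meetFst (prod.fst : S₁ ⨯ T₂ ⟶ S₁) (prod.snd : S₁ ⨯ T₂ ⟶ T₂) X₁ Y₂).comp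
    φ₁ rfl) (meetSnd (prod.fst : S₁ ⨯ T₂ ⟶ S₁) (prod.snd : S₁ ⨯ T₂ ⟶ T₂) X₁ Y₂) hg₁ hg₂
  have k₁ : IsStablyOpcart θ₁ := H₂.whisker prod.fst (isProd_fst_snd _ _)
    ((prod.lift_fst q₁ (q₂ ≫ f₂)).symm ▸ hq) θ₁ hM.symm hK.symm (by simp [θ₁]) (by simp [θ₁])
  have k₂ : IsStablyOpcart θ₂ := H₁.whisker r₂ hr.symm (hg₂.symm ▸ (isProd_fst_snd _ _).symm) θ₂
    hK hN (by simp [θ₂]) (by simp [θ₂])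
  have e : prod.lift q₁ (q₂ ≫ f₂) ≫ g = f := hr.hom_ext (by simp [hg₁, e₁]) (by simp [hg₂, e₂])
  have : θ = θ₁.comp θ₂ e :=
    OverHom.ext (hN.hom_ext (by simp [θ₁, θ₂, h₁]) (by simp [θ₁, θ₂, h₂]))
  exact this ▸ k₁.comp k₂ e

/-! ### Transport of conjunctions along equalities of paths -/

/-- The comparison of the conjunctions of two equal paths. -/
noncomputable def conjCast {I J : B} {P P' : LPath (Rel p) I J} (h : P = P') :
    Functor.Fiber.fiberInclusion.obj (conj P') ⟶
      (Functor.Fiber.fiberInclusion.obj (conj P) : E) :=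
  eqToHom (by rw [h])

theorem conjCast_head {I J K : B} (α : Rel p I J) {P P' : LPath (Rel p) J K} (h : P = P')
    (h' : LPath.cons α P = LPath.cons α P') :
    conjCast h' ≫ (conjHead α P).hom = (conjHead α P').hom := by
  subst h; exact Category.id_comp _

theorem conjCast_tail {I J K : B} (α : Rel p I J) {P P' : LPath (Rel p) J K} (h : P = P')
    (h' : LPath.cons α P = LPath.cons α P') :
    conjCast h' ≫ (conjTail α P).hom = (conjTail α P').hom ≫ conjCast h := by
  subst h; exact (Category.id_comp _).trans (Category.comp_id _).symm

theorem recast_hom {I I' J J' : B} {P P' : LPath (Rel p) I I'} {s s' : I ⟶ J} {t t' : I' ⟶ J'}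
    {β : Rel p J J'} (hP : P = P') (hs : s = s') (ht : t = t') (ξ : (bilData p).Cell P s t β) :
    OverHom.hom (p := p) ((bilData p).recast hP hs ht ξ) = conjCast hP ≫ ξ.hom := by
  subst hP hs ht; exact (Category.id_comp _).symm

/-! ### Products of loose arrows -/

section

variable (p)

/-- The underlying data of `Bil[p] × Bil[p]`. -/
noncomputable abbrev bilSq : VDCData.{u₁, v₁, u₂, v₂} := (bilData p).prod (bilData p)

/-- The functor of binary products. -/
noncomputable def prodTight : B × B ⥤ B where
  obj X := X.1 ⨯ X.2
  map f := prod.map f.1 f.2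

/-- The diagonal is left adjoint to the functor of binary products. -/
noncomputable def diagAdj : Functor.diag B ⊣ prodTight (B := B) :=
  CategoryTheory.Adjunction.mkOfUnitCounit
    { unit := { app := fun X => prod.lift (𝟙 X) (𝟙 X)
                naturality := fun X Y f => by simp [prodTight] }
      counit := { app := fun X => (prod.fst, prod.snd)
                  naturality := fun X Y f => Prod.ext (by simp [prodTight]) (by simp [prodTight]) }
      left_triangle := by
        ext X
        · change (prod.lift (𝟙 X) (𝟙 X)) ≫ 𝟙 (X ⨯ X) ≫ prod.fst = 𝟙 X
          simp
        · change (prod.lift (𝟙 X) (𝟙 X)) ≫ 𝟙 (X ⨯ X) ≫ prod.snd = 𝟙 X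
          simp
      right_triangle := by ext; simp [prodTight] }

end

/-- The external conjunction of two loose arrows. -/
noncomputable def relProd {X X' Y Y' : B} (α : Rel p X X') (β : Rel p Y Y') :
    Rel p (X ⨯ Y) (X' ⨯ Y') :=
  meet (prod.map prod.fst prod.fst) (prod.map prod.snd prod.snd) α β

section

variable {X X' Y Y' : B} (α : Rel p X X') (β : Rel p Y Y')

/-- The first projection. -/
noncomputable def relFst : OverHom p (prod.map prod.fst prod.fst) (relProd α β) α :=
  meetFst _ _ _ _

/-- The second projection. -/
noncomputable def relSnd : OverHom p (prod.map prod.snd prod.snd) (relProd α β) β :=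
  meetSnd _ _ _ _

theorem isMeet_relProd : IsMeet (relFst α β) (relSnd α β) :=
  isMeet_meet _ _ _ _

end

/-! ### Families of cells -/

section

variable (p) in
/-- A morphism from a graph to the graph of loose arrows. -/
structure LooseMap {O : Type u'} (L : O → O → Type w') where
  obj : O → B
  loose : ∀ {I J : O}, L I J → Rel p (obj I) (obj J)

variable {O : Type u'} {L : O → O → Type w'}

/-- The image of a path. -/
abbrev LooseMap.path (F : LooseMap p L) {I J : O} (P : LPath L I J) :
    LPath (Rel p) (F.obj I) (F.obj J) :=
  P.map F.obj F.loose

theorem LooseMap.path_append (F : LooseMap p L) {I J K : O} (P : LPath L I J) (Q : LPath L J K) :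
    F.path (P.append Q) = (F.path P).append (F.path Q) :=
  LPath.map_append _ _ _ _

/-- A family of tight arrows and of arrows over them. -/
structure LooseTrans (F G : LooseMap p L) where
  tight : ∀ I : O, F.obj I ⟶ G.obj I
  arrow : ∀ {I J : O} (α : L I J), OverHom p (prod.map (tight I) (tight J)) (F.loose α) (G.loose α)

namespace LooseTrans

variable {F G : LooseMap p L} (c : LooseTrans F G)

/-- The sequence of the cells given by a family of arrows, along a path. -/
noncomputable def cells {I J : O} : (P : LPath L I J) →
    VDCData.CellPath (bilData p) (F.path P) (G.path P) (c.tight I) (c.tight J)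
  | .nil I => .nil (D := bilData p) (c.tight I)
  | .cons α P => .cons (D := bilData p) (cellOf (c.arrow α)) (cells P) rfl

theorem cells_head {I J K : O} (α : L I J) (P : LPath L J K) :
    (pathArrow (c.cells (.cons α P))).hom ≫ (conjHead (G.loose α) (G.path P)).hom =
      (conjHead (F.loose α) (F.path P)).hom ≫ (c.arrow α).hom := by
  refine (pathArrow_head (p := p) (cellOf (c.arrow α)) (c.cells P) rfl).trans ?_
  refine (Category.assoc _ _ _).symm.trans (congrArg (· ≫ (c.arrow α).hom) ?_)
  exact segInit_head (p := p) (P := F.path P) (P₁ := .nil _) (P₂ := F.path P) rfl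

theorem cells_tail {I J K : O} (α : L I J) (P : LPath L J K) :
    (pathArrow (c.cells (.cons α P))).hom ≫ (conjTail (G.loose α) (G.path P)).hom =
      (conjTail (F.loose α) (F.path P)).hom ≫ (pathArrow (c.cells P)).hom := by
  refine (pathArrow_tail (p := p) (cellOf (c.arrow α)) (c.cells P) rfl).trans ?_
  refine congrArg (· ≫ _) ?_
  exact (segFin_cons (p := p) (P := F.path P) (P₁ := .nil _) (P₂ := F.path P) rfl rfl).trans
    (Category.comp_id _)

theorem cells_append {I J K : O} (P₁ : LPath L I J) (P₂ : LPath L J K) :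
    c.cells (P₁.append P₂) = (c.cells P₁).append (c.cells P₂) (F.path_append P₁ P₂)
      (G.path_append P₁ P₂) := by
  induction P₁ with
  | nil I => rfl
  | cons α P₁ ih =>
    refine Eq.trans ?_ (VDCData.CellPath.cons_append (D := bilData p) (cellOf (c.arrow α))
      (c.cells P₁) rfl (c.cells P₂) (F.path_append (.cons α P₁) P₂)
      (G.path_append (.cons α P₁) P₂) (F.path_append P₁ P₂) (G.path_append P₁ P₂)
      (congrArg (LPath.cons (F.loose α)) rfl)).symm
    rw [← ih]
    rfl

theorem cells_seg {I J K : O} {P₁ : LPath L I J} {P₂ : LPath L J K} {P : LPath L I K}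
    (h : P = P₁.append P₂) (hF : F.path P = (F.path P₁).append (F.path P₂))
    (hG : G.path P = (G.path P₁).append (G.path P₂)) :
    (pathArrow (c.cells P)).hom ≫ (segInit hG).hom =
        (segInit hF).hom ≫ (pathArrow (c.cells P₁)).hom ∧
      (pathArrow (c.cells P)).hom ≫ (segFin hG).hom =
        (segFin hF).hom ≫ (pathArrow (c.cells P₂)).hom := by
  subst h
  rw [cells_append]
  exact pathArrow_append _ _ _ _

end LooseTrans

end

section

variable {D : VDCData.{u, v, w, x}}

/-- The underlying morphism of graphs. -/
def looseMap (F : D.Hom (bilData p)) : LooseMap p D.Loose where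
  obj := F.tight.obj
  loose := F.loose

variable {F G : D.Hom (bilData p)} (c : LooseTrans (looseMap F) (looseMap G))
  (hτ : ∀ {I J : D.Obj} (s : I ⟶ J), c.tight I ≫ G.tight.map s = F.tight.map s ≫ c.tight J)
  (hc : ∀ {I I' J J' : D.Obj} {P : LPath D.Loose I I'} {s : I ⟶ J} {t : I' ⟶ J'}
    {β : D.Loose J J'} (ξ : D.Cell P s t β), OverHom.hom (p := p) (F.cell ξ) ≫ (c.arrow β).hom =
      (pathArrow (c.cells P)).hom ≫ OverHom.hom (p := p) (G.cell ξ))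

include hτ hc in
/-- A family of arrows that is natural with respect to cells is so with respect to sequences of
cells. -/
theorem LooseTrans.natural {I I' J J' : D.Obj} {P : LPath D.Loose I I'} {Q : LPath D.Loose J J'}
    {s : I ⟶ J} {t : I' ⟶ J'} (Ξ : VDCData.CellPath D P Q s t) :
    (pathArrow (c.cells P)).hom ≫ (pathArrow (Ξ.map G)).hom =
      (pathArrow (Ξ.map F)).hom ≫ (pathArrow (c.cells Q)).hom := by
  induction Ξ with
  | @nil I J s =>
    have e (X : p.Fiber ((looseMap F).obj I)) {u u' : (looseMap F).obj I ⟶ (looseMap G).obj J}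
      (h : u = u') (φ : OverHom p u X (⊤_ (p.Fiber ((looseMap G).obj J))))
      (ψ : OverHom p u' X (⊤_ (p.Fiber ((looseMap G).obj J)))) : φ.hom = ψ.hom :=
      terminal_hom_ext φ ψ h
    exact e _ (hτ s) ((pathArrow (c.cells (.nil I))).comp (pathArrow (p := p)
      (.nil (D := bilData p) (G.tight.map s))) rfl)
      ((pathArrow (p := p) (.nil (D := bilData p) (F.tight.map s))).comp
        (pathArrow (c.cells (.nil J))) rfl)
  | @cons I K I' J M J' P₁ P₂ P β Q s t u ξ Ξ h ih =>
    have hF : (looseMap F).path P = ((looseMap F).path P₁).append ((looseMap F).path P₂) := by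
      rw [h, LooseMap.path_append]
    have hG : (looseMap G).path P = ((looseMap G).path P₁).append ((looseMap G).path P₂) := by
      rw [h, LooseMap.path_append]
    obtain ⟨h₁, h₂⟩ := c.cells_seg h hF hG
    refine conjCons_ext (α := (looseMap G).loose β) (P := (looseMap G).path Q)
      (φ := (pathArrow (c.cells P)).comp (pathArrow (p := p) (.cons (D := bilData p)
        (G.cell ξ) (Ξ.map G) hG)) rfl)
      (ψ := (pathArrow (p := p) (.cons (D := bilData p) (F.cell ξ) (Ξ.map F) hF)).comp
        (pathArrow (c.cells (.cons β Q))) rfl) ?_ ?_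
    · refine (Category.assoc _ _ _).trans ?_
      refine (congrArg (_ ≫ ·) (pathArrow_head (p := p) (G.cell ξ) (Ξ.map G) hG)).trans ?_
      refine (Category.assoc _ _ _).symm.trans ?_
      refine (congrArg (· ≫ _) h₁).trans ?_
      refine (Category.assoc _ _ _).trans ?_
      refine (congrArg (_ ≫ ·) (hc ξ).symm).trans ?_
      refine (Category.assoc _ _ _).symm.trans ?_
      refine (congrArg (· ≫ _) (pathArrow_head (p := p) (F.cell ξ) (Ξ.map F) hF).symm).trans ?_
      refine (Category.assoc _ _ _).trans ?_
      refine (congrArg (_ ≫ ·) (c.cells_head β Q).symm).trans ?_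
      exact (Category.assoc _ _ _).symm
    · refine (Category.assoc _ _ _).trans ?_
      refine (congrArg (_ ≫ ·) (pathArrow_tail (p := p) (G.cell ξ) (Ξ.map G) hG)).trans ?_
      refine (Category.assoc _ _ _).symm.trans ?_
      refine (congrArg (· ≫ _) h₂).trans ?_
      refine (Category.assoc _ _ _).trans ?_
      refine (congrArg (_ ≫ ·) ih).trans ?_
      refine (Category.assoc _ _ _).symm.trans ?_
      refine (congrArg (· ≫ _) (pathArrow_tail (p := p) (F.cell ξ) (Ξ.map F) hF).symm).trans ?_
      refine (Category.assoc _ _ _).trans ?_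
      refine (congrArg (_ ≫ ·) (c.cells_tail β Q).symm).trans ?_
      exact (Category.assoc _ _ _).symm

end

end

end Fibration

namespace Fibration

attribute [local simp] prod.lift_fst prod.lift_snd prod.lift_fst_assoc prod.lift_snd_assoc

section

variable {B : Type u₁} [Category.{v₁} B] [HasFiniteProducts B] {E : Type u₂} [Category.{v₂} E]
  {p : E ⥤ B} [IsCartesianFibration p]

/-! ### The product functor -/

/-- The regrouping of (H₁ ∧ H₂) ∧ (N₁ ∧ N₂) as (H₁ ∧ N₁) ∧ (H₂ ∧ N₂). It is the inductive step in
splitting the conjunction of a path of products. -/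
theorem IsMeet.interchange {S T T' S₁ S₂ T₁ T₂ T₁' T₂' : B} {M : p.Fiber S} {H : p.Fiber T}
    {N : p.Fiber T'} {M₁ : p.Fiber S₁} {M₂ : p.Fiber S₂} {H₁ : p.Fiber T₁} {H₂ : p.Fiber T₂}
    {N₁ : p.Fiber T₁'} {N₂ : p.Fiber T₂'} {kh : S ⟶ T} {kn : S ⟶ T'} {kh₁ : T ⟶ T₁} {kh₂ : T ⟶ T₂}
    {kn₁ : T' ⟶ T₁'} {kn₂ : T' ⟶ T₂'} {l₁ : S₁ ⟶ T₁} {l₂ : S₂ ⟶ T₂} {m₁ : S₁ ⟶ T₁'}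
    {m₂ : S₂ ⟶ T₂'} {q₁ : S ⟶ S₁} {q₂ : S ⟶ S₂}
    {h : OverHom p kh M H} {n : OverHom p kn M N} {h₁ : OverHom p kh₁ H H₁}
    {h₂ : OverHom p kh₂ H H₂} {n₁ : OverHom p kn₁ N N₁} {n₂ : OverHom p kn₂ N N₂}
    {c₁ : OverHom p l₁ M₁ H₁} {c₂ : OverHom p l₂ M₂ H₂} {d₁ : OverHom p m₁ M₁ N₁}
    {d₂ : OverHom p m₂ M₂ N₂} {a₁ : OverHom p q₁ M M₁} {a₂ : OverHom p q₂ M M₂}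
    (hM : IsMeet h n) (hH : IsMeet h₁ h₂) (hN : IsMeet n₁ n₂) (hM₁ : IsMeet c₁ d₁)
    (hM₂ : IsMeet c₂ d₂) (e₁ : a₁.hom ≫ c₁.hom = h.hom ≫ h₁.hom)
    (e₂ : a₁.hom ≫ d₁.hom = n.hom ≫ n₁.hom) (e₃ : a₂.hom ≫ c₂.hom = h.hom ≫ h₂.hom)
    (e₄ : a₂.hom ≫ d₂.hom = n.hom ≫ n₂.hom) : IsMeet a₁ a₂ := by
  have w₁ := OverHom.base_eq (φ := a₁.comp c₁ rfl) (ψ := h.comp h₁ rfl) e₁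
  have w₂ := OverHom.base_eq (φ := a₁.comp d₁ rfl) (ψ := n.comp n₁ rfl) e₂
  have w₃ := OverHom.base_eq (φ := a₂.comp c₂ rfl) (ψ := h.comp h₂ rfl) e₃
  have w₄ := OverHom.base_eq (φ := a₂.comp d₂ rfl) (ψ := n.comp n₂ rfl) e₄
  intro R u W q r x y hq hr
  subst hq hr
  let zh := hH.lift (u ≫ kh) (x.comp c₁ rfl) (y.comp c₂ rfl) (by simp [w₁]) (by simp [w₃])
  let zn := hN.lift (u ≫ kn) (x.comp d₁ rfl) (y.comp d₂ rfl) (by simp [w₂]) (by simp [w₄])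
  let z := hM.lift u zh zn rfl rfl
  refine ⟨z, ⟨?_, ?_⟩, fun z' ⟨k₁, k₂⟩ => OverHom.ext (hM.hom_ext ?_ ?_)⟩
  · refine hM₁.hom_ext (z := z.comp a₁ rfl) ?_ ?_
    · simp [e₁, z, zh]
    · simp [e₂, z, zn]
  · refine hM₂.hom_ext (z := z.comp a₂ rfl) ?_ ?_
    · simp [e₃, z, zh]
    · simp [e₄, z, zn]
  · refine hH.hom_ext (z := z'.comp h rfl) (z' := z.comp h rfl) ?_ ?_
    · simp [z, zh, ← e₁, ← k₁]
    · simp [z, zh, ← e₃, ← k₂]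
  · refine hN.hom_ext (z := z'.comp n rfl) (z' := z.comp n rfl) ?_ ?_
    · simp [z, zn, ← e₂, ← k₁]
    · simp [z, zn, ← e₄, ← k₂]

theorem IsProd.lift_lift {R K T X Y : B} {k : R ⟶ K} {q : R ⟶ T} (H : IsProd k q) :
    IsProd (prod.lift (prod.fst ≫ prod.fst) (prod.snd ≫ k) : (X ⨯ Y) ⨯ R ⟶ X ⨯ K)
      (prod.lift (prod.fst ≫ prod.snd) (prod.snd ≫ q)) := by
  intro A a b
  obtain ⟨u, hu₁, hu₂⟩ := H.exists_lift (a ≫ prod.snd) (b ≫ prod.snd)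
  refine ⟨prod.lift (prod.lift (a ≫ prod.fst) (b ≫ prod.fst)) u,
    ⟨by ext <;> simp [hu₁], by ext <;> simp [hu₂]⟩, ?_⟩
  rintro u' ⟨rfl, rfl⟩
  refine Limits.prod.hom_ext ?_ (H.hom_ext ?_ ?_)
  · ext <;> simp
  · simp [hu₁]
  · simp [hu₂]

section

variable (p)

/-- The action of the product functor on loose arrows. -/
noncomputable def prodLoose : LooseMap p (O := B × B) (bilSq p).Loose where
  obj X := X.1 ⨯ X.2
  loose α := relProd α.1 α.2

/-- The first projections. -/
noncomputable def fstTrans :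
    LooseTrans (prodLoose p) (looseMap ((bilData p).fst (bilData p))) where
  tight X := (prod.fst : X.1 ⨯ X.2 ⟶ X.1)
  arrow α := relFst α.1 α.2

/-- The second projections. -/
noncomputable def sndTrans :
    LooseTrans (prodLoose p) (looseMap ((bilData p).snd (bilData p))) where
  tight X := (prod.snd : X.1 ⨯ X.2 ⟶ X.2)
  arrow α := relSnd α.1 α.2

end

/-- The variables of a path of pairs are those of its two component paths, interleaved. -/
theorem isProd_projections {I J : B × B} (P : LPath (bilSq p).Loose I J) :
    IsProd (pathBase ((fstTrans p).cells P)) (pathBase ((sndTrans p).cells P)) := by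
  induction P with
  | nil I => exact isProd_fst_snd I.1 I.2
  | @cons I J K α P ih =>
    have h := ih.lift_lift (X := I.1) (Y := I.2)
    have e₁ : (prod.lift (prod.fst ≫ prod.fst) ((prod.snd ≫ 𝟙 _) ≫
        pathBase ((fstTrans p).cells P)) : (I.1 ⨯ I.2) ⨯ _ ⟶ I.1 ⨯ _) = _ :=
      congrArg (fun x => prod.lift _ (x ≫ _)) (Category.comp_id _)
    have e₂ : (prod.lift (prod.fst ≫ prod.snd) ((prod.snd ≫ 𝟙 _) ≫
        pathBase ((sndTrans p).cells P)) : (I.1 ⨯ I.2) ⨯ _ ⟶ I.2 ⨯ _) = _ :=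
      congrArg (fun x => prod.lift _ (x ≫ _)) (Category.comp_id _)
    rw [← e₁, ← e₂] at h
    exact h

/-- Upstairs analogue of `isProd_projections`. Together they place the two component paths in
separate variables, as `IsStablyOpcart.meet` requires. -/
theorem isMeet_projections {I J : B × B} (P : LPath (bilSq p).Loose I J) :
    IsMeet (pathArrow ((fstTrans p).cells P)) (pathArrow ((sndTrans p).cells P)) := by
  induction P with
  | nil I =>
    intro R u N q' r' x y hq hr
    exact ⟨terminalLift p N u, ⟨terminal_hom_ext ((terminalLift p N u).comp (pathArrow
      ((fstTrans p).cells (.nil I))) rfl) x hq, terminal_hom_ext ((terminalLift p N u).comp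
        (pathArrow ((sndTrans p).cells (.nil I))) rfl) y hr⟩, fun _ _ => terminal_overHom_ext p _ _⟩
  | cons α P ih =>
    exact IsMeet.interchange (isMeet_conj _ _) (isMeet_relProd α.1 α.2) ih (isMeet_conj _ _)
      (isMeet_conj _ _) ((fstTrans p).cells_head α P) ((fstTrans p).cells_tail α P)
      ((sndTrans p).cells_head α P) ((sndTrans p).cells_tail α P)

section

variable {I I' J J' : B × B} {P : LPath (bilSq p).Loose I I'} {s : I ⟶ J} {t : I' ⟶ J'}
  {β : (bilSq p).Loose J J'} (ξ : (bilSq p).Cell P s t β)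

/-- The action of the product functor on cells. -/
noncomputable def prodCell : (bilData p).Cell ((prodLoose p).path P) (prod.map s.1 s.2)
    (prod.map t.1 t.2) (relProd β.1 β.2) :=
  (isMeet_relProd β.1 β.2).lift _ ((pathArrow ((fstTrans p).cells P)).comp ξ.1 rfl)
    ((pathArrow ((sndTrans p).cells P)).comp ξ.2 rfl)
    (by
      refine Eq.trans ?_ (pathBase_comp_sides ((fstTrans p).cells P) (prod.map_fst s.1 s.2).symm
        (prod.map_fst t.1 t.2).symm).symm
      exact (prod.lift_map _ _ _ _).trans
        (congrArg₂ prod.lift (Category.assoc _ _ _) (Category.assoc _ _ _)))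
    (by
      refine Eq.trans ?_ (pathBase_comp_sides ((sndTrans p).cells P) (prod.map_snd s.1 s.2).symm
        (prod.map_snd t.1 t.2).symm).symm
      exact (prod.lift_map _ _ _ _).trans
        (congrArg₂ prod.lift (Category.assoc _ _ _) (Category.assoc _ _ _)))

theorem prodCell_fst : (prodCell ξ).hom ≫ (relFst β.1 β.2).hom =
    (pathArrow ((fstTrans p).cells P)).hom ≫ ξ.1.hom :=
  IsMeet.lift_left _ _ _ _ _ _

theorem prodCell_snd : (prodCell ξ).hom ≫ (relSnd β.1 β.2).hom =
    (pathArrow ((sndTrans p).cells P)).hom ≫ ξ.2.hom :=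
  IsMeet.lift_right _ _ _ _ _ _

end

end

end Fibration

namespace Fibration

attribute [local simp] prod.lift_fst prod.lift_snd prod.lift_fst_assoc prod.lift_snd_assoc

section

variable {B : Type u₁} [Category.{v₁} B] [HasFiniteProducts B] {E : Type u₂} [Category.{v₂} E]
  {p : E ⥤ B} [IsCartesianFibration p]

variable (p) in
/-- The data of the product functor. -/
noncomputable def prodHom : (bilSq p).Hom (bilData p) where
  tight := prodTight
  loose α := relProd α.1 α.2
  cell ξ := prodCell ξ

theorem fstTrans_natural {I I' J J' : (bilSq p).Obj} {P : LPath (bilSq p).Loose I I'}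
    {Q : LPath (bilSq p).Loose J J'} {s : I ⟶ J} {t : I' ⟶ J'}
    (Ξ : VDCData.CellPath (bilSq p) P Q s t) :
    (pathArrow ((fstTrans p).cells P)).hom ≫
        (pathArrow (Ξ.map ((bilData p).fst (bilData p)))).hom =
      (pathArrow (Ξ.map (prodHom p))).hom ≫ (pathArrow ((fstTrans p).cells Q)).hom :=
  LooseTrans.natural (F := prodHom p) (fstTrans p) (fun s => (prod.map_fst s.1 s.2).symm)
    (fun ξ => prodCell_fst ξ) Ξ

theorem sndTrans_natural {I I' J J' : (bilSq p).Obj} {P : LPath (bilSq p).Loose I I'}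
    {Q : LPath (bilSq p).Loose J J'} {s : I ⟶ J} {t : I' ⟶ J'}
    (Ξ : VDCData.CellPath (bilSq p) P Q s t) :
    (pathArrow ((sndTrans p).cells P)).hom ≫
        (pathArrow (Ξ.map ((bilData p).snd (bilData p)))).hom =
      (pathArrow (Ξ.map (prodHom p))).hom ≫ (pathArrow ((sndTrans p).cells Q)).hom :=
  LooseTrans.natural (F := prodHom p) (sndTrans p) (fun s => (prod.map_snd s.1 s.2).symm)
    (fun ξ => prodCell_snd ξ) Ξ

theorem relProd_hom_ext {X X' Y Y' S : B} {α : Rel p X X'} {β : Rel p Y Y'} {N : p.Fiber S}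
    {u u' : S ⟶ (X ⨯ Y) ⨯ (X' ⨯ Y')} {φ : OverHom p u N (relProd α β)}
    {ψ : OverHom p u' N (relProd α β)} (h : φ.hom ≫ (relFst α β).hom = ψ.hom ≫ (relFst α β).hom)
    (k : φ.hom ≫ (relSnd α β).hom = ψ.hom ≫ (relSnd α β).hom) : φ.hom = ψ.hom := by
  have e₁ := OverHom.base_eq (φ := φ.comp (relFst α β) rfl) (ψ := ψ.comp (relFst α β) rfl) h
  have e₂ := OverHom.base_eq (φ := φ.comp (relSnd α β) rfl) (ψ := ψ.comp (relSnd α β) rfl) k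
  obtain rfl : u = u' := isProd_map.hom_ext e₁ e₂
  exact (isMeet_relProd α β).hom_ext h k

theorem cells_single_head {O : Type u'} {L : O → O → Type w'} {F G : LooseMap p L}
    (c : LooseTrans F G) {I J : O} (α : L I J) :
    (pathArrow (c.cells (.single α))).hom ≫ (conjHead (G.loose α) (.nil _)).hom =
      (conjHead (F.loose α) (.nil _)).hom ≫ (c.arrow α).hom :=
  c.cells_head α (.nil J)

variable (p) in
/-- The product functor. -/
noncomputable def bilProd : VDC.Functor ((Bil p).prod (Bil p)) (Bil p) where
  toHom := prodHom p
  map_id {I J} α := by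
    refine OverHom.ext (p := p) ?_
    refine (recast_hom rfl _ _ (prodCell (p := p) _)).trans ?_
    refine (Category.id_comp _).trans ?_
    refine relProd_hom_ext (p := p) (α := α.1) (β := α.2) (ψ := bilId p (relProd α.1 α.2)) ?_ ?_
    · refine (prodCell_fst _).trans ?_
      rw [bilId_hom]
      refine (congrArg (_ ≫ ·) (bilId_hom p α.1)).trans ?_
      exact cells_single_head (fstTrans p) α
    · refine (prodCell_snd _).trans ?_
      rw [bilId_hom]
      refine (congrArg (_ ≫ ·) (bilId_hom p α.2)).trans ?_
      exact cells_single_head (sndTrans p) α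
  map_comp {I I' J J' K K' P Q s u f g γ} Ξ ζ := by
    refine OverHom.ext (p := p) ?_
    refine relProd_hom_ext (p := p) (α := γ.1) (β := γ.2) (φ := prodCell _) (ψ :=
      (pathArrow (Ξ.map (prodHom p))).comp (prodCell ζ) rfl) ?_ ?_
    · refine (prodCell_fst _).trans ?_
      refine Eq.trans ?_ (Category.assoc _ _ _).symm
      refine Eq.trans ?_ (congrArg (_ ≫ ·) (prodCell_fst ζ).symm)
      refine Eq.trans ?_ (Category.assoc _ _ _)
      refine Eq.trans ?_ (congrArg (· ≫ _) (fstTrans_natural Ξ))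
      exact (Category.assoc _ _ _).symm
    · refine (prodCell_snd _).trans ?_
      refine Eq.trans ?_ (Category.assoc _ _ _).symm
      refine Eq.trans ?_ (congrArg (_ ≫ ·) (prodCell_snd ζ).symm)
      refine Eq.trans ?_ (Category.assoc _ _ _)
      refine Eq.trans ?_ (congrArg (· ≫ _) (sndTrans_natural Ξ))
      exact (Category.assoc _ _ _).symm

end

end Fibration

namespace Fibration

attribute [local simp] prod.lift_fst prod.lift_snd prod.lift_fst_assoc prod.lift_snd_assoc

section

variable {B : Type u₁} [Category.{v₁} B] [HasFiniteProducts B] {E : Type u₂} [Category.{v₂} E]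
  {p : E ⥤ B} [IsCartesianFibration p]

/-! ### The product functor is right adjoint to the diagonal -/

/-- Presents the comparison as an arrow over some arrow of the base, so that extensionality for
conjunctions applies to composites with it. -/
theorem exists_conjCast {I J : B} {P P' : LPath (Rel p) I J} (h : P = P') :
    ∃ (u : ctx P' ⟶ ctx P) (φ : OverHom p u (conj P') (conj P)), φ.hom = conjCast h := by
  subst h; exact ⟨_, OverHom.id _, rfl⟩

/-- The diagonal of a loose arrow. -/
noncomputable def relDiag {X X' : B} (α : Rel p X X') :
    OverHom p (prod.map (prod.lift (𝟙 X) (𝟙 X)) (prod.lift (𝟙 X') (𝟙 X'))) α (relProd α α) :=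
  (isMeet_relProd α α).lift _ (OverHom.id α) (OverHom.id α) (by ext <;> simp) (by ext <;> simp)

theorem relDiag_fst {X X' : B} (α : Rel p X X') : (relDiag α).hom ≫ (relFst α α).hom = 𝟙 _ :=
  IsMeet.lift_left _ _ _ _ _ _

theorem relDiag_snd {X X' : B} (α : Rel p X X') : (relDiag α).hom ≫ (relSnd α α).hom = 𝟙 _ :=
  IsMeet.lift_right _ _ _ _ _ _

/-- The image of a path under the diagonal. -/
abbrev diagPath {I J : B} (P : LPath (Rel p) I J) : LPath (bilSq p).Loose (I, I) (J, J) :=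
  P.map (L' := (bilSq p).Loose) (Functor.diag B).obj fun α => (α, α)

section

variable (p)

/-- The sequence of the diagonals of the members of a path. -/
noncomputable abbrev diagCells {I J : B} (P : LPath (Rel p) I J) :
    VDCData.CellPath (bilData p) P
      ((prodLoose p).path (diagPath P))
      (prod.lift (𝟙 I) (𝟙 I)) (prod.lift (𝟙 J) (𝟙 J)) :=
  VDCData.Hom.unitPath (VDC.diagHom (Bil p)) (prodHom p)
    (fun I : B => (prod.lift (𝟙 I) (𝟙 I) : I ⟶ I ⨯ I)) (fun α => cellOf (relDiag α)) P

/-- The sequence of the projections of the members of a path. -/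
noncomputable abbrev projCells {I J : B × B} (P : LPath (bilSq p).Loose I J) :
    VDCData.CellPath (bilSq p)
      (diagPath ((prodLoose p).path P)) P ((prod.fst, prod.snd) : (I.1 ⨯ I.2, I.1 ⨯ I.2) ⟶ I)
      ((prod.fst, prod.snd) : (J.1 ⨯ J.2, J.1 ⨯ J.2) ⟶ J) :=
  VDCData.Hom.counitPath (VDC.diagHom (Bil p)) (prodHom p)
    (fun I : B × B => ((prod.fst, prod.snd) : (I.1 ⨯ I.2, I.1 ⨯ I.2) ⟶ I))
    (fun α => (cellOf (relFst α.1 α.2), cellOf (relSnd α.1 α.2))) P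

end

theorem diagCells_head {I J K : B} (α : Rel p I J) (P : LPath (Rel p) J K) :
    (pathArrow (diagCells p (.cons α P))).hom ≫ (conjHead (relProd α α)
        ((prodLoose p).path (diagPath P))).hom =
      (conjHead α P).hom ≫ (relDiag α).hom := by
  refine (pathArrow_head (p := p) (cellOf (relDiag α)) (diagCells p P) rfl).trans ?_
  refine (Category.assoc _ _ _).symm.trans (congrArg (· ≫ (relDiag α).hom) ?_)
  exact segInit_head (p := p) (P₁ := .nil _) (P₂ := P) rfl

theorem diagCells_tail {I J K : B} (α : Rel p I J) (P : LPath (Rel p) J K) :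
    (pathArrow (diagCells p (.cons α P))).hom ≫ (conjTail (relProd α α)
        ((prodLoose p).path (diagPath P))).hom =
      (conjTail α P).hom ≫ (pathArrow (diagCells p P)).hom := by
  refine (pathArrow_tail (p := p) (cellOf (relDiag α)) (diagCells p P) rfl).trans ?_
  refine congrArg (· ≫ _) ?_
  exact (segFin_cons (p := p) (P₁ := .nil _) (P₂ := P) rfl rfl).trans (Category.comp_id _)

/-- On each member, projection after diagonal is the identity. The comparison is needed because P
and the projection of its diagonal path agree only up to a proof by induction. -/
theorem diagCells_fst {I J : B} (P : LPath (Rel p) I J)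
    (h : P = (looseMap ((bilData p).fst (bilData p))).path
      (diagPath P)) :
    (pathArrow (diagCells p P)).hom ≫ (pathArrow ((fstTrans p).cells
      (diagPath P))).hom ≫ conjCast h =
        𝟙 _ := by
  induction P with
  | nil I =>
    refine (congrArg (_ ≫ ·) (Category.comp_id _)).trans ?_
    exact terminal_hom_ext ((pathArrow (diagCells p (.nil I))).comp (pathArrow ((fstTrans p).cells
      (.nil (I, I)))) rfl) (OverHom.id _)
      (prod.lift_fst (𝟙 I) (𝟙 I))
  | @cons I J K α P ih =>
    have h' : P = (looseMap ((bilData p).fst (bilData p))).path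
      (diagPath P) := VDC.map_diag_fst (D := Bil p) P
    obtain ⟨v, φ, hφ⟩ := exists_conjCast h
    refine (congrArg (fun x => _ ≫ _ ≫ x) hφ.symm).trans ?_
    refine conjCons_ext (φ := (pathArrow (diagCells p (.cons α P))).comp ((pathArrow
      ((fstTrans p).cells (diagPath (.cons α P)))).comp φ rfl) rfl) (ψ := OverHom.id _) ?_ ?_
    · refine Eq.trans ?_ (Category.id_comp _).symm
      refine (Category.assoc _ _ _).trans ?_
      refine (congrArg (_ ≫ ·) (Category.assoc _ _ _)).trans ?_
      refine (congrArg (fun x => _ ≫ _ ≫ x) ((congrArg (· ≫ _) hφ).trans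
        (conjCast_head α h' h))).trans ?_
      refine (congrArg (_ ≫ ·) ((fstTrans p).cells_head (I := (I, I)) (J := (J, J))
        (K := (K, K)) (α, α) (diagPath P))).trans ?_
      refine (Category.assoc _ _ _).symm.trans ?_
      refine (congrArg (· ≫ _) (diagCells_head α P)).trans ?_
      refine (Category.assoc _ _ _).trans ?_
      exact (congrArg (_ ≫ ·) (relDiag_fst α)).trans (Category.comp_id _)
    · refine Eq.trans ?_ (Category.id_comp _).symm
      refine (Category.assoc _ _ _).trans ?_
      refine (congrArg (_ ≫ ·) (Category.assoc _ _ _)).trans ?_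
      refine (congrArg (fun x => _ ≫ _ ≫ x) ((congrArg (· ≫ _) hφ).trans
        (conjCast_tail α h' h))).trans ?_
      refine (congrArg (_ ≫ ·) (Category.assoc _ _ _).symm).trans ?_
      refine (congrArg (fun x => _ ≫ x ≫ _) ((fstTrans p).cells_tail (I := (I, I)) (J := (J, J))
        (K := (K, K)) (α, α) (diagPath P))).trans ?_
      refine (congrArg (_ ≫ ·) (Category.assoc _ _ _)).trans ?_
      refine (Category.assoc _ _ _).symm.trans ?_
      refine (congrArg (· ≫ _) (diagCells_tail α P)).trans ?_
      refine (Category.assoc _ _ _).trans ?_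
      exact (congrArg (_ ≫ ·) (ih h')).trans (Category.comp_id _)

/-- The counit along a path has the first projections as first components, but its domain path has
passed through the diagonal, whence the comparison. -/
theorem projCells_fst {I J : B × B} (P : LPath (bilSq p).Loose I J)
    (h : (prodLoose p).path P = (looseMap ((bilData p).fst (bilData p))).path
      (diagPath ((prodLoose p).path P))) :
    (pathArrow ((projCells p P).map ((bilData p).fst (bilData p)))).hom =
      conjCast h ≫ (pathArrow ((fstTrans p).cells P)).hom := by
  induction P with
  | nil I => exact (Category.id_comp _).symm
  | @cons I J K α P ih =>
    have h' : (prodLoose p).path P = (looseMap ((bilData p).fst (bilData p))).path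
      (diagPath ((prodLoose p).path P)) :=
      VDC.map_diag_fst (D := Bil p) _
    obtain ⟨v, φ, hφ⟩ := exists_conjCast h
    refine Eq.trans ?_ (congrArg (· ≫ _) hφ)
    refine conjCons_ext (φ := pathArrow (p := p) (.cons (D := bilData p)
      (cellOf (relFst α.1 α.2)) ((projCells p P).map ((bilData p).fst (bilData p))) rfl))
      (ψ := φ.comp (pathArrow ((fstTrans p).cells (.cons α P))) rfl) ?_ ?_
    · refine (pathArrow_head (p := p) _ _ _).trans ?_
      refine (Category.assoc _ _ _).symm.trans ?_
      refine (congrArg (· ≫ _) (segInit_head (p := p) (P₁ := .nil _) rfl)).trans ?_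
      refine Eq.trans ?_ (Category.assoc _ _ _).symm
      refine Eq.trans ?_ (congrArg (_ ≫ ·) ((fstTrans p).cells_head α P)).symm
      refine Eq.trans ?_ (Category.assoc _ _ _)
      exact congrArg (· ≫ _) ((congrArg (· ≫ _) hφ).trans (conjCast_head _ h' h)).symm
    · refine (pathArrow_tail (p := p) _ _ _).trans ?_
      refine (congrArg (_ ≫ ·) (ih h')).trans ?_
      refine Eq.trans ?_ (Category.assoc _ _ _).symm
      refine Eq.trans ?_ (congrArg (_ ≫ ·) ((fstTrans p).cells_tail α P)).symm
      refine Eq.trans ?_ (Category.assoc _ _ _)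
      refine Eq.trans ?_ (congrArg (· ≫ _) ((congrArg (· ≫ _) hφ).trans
        (conjCast_tail _ h' h)).symm)
      refine Eq.trans ?_ (Category.assoc _ _ _).symm
      refine congrArg (· ≫ _) ?_
      exact (segFin_cons (p := p) (P₁ := .nil _) rfl rfl).trans (Category.comp_id _)

theorem diagCells_snd {I J : B} (P : LPath (Rel p) I J)
    (h : P = (looseMap ((bilData p).snd (bilData p))).path
      (diagPath P)) :
    (pathArrow (diagCells p P)).hom ≫ (pathArrow ((sndTrans p).cells
      (diagPath P))).hom ≫ conjCast h =
        𝟙 _ := by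
  induction P with
  | nil I =>
    refine (congrArg (_ ≫ ·) (Category.comp_id _)).trans ?_
    exact terminal_hom_ext ((pathArrow (diagCells p (.nil I))).comp (pathArrow ((sndTrans p).cells
      (.nil (I, I)))) rfl) (OverHom.id _)
      (prod.lift_snd (𝟙 I) (𝟙 I))
  | @cons I J K α P ih =>
    have h' : P = (looseMap ((bilData p).snd (bilData p))).path
      (diagPath P) := VDC.map_diag_snd (D := Bil p) P
    obtain ⟨v, φ, hφ⟩ := exists_conjCast h
    refine (congrArg (fun x => _ ≫ _ ≫ x) hφ.symm).trans ?_
    refine conjCons_ext (φ := (pathArrow (diagCells p (.cons α P))).comp ((pathArrow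
      ((sndTrans p).cells (diagPath (.cons α P)))).comp φ rfl) rfl) (ψ := OverHom.id _) ?_ ?_
    · refine Eq.trans ?_ (Category.id_comp _).symm
      refine (Category.assoc _ _ _).trans ?_
      refine (congrArg (_ ≫ ·) (Category.assoc _ _ _)).trans ?_
      refine (congrArg (fun x => _ ≫ _ ≫ x) ((congrArg (· ≫ _) hφ).trans
        (conjCast_head α h' h))).trans ?_
      refine (congrArg (_ ≫ ·) ((sndTrans p).cells_head (I := (I, I)) (J := (J, J))
        (K := (K, K)) (α, α) (diagPath P))).trans ?_
      refine (Category.assoc _ _ _).symm.trans ?_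
      refine (congrArg (· ≫ _) (diagCells_head α P)).trans ?_
      refine (Category.assoc _ _ _).trans ?_
      exact (congrArg (_ ≫ ·) (relDiag_snd α)).trans (Category.comp_id _)
    · refine Eq.trans ?_ (Category.id_comp _).symm
      refine (Category.assoc _ _ _).trans ?_
      refine (congrArg (_ ≫ ·) (Category.assoc _ _ _)).trans ?_
      refine (congrArg (fun x => _ ≫ _ ≫ x) ((congrArg (· ≫ _) hφ).trans
        (conjCast_tail α h' h))).trans ?_
      refine (congrArg (_ ≫ ·) (Category.assoc _ _ _).symm).trans ?_
      refine (congrArg (fun x => _ ≫ x ≫ _) ((sndTrans p).cells_tail (I := (I, I)) (J := (J, J))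
        (K := (K, K)) (α, α) (diagPath P))).trans ?_
      refine (congrArg (_ ≫ ·) (Category.assoc _ _ _)).trans ?_
      refine (Category.assoc _ _ _).symm.trans ?_
      refine (congrArg (· ≫ _) (diagCells_tail α P)).trans ?_
      refine (Category.assoc _ _ _).trans ?_
      exact (congrArg (_ ≫ ·) (ih h')).trans (Category.comp_id _)

theorem projCells_snd {I J : B × B} (P : LPath (bilSq p).Loose I J)
    (h : (prodLoose p).path P = (looseMap ((bilData p).snd (bilData p))).path
      (diagPath ((prodLoose p).path P))) :
    (pathArrow ((projCells p P).map ((bilData p).snd (bilData p)))).hom =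
      conjCast h ≫ (pathArrow ((sndTrans p).cells P)).hom := by
  induction P with
  | nil I => exact (Category.id_comp _).symm
  | @cons I J K α P ih =>
    have h' : (prodLoose p).path P = (looseMap ((bilData p).snd (bilData p))).path
      (diagPath ((prodLoose p).path P)) :=
      VDC.map_diag_snd (D := Bil p) _
    obtain ⟨v, φ, hφ⟩ := exists_conjCast h
    refine Eq.trans ?_ (congrArg (· ≫ _) hφ)
    refine conjCons_ext (φ := pathArrow (p := p) (.cons (D := bilData p)
      (cellOf (relSnd α.1 α.2)) ((projCells p P).map ((bilData p).snd (bilData p))) rfl))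
      (ψ := φ.comp (pathArrow ((sndTrans p).cells (.cons α P))) rfl) ?_ ?_
    · refine (pathArrow_head (p := p) _ _ _).trans ?_
      refine (Category.assoc _ _ _).symm.trans ?_
      refine (congrArg (· ≫ _) (segInit_head (p := p) (P₁ := .nil _) rfl)).trans ?_
      refine Eq.trans ?_ (Category.assoc _ _ _).symm
      refine Eq.trans ?_ (congrArg (_ ≫ ·) ((sndTrans p).cells_head α P)).symm
      refine Eq.trans ?_ (Category.assoc _ _ _)
      exact congrArg (· ≫ _) ((congrArg (· ≫ _) hφ).trans (conjCast_head _ h' h)).symm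
    · refine (pathArrow_tail (p := p) _ _ _).trans ?_
      refine (congrArg (_ ≫ ·) (ih h')).trans ?_
      refine Eq.trans ?_ (Category.assoc _ _ _).symm
      refine Eq.trans ?_ (congrArg (_ ≫ ·) ((sndTrans p).cells_tail α P)).symm
      refine Eq.trans ?_ (Category.assoc _ _ _)
      refine Eq.trans ?_ (congrArg (· ≫ _) ((congrArg (· ≫ _) hφ).trans
        (conjCast_tail _ h' h)).symm)
      refine Eq.trans ?_ (Category.assoc _ _ _).symm
      refine congrArg (· ≫ _) ?_
      exact (segFin_cons (p := p) (P₁ := .nil _) rfl rfl).trans (Category.comp_id _)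

end

end Fibration

namespace Fibration

attribute [local simp] prod.lift_fst prod.lift_snd prod.lift_fst_assoc prod.lift_snd_assoc

section

variable {B : Type u₁} [Category.{v₁} B] [HasFiniteProducts B] {E : Type u₂} [Category.{v₂} E]
  {p : E ⥤ B} [IsCartesianFibration p]

theorem comp_cellOf_recast {I' J' I J K K' : B} {α' : Rel p I' J'} {f : I' ⟶ I} {g : J' ⟶ J}
    {α : Rel p I J} (r : OverHom p (prod.map f g) α' α) {P P' : LPath (Rel p) K K'} {h : K ⟶ I'}
    {k : K' ⟶ J'} (ξ : (bilData p).Cell P h k α') (e : P = P') :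
    (pathArrow (p := p) (.single (D := bilData p) ((bilData p).recast e rfl rfl ξ))).hom ≫
      (cellOf r).hom = conjCast e ≫ ξ.hom ≫ r.hom :=
  (comp_cellOf r _).trans ((congrArg (· ≫ r.hom) (recast_hom e rfl rfl ξ)).trans
    (Category.assoc _ _ _))

theorem cells_single_comp {O : Type u'} {L : O → O → Type w'} {F G : LooseMap p L}
    (c : LooseTrans F G) {I J : O} (α : L I J) {K K' : B} {f : G.obj I ⟶ K} {g : G.obj J ⟶ K'}
    {δ : Rel p K K'} (r : OverHom p (prod.map f g) (G.loose α) δ) :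
    (pathArrow (c.cells (.single α))).hom ≫ (cellOf r).hom =
      (conjHead (F.loose α) (.nil _)).hom ≫ (c.arrow α).hom ≫ r.hom := by
  refine (Category.assoc _ _ _).symm.trans ?_
  exact (congrArg (· ≫ r.hom) (cells_single_head c α)).trans (Category.assoc _ _ _)

/-- After either projection, both sides become ξ: on the left because a projection undoes the
diagonal of β, on the right by the same fact along P. -/
theorem unit_naturality_bil {I I' J J' : B} {P : LPath (Rel p) I I'} {s : I ⟶ J} {t : I' ⟶ J'}
    {β : Rel p J J'} (ξ : (bilData p).Cell P s t β) :
    ξ.hom ≫ (relDiag β).hom = (pathArrow (diagCells p P)).hom ≫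
      (prodCell ((VDC.diagHom (Bil p)).cell ξ)).hom := by
  refine relProd_hom_ext (p := p) (α := β) (β := β) (φ := ξ.comp (relDiag β) rfl) (ψ :=
    (pathArrow (diagCells p P)).comp (prodCell ((VDC.diagHom (Bil p)).cell ξ)) rfl) ?_ ?_
  · refine (Category.assoc _ _ _).trans ?_
    refine (congrArg (_ ≫ ·) (relDiag_fst β)).trans ((Category.comp_id _).trans ?_)
    refine Eq.trans ?_ (Category.assoc _ _ _).symm
    refine Eq.trans ?_ (congrArg (_ ≫ ·) (prodCell_fst ((VDC.diagHom (Bil p)).cell ξ)).symm)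
    refine Eq.trans ?_ (congrArg (fun x => _ ≫ _ ≫ x)
      (recast_hom (VDC.map_diag_fst (D := Bil p) P) rfl rfl ξ).symm)
    refine Eq.trans ?_ (congrArg (_ ≫ ·) (Category.assoc _ _ _))
    refine Eq.trans ?_ (Category.assoc _ _ _)
    exact (Category.id_comp _).symm.trans (congrArg (· ≫ ξ.hom) (diagCells_fst P _).symm)
  · refine (Category.assoc _ _ _).trans ?_
    refine (congrArg (_ ≫ ·) (relDiag_snd β)).trans ((Category.comp_id _).trans ?_)
    refine Eq.trans ?_ (Category.assoc _ _ _).symm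
    refine Eq.trans ?_ (congrArg (_ ≫ ·) (prodCell_snd ((VDC.diagHom (Bil p)).cell ξ)).symm)
    refine Eq.trans ?_ (congrArg (fun x => _ ≫ _ ≫ x)
      (recast_hom (VDC.map_diag_snd (D := Bil p) P) rfl rfl ξ).symm)
    refine Eq.trans ?_ (congrArg (_ ≫ ·) (Category.assoc _ _ _))
    refine Eq.trans ?_ (Category.assoc _ _ _)
    exact (Category.id_comp _).symm.trans (congrArg (· ≫ ξ.hom) (diagCells_snd P _).symm)

/-- The diagonal of a loose arrow as a cell. -/
noncomputable def diagCell {I J : B} (α : Rel p I J) :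
    (bilData p).Cell (.single α) (prod.lift (𝟙 I) (𝟙 I)) (prod.lift (𝟙 J) (𝟙 J)) (relProd α α) :=
  cellOf (relDiag α)

/-- The pair of projections of a product. -/
noncomputable def projCell {I J : B × B} (α : (bilSq p).Loose I J) :
    (bilSq p).Cell (diagPath (.single (relProd α.1 α.2)))
      ((prod.fst, prod.snd) : (I.1 ⨯ I.2, I.1 ⨯ I.2) ⟶ I)
      ((prod.fst, prod.snd) : (J.1 ⨯ J.2, J.1 ⨯ J.2) ⟶ J) α :=
  (cellOf (relFst α.1 α.2), cellOf (relSnd α.1 α.2))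

theorem right_triangle_bil {I J : B × B} (α : (bilSq p).Loose I J) :
    (pathArrow (p := p) (.single (D := bilData p) (cellOf (relDiag (relProd α.1 α.2))))).hom ≫
        (prodCell (projCell α)).hom =
      (conjHead (relProd α.1 α.2) (.nil _)).hom := by
  have e := single_comp_hom (cellOf (relDiag (relProd α.1 α.2)))
  refine relProd_hom_ext (φ := (pathArrow (p := p) (.single (D := bilData p)
    (cellOf (relDiag (relProd α.1 α.2))))).comp (prodCell (projCell α)) rfl)
    (ψ := conjHead (relProd α.1 α.2) (.nil _)) ?_ ?_
  · refine (Category.assoc _ _ _).trans ?_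
    refine (congrArg (_ ≫ ·) (prodCell_fst (projCell α))).trans ?_
    refine (congrArg (_ ≫ ·) (cells_single_comp (fstTrans p) (I := (I.1 ⨯ I.2, I.1 ⨯ I.2))
      (J := (J.1 ⨯ J.2, J.1 ⨯ J.2)) (relProd α.1 α.2, relProd α.1 α.2) (relFst α.1 α.2))).trans ?_
    refine (Category.assoc _ _ _).symm.trans ?_
    refine (congrArg (· ≫ _) e).trans ?_
    refine (Category.assoc _ _ _).trans (congrArg (_ ≫ ·) ?_)
    refine (Category.assoc _ _ _).symm.trans ?_
    exact (congrArg (· ≫ _) (relDiag_fst _)).trans (Category.id_comp _)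
  · refine (Category.assoc _ _ _).trans ?_
    refine (congrArg (_ ≫ ·) (prodCell_snd (projCell α))).trans ?_
    refine (congrArg (_ ≫ ·) (cells_single_comp (sndTrans p) (I := (I.1 ⨯ I.2, I.1 ⨯ I.2))
      (J := (J.1 ⨯ J.2, J.1 ⨯ J.2)) (relProd α.1 α.2, relProd α.1 α.2) (relSnd α.1 α.2))).trans ?_
    refine (Category.assoc _ _ _).symm.trans ?_
    refine (congrArg (· ≫ _) e).trans ?_
    refine (Category.assoc _ _ _).trans (congrArg (_ ≫ ·) ?_)
    refine (Category.assoc _ _ _).symm.trans ?_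
    exact (congrArg (· ≫ _) (relDiag_snd _)).trans (Category.id_comp _)

variable (p) in
/-- The product functor is right adjoint to the diagonal. -/
noncomputable def diagAdjunction : VDC.Adjunction (VDC.diag (Bil p)) (bilProd p) where
  tight := diagAdj (B := B)
  unit α := diagCell α
  counit α := projCell α
  unit_naturality {I I' J J' P s t β} ξ := by
    refine OverHom.ext (p := p) ?_
    refine (comp_cellOf (relDiag β) ξ).trans ?_
    exact unit_naturality_bil ξ
  counit_naturality {I I' J J' P s t β} ξ := by
    refine Prod.ext (OverHom.ext (p := p) ?_) (OverHom.ext (p := p) ?_)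
    · refine (comp_cellOf_recast (relFst β.1 β.2) (prodCell ξ)
        (VDC.map_diag_fst (D := Bil p) ((prodLoose p).path P))).trans ?_
      refine (congrArg (_ ≫ ·) (prodCell_fst ξ)).trans ?_
      refine (Category.assoc _ _ _).symm.trans ?_
      exact congrArg (· ≫ _) (projCells_fst P _).symm
    · refine (comp_cellOf_recast (relSnd β.1 β.2) (prodCell ξ)
        (VDC.map_diag_snd (D := Bil p) ((prodLoose p).path P))).trans ?_
      refine (congrArg (_ ≫ ·) (prodCell_snd ξ)).trans ?_
      refine (Category.assoc _ _ _).symm.trans ?_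
      exact congrArg (· ≫ _) (projCells_snd P _).symm
  left_triangle {I J} α := by
    refine Prod.ext (OverHom.ext (p := p) ?_) (OverHom.ext (p := p) ?_)
    · refine (comp_cellOf (relFst α α) (cellOf (relDiag α))).trans ?_
      refine (Category.assoc _ _ _).trans ?_
      refine (congrArg (_ ≫ ·) (relDiag_fst α)).trans ((Category.comp_id _).trans ?_)
      exact (bilId_hom p α).symm
    · refine (comp_cellOf (relSnd α α) (cellOf (relDiag α))).trans ?_
      refine (Category.assoc _ _ _).trans ?_
      refine (congrArg (_ ≫ ·) (relDiag_snd α)).trans ((Category.comp_id _).trans ?_)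
      exact (bilId_hom p α).symm
  right_triangle {I J} α := by
    refine OverHom.ext (p := p) ?_
    refine Eq.trans ?_ (bilId_hom p (relProd α.1 α.2)).symm
    exact right_triangle_bil α

end

end Fibration

namespace Fibration

attribute [local simp] prod.lift_fst prod.lift_snd prod.lift_fst_assoc prod.lift_snd_assoc

section

variable {B : Type u₁} [Category.{v₁} B] [HasFiniteProducts B] {E : Type u₂} [Category.{v₂} E]
  {p : E ⥤ B} [IsCartesianFibration p]

/-! ### The product functor preserves restrictions -/

/-- A conjunction of cartesian arrows is cartesian. -/
theorem IsMeet.isStronglyCartesian {S T S₁ S₂ T₁ T₂ : B} {f : S ⟶ T} {f₁ : S₁ ⟶ T₁} {f₂ : S₂ ⟶ T₂}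
    {q₁ : S ⟶ S₁} {q₂ : S ⟶ S₂} {r₁ : T ⟶ T₁} {r₂ : T ⟶ T₂} {M : p.Fiber S} {N : p.Fiber T}
    {X₁ : p.Fiber S₁} {X₂ : p.Fiber S₂} {Y₁ : p.Fiber T₁} {Y₂ : p.Fiber T₂}
    {a₁ : OverHom p q₁ M X₁} {a₂ : OverHom p q₂ M X₂} {b₁ : OverHom p r₁ N Y₁}
    {b₂ : OverHom p r₂ N Y₂} (hM : IsMeet a₁ a₂) (hN : IsMeet b₁ b₂) (φ₁ : OverHom p f₁ X₁ Y₁)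
    (φ₂ : OverHom p f₂ X₂ Y₂) [p.IsStronglyCartesian f₁ φ₁.hom] [p.IsStronglyCartesian f₂ φ₂.hom]
    (θ : OverHom p f M N) (h₁ : θ.hom ≫ b₁.hom = a₁.hom ≫ φ₁.hom)
    (h₂ : θ.hom ≫ b₂.hom = a₂.hom ≫ φ₂.hom) : p.IsStronglyCartesian f θ.hom := by
  have e₁ := OverHom.base_eq (φ := θ.comp b₁ rfl) (ψ := a₁.comp φ₁ rfl) h₁
  have e₂ := OverHom.base_eq (φ := θ.comp b₂ rfl) (ψ := a₂.comp φ₂ rfl) h₂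
  refine isStronglyCartesian_of_existsUnique θ fun {W} ψ => ?_
  have k₁ := Functor.IsStronglyCartesian.fac p f₁ φ₁.hom (g := q₁) e₁ (ψ.comp b₁ rfl).hom
  set z₁ := Functor.IsStronglyCartesian.map p f₁ φ₁.hom (g := q₁) e₁ (ψ.comp b₁ rfl).hom
  have k₂ := Functor.IsStronglyCartesian.fac p f₂ φ₂.hom (g := q₂) e₂ (ψ.comp b₂ rfl).hom
  set z₂ := Functor.IsStronglyCartesian.map p f₂ φ₂.hom (g := q₂) e₂ (ψ.comp b₂ rfl).hom
  obtain ⟨χ, ⟨hχ₁, hχ₂⟩, hχ⟩ := hM (𝟙 S) (N := W) (q' := q₁) (r' := q₂) ⟨z₁, inferInstance⟩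
    ⟨z₂, inferInstance⟩ (Category.id_comp _) (Category.id_comp _)
  refine ⟨χ, hN.hom_ext (z := χ.comp θ (Category.id_comp f)) (z' := ψ) ?_ ?_, fun χ' h => hχ χ'
    ⟨?_, ?_⟩⟩
  · rw [OverHom.comp_hom, Category.assoc, h₁, ← Category.assoc, hχ₁]
    exact k₁
  · rw [OverHom.comp_hom, Category.assoc, h₂, ← Category.assoc, hχ₂]
    exact k₂
  · have : p.IsHomLift q₁ (χ'.hom ≫ a₁.hom) :=
      (χ'.comp a₁ (Category.id_comp q₁)).isHomLift
    refine Functor.IsStronglyCartesian.ext p f₁ φ₁.hom q₁ (Eq.trans ?_ k₁.symm)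
    rw [Category.assoc, ← h₁, ← Category.assoc, h]; rfl
  · have : p.IsHomLift q₂ (χ'.hom ≫ a₂.hom) :=
      (χ'.comp a₂ (Category.id_comp q₂)).isHomLift
    refine Functor.IsStronglyCartesian.ext p f₂ φ₂.hom q₂ (Eq.trans ?_ k₂.symm)
    rw [Category.assoc, ← h₂, ← Category.assoc, h]; rfl

/-- An arrow over `f × g` as a cell whose sides factor through `f` and `g`. -/
noncomputable def cellOf' {I' J' I J : B} {W : Rel p I' J'} {f : I' ⟶ I} {g : J' ⟶ J}
    {α : Rel p I J} (ψ : OverHom p (prod.map f g) W α) :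
    (bilData p).Cell (.single W) (𝟙 I' ≫ f) (𝟙 J' ≫ g) α :=
  (cellOf ψ).rebase (by rw [Category.id_comp, Category.id_comp])

section

variable {I' J' I J : B × B} {α' : (bilSq p).Loose I' J'} {f : I' ⟶ I} {g : J' ⟶ J}
  {α : (bilSq p).Loose I J} {r₁ : OverHom p (prod.map f.1 g.1) α'.1 α.1}
  {r₂ : OverHom p (prod.map f.2 g.2) α'.2 α.2}

/-- A component of a restriction in the product is tested by pairing a test arrow for it with the
other component itself, for which a factorisation is given. Existence and uniqueness for the pair
then give them for the component. -/
theorem isStronglyCartesian_fst (hρ : VDC.IsRestriction ((Bil p).prod (Bil p)) (α' := α') (α := α)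
    (f := f) (g := g) (cellOf r₁, cellOf r₂)) :
    p.IsStronglyCartesian (prod.map f.1 g.1) r₁.hom := by
  refine isStronglyCartesian_of_existsUnique r₁ fun {W} ψ => ?_
  have hW := isIso_conjHead W
  have key (χ : OverHom p (𝟙 _) W α'.1) : ((pathArrow (p := p) (.single (D := bilData p)
      (cellOf (χ.rebase prod.map_id_id.symm)))).hom ≫ (cellOf r₁).hom = (cellOf ψ).hom) ↔
        χ.hom ≫ r₁.hom = ψ.hom := by
    rw [comp_cellOf]
    constructor
    · intro h
      exact (cancel_epi (conjHead W (.nil J'.1)).hom).mp ((Category.assoc _ _ _).symm.trans h)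
    · intro h
      exact (Category.assoc _ _ _).trans (congrArg ((conjHead W (.nil J'.1)).hom ≫ ·) h)
  obtain ⟨ξ, hξ, hξ'⟩ := hρ (.single (W, α'.2)) (𝟙 I') (𝟙 J') (cellOf' ψ, cellOf' r₂)
  obtain ⟨χ, hχ⟩ := exists_cellOf (p := p) (f := 𝟙 I'.1) (g := 𝟙 J'.1) (α' := W) (α := α'.1) ξ.1
  have e : cellOf ((χ.rebase prod.map_id_id).rebase prod.map_id_id.symm) = ξ.1 := hχ
  refine ⟨χ.rebase prod.map_id_id, (key _).mp ?_, fun χ' h => ?_⟩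
  · rw [e]
    exact congrArg (fun x => OverHom.hom (p := p) x.1) hξ
  · have h₁ := hξ' (cellOf (χ'.rebase prod.map_id_id.symm), ξ.2) (Prod.ext
      (OverHom.ext (p := p) ((key χ').mpr h)) (congrArg (fun x => x.2) hξ))
    have h₂ : (cellOf (χ'.rebase prod.map_id_id.symm)).hom = (cellOf χ).hom := by
      rw [hχ]
      exact congrArg (fun x => OverHom.hom (p := p) x.1) h₁
    exact OverHom.ext ((cancel_epi (conjHead W (.nil J'.1)).hom).mp h₂)

theorem isStronglyCartesian_snd (hρ : VDC.IsRestriction ((Bil p).prod (Bil p)) (α' := α') (α := α)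
    (f := f) (g := g) (cellOf r₁, cellOf r₂)) :
    p.IsStronglyCartesian (prod.map f.2 g.2) r₂.hom := by
  refine isStronglyCartesian_of_existsUnique r₂ fun {W} ψ => ?_
  have hW := isIso_conjHead W
  have key (χ : OverHom p (𝟙 _) W α'.2) : ((pathArrow (p := p) (.single (D := bilData p)
      (cellOf (χ.rebase prod.map_id_id.symm)))).hom ≫ (cellOf r₂).hom = (cellOf ψ).hom) ↔
        χ.hom ≫ r₂.hom = ψ.hom := by
    rw [comp_cellOf]
    constructor
    · intro h
      exact (cancel_epi (conjHead W (.nil J'.2)).hom).mp ((Category.assoc _ _ _).symm.trans h)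
    · intro h
      exact (Category.assoc _ _ _).trans (congrArg ((conjHead W (.nil J'.2)).hom ≫ ·) h)
  obtain ⟨ξ, hξ, hξ'⟩ := hρ (.single (α'.1, W)) (𝟙 I') (𝟙 J') (cellOf' r₁, cellOf' ψ)
  obtain ⟨χ, hχ⟩ := exists_cellOf (p := p) (f := 𝟙 I'.2) (g := 𝟙 J'.2) (α' := W) (α := α'.2) ξ.2
  have e : cellOf ((χ.rebase prod.map_id_id).rebase prod.map_id_id.symm) = ξ.2 := hχ
  refine ⟨χ.rebase prod.map_id_id, (key _).mp ?_, fun χ' h => ?_⟩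
  · rw [e]
    exact congrArg (fun x => OverHom.hom (p := p) x.2) hξ
  · have h₁ := hξ' (ξ.1, cellOf (χ'.rebase prod.map_id_id.symm)) (Prod.ext
      (congrArg (fun x => x.1) hξ) (OverHom.ext (p := p) ((key χ').mpr h)))
    have h₂ : (cellOf (χ'.rebase prod.map_id_id.symm)).hom = (cellOf χ).hom := by
      rw [hχ]
      exact congrArg (fun x => OverHom.hom (p := p) x.2) h₁
    exact OverHom.ext ((cancel_epi (conjHead W (.nil J'.2)).hom).mp h₂)

end

theorem exists_prodCell_eq_cellOf {I' J' I J : B × B} {α' : (bilSq p).Loose I' J'} {f : I' ⟶ I}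
    {g : J' ⟶ J} {α : (bilSq p).Loose I J} (r₁ : OverHom p (prod.map f.1 g.1) α'.1 α.1)
    (r₂ : OverHom p (prod.map f.2 g.2) α'.2 α.2) :
    ∃ r : OverHom p (prod.map (prod.map f.1 f.2) (prod.map g.1 g.2)) (relProd α'.1 α'.2)
      (relProd α.1 α.2), r.hom ≫ (relFst α.1 α.2).hom = (relFst α'.1 α'.2).hom ≫ r₁.hom ∧
        r.hom ≫ (relSnd α.1 α.2).hom = (relSnd α'.1 α'.2).hom ≫ r₂.hom ∧
        prodCell (P := .single α') (β := α) (s := f) (t := g) (cellOf r₁, cellOf r₂) =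
          cellOf r := by
  let r := (isMeet_relProd α.1 α.2).lift (prod.map (prod.map f.1 f.2) (prod.map g.1 g.2))
    ((relFst α'.1 α'.2).comp r₁ rfl) ((relSnd α'.1 α'.2).comp r₂ rfl)
    (by ext <;> simp) (by ext <;> simp)
  have h₁ : r.hom ≫ (relFst α.1 α.2).hom = _ := IsMeet.lift_left _ _ _ _ _ _
  have h₂ : r.hom ≫ (relSnd α.1 α.2).hom = _ := IsMeet.lift_right _ _ _ _ _ _
  refine ⟨r, h₁, h₂, OverHom.ext (relProd_hom_ext ?_ ?_)⟩
  · refine (prodCell_fst _).trans ?_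
    refine (cells_single_comp (fstTrans p) α' r₁).trans ?_
    exact (congrArg (_ ≫ ·) h₁.symm).trans (Category.assoc _ _ _).symm
  · refine (prodCell_snd _).trans ?_
    refine (cells_single_comp (sndTrans p) α' r₂).trans ?_
    exact (congrArg (_ ≫ ·) h₂.symm).trans (Category.assoc _ _ _).symm

variable (p) in
-- Restrictions are exactly the cells of cartesian arrows, and a conjunction of two cartesian arrows
-- is cartesian.
theorem bilProd_preservesRestrictions : (bilProd p).PreservesRestrictions := by
  have key {I' J' I J : B × B} {α' : (bilSq p).Loose I' J'} {f : I' ⟶ I}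
      {g : J' ⟶ J} {α : (bilSq p).Loose I J} (ρ : (bilSq p).Cell (.single α') f g α)
      (hρ : VDC.IsRestriction ((Bil p).prod (Bil p)) (α' := α') (α := α) (f := f) (g := g) ρ) :
      (Bil p).IsRestriction (α' := relProd α'.1 α'.2) (f := (prodHom p).tight.map f)
        (g := (prodHom p).tight.map g) (α := relProd α.1 α.2) (prodCell ρ) := by
    obtain ⟨ρ₁, ρ₂⟩ := ρ
    obtain ⟨r₁, rfl⟩ := exists_cellOf (p := p) (f := f.1) (g := g.1) (α' := α'.1) (α := α.1) ρ₁
    obtain ⟨r₂, rfl⟩ := exists_cellOf (p := p) (f := f.2) (g := g.2) (α' := α'.2) (α := α.2) ρ₂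
    obtain ⟨r, h₁, h₂, e⟩ := exists_prodCell_eq_cellOf r₁ r₂
    have := isStronglyCartesian_fst hρ
    have := isStronglyCartesian_snd hρ
    have := (isMeet_relProd α'.1 α'.2).isStronglyCartesian (isMeet_relProd α.1 α.2) r₁ r₂ r h₁ h₂
    rw [e]
    exact @isRestriction_cellOf B _ _ E _ p _ _ _ _ _ _ _ _ _ r this
  intro I' J' I J α' f g α ρ hρ
  exact key ρ hρ

/-! ### The product functor preserves composites -/

theorem isComposing_recast {I J : B} {P : LPath (Rel p) I J} {s : I ⟶ I} {t : J ⟶ J}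
    {γ : Rel p I J} (hs : s = 𝟙 I) (ht : t = 𝟙 J) {κ : (bilData p).Cell P s t γ}
    (H : IsStablyOpcart κ) : (Bil p).IsComposing ((bilData p).recast rfl hs ht κ) := by
  subst hs ht; exact isComposing_of_isStablyOpcart H

/-- Cells into ⊤ are unique, so a test cell ψ for the first component is paired with the cell into ⊤
in the second. This tests the composing property without whiskering, which suffices by
`isStablyOpcart_of_existsUnique`. -/
theorem isStablyOpcart_fst (H : IsElementaryExistential p) {I J : B × B}
    {P : LPath (bilSq p).Loose I J} {γ : (bilSq p).Loose I J}
    {κ : (bilSq p).Cell P (𝟙 I) (𝟙 J) γ}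
    (hκ : VDC.IsComposing ((Bil p).prod (Bil p)) κ) : IsStablyOpcart (p := p) κ.1 := by
  refine isStablyOpcart_of_existsUnique H (I := I.1) (J := J.1)
    (P := (looseMap ((bilData p).fst (bilData p))).path P) κ.1
    (R := (looseMap ((bilData p).fst (bilData p))).path (P.append (.nil J)))
    (LooseMap.path_append _ _ _) fun W ψ => ?_
  obtain ⟨ν, hν, hν'⟩ := hκ (.nil I) (.nil J) (𝟙 I) (𝟙 J) (W, ⊤_ (p.Fiber (I.2 ⨯ J.2)))
    (ψ, terminalLift p _ _)
  refine ⟨ν.1, congrArg (fun x => OverHom.hom (p := p) x.1) hν, fun χ h => ?_⟩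
  exact congrArg (fun x => x.1) (hν' (χ, ν.2) (Prod.ext (OverHom.ext (p := p) h)
    (terminal_overHom_ext p _ _)))

theorem isStablyOpcart_snd (H : IsElementaryExistential p) {I J : B × B}
    {P : LPath (bilSq p).Loose I J} {γ : (bilSq p).Loose I J}
    {κ : (bilSq p).Cell P (𝟙 I) (𝟙 J) γ}
    (hκ : VDC.IsComposing ((Bil p).prod (Bil p)) κ) : IsStablyOpcart (p := p) κ.2 := by
  refine isStablyOpcart_of_existsUnique H (I := I.2) (J := J.2)
    (P := (looseMap ((bilData p).snd (bilData p))).path P) κ.2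
    (R := (looseMap ((bilData p).snd (bilData p))).path (P.append (.nil J)))
    (LooseMap.path_append _ _ _) fun W ψ => ?_
  obtain ⟨ν, hν, hν'⟩ := hκ (.nil I) (.nil J) (𝟙 I) (𝟙 J) (⊤_ (p.Fiber (I.1 ⨯ J.1)), W)
    (terminalLift p _ _, ψ)
  refine ⟨ν.2, congrArg (fun x => OverHom.hom (p := p) x.2) hν, fun χ h => ?_⟩
  exact congrArg (fun x => x.2) (hν' (ν.1, χ) (Prod.ext (terminal_overHom_ext p _ _)
    (OverHom.ext (p := p) h)))

/-- The image of a composing pair is the conjunction, in separate variables, of its two stably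
opcartesian components. -/
theorem bilProd_preservesComposites (H : IsElementaryExistential p) :
    (bilProd p).PreservesComposites := by
  intro I J P γ κ hκ
  have h : IsStablyOpcart (prodCell (p := p) κ) :=
    (isStablyOpcart_fst H hκ).meet (isStablyOpcart_snd H hκ) (isProd_projections P) isProd_map
      (isMeet_projections P) (isMeet_relProd γ.1 γ.2) _ (prodCell_fst κ) (prodCell_snd κ)
  exact @isComposing_recast B _ _ E _ p _ _ _ _ _ _ _ ((prodHom p).tight.map_id I)
    ((prodHom p).tight.map_id J) _ h

/-- The diagonal functor has a right adjoint. -/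
theorem hasRightAdjoint_diag (H : IsElementaryExistential p) :
    (VDC.diag (Bil p)).HasRightAdjoint :=
  ⟨bilProd p, bilProd_preservesRestrictions p, bilProd_preservesComposites H, ⟨diagAdjunction p⟩⟩

/-- The bilateral virtual double category of an elementary existential fibration is a cartesian
equipment. -/
theorem isCartesianComposableFVDC_of_isElementaryExistential (H : IsElementaryExistential p) :
    (Bil p).IsCartesianComposableFVDC where
  fibrational := isFibrational_bil p
  composable := isComposable_of_isElementaryExistential H
  diag := hasRightAdjoint_diag H
  toTerminal := hasRightAdjoint_toTerminal p

end

end Fibration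

/-! ### The main theorem -/

theorem mainTheorem1 {B : Type u₁} [Category.{v₁} B] [HasFiniteProducts B] {E : Type u₂}
    [Category.{v₂} E] (p : E ⥤ B) [Fibration.IsCartesianFibration p] :
    Fibration.IsElementaryExistential p ↔ (Fibration.Bil p).IsCartesianComposableFVDC :=
  ⟨fun H => Fibration.isCartesianComposableFVDC_of_isElementaryExistential H,
    fun H => Fibration.isElementaryExistential_of_isComposable fun P => H.composable P⟩
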